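/- Let $d\ge 2$ be an integer, $a_0\in\mathbb R$, $h(x)=a_0-x^2$, and let $I=[l,r]$, $l<r$, be a compact interval with $h(I)\subset \operatorname{int} I$. Assume that $h$ is hyperbolic on $I$: it has finitely many hyperbolic attracting periodic points in $I$, and on the complement in $I$ of their basins of attraction $|(h^n)'|\ge C\sigma^n$ for all $n\ge 0$, with some $C>0$, $\sigma>1$. For $\alpha>0$ let $$\varphi_\alpha(\theta,x)=\big(d\theta \bmod 1,\; a_0+\alpha\sin(2\pi\theta)-x^2\big),\qquad (\theta,x)\in S^1\times I,\quad S^1=\mathbb R/\mathbb Z .$$ Then there is $\alpha_0>0$ such that for every $0<\alpha<\alpha_0$ the map $\varphi_\alpha$ sends $S^1\times I$ into itself and has a hyperbolic SRB measure supported in a proper attractor. Moreover, for each such $\alpha$ there is $\varepsilon>0$ such that the same holds for every skew product $\varphi$ that is $\varepsilon$-$C^3$-close to $\varphi_\alpha$. Here: * An *SRB measure* of $\varphi$ is an ergodic $\varphi$-invariant probability measure $\nu$ whose basin $\{z\in S^1\times I:\frac1n\sum_{j<n}\delta_{\varphi^j(z)}\to\nu \text{ weakly}^*\}$ has positive Lebesgue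 measure. * It is *hyperbolic* if its Lyapunov exponents are nonzero and not all of the same sign, i.e. there are $-\infty\le\chi_s<0<\chi_u<\infty$ such that at $\nu$-almost every $z$ all iterates of $\varphi$ are differentiable and, for some line $E_z\subset\mathbb R^2$, $\lim\frac1n\log\|D\varphi^n(z)v\|$ equals $\chi_s$ for $0\ne v\in E_z$ and $\chi_u$ for $v\notin E_z$. * It is *supported in a proper attractor* if $\nu(\mathcal G)=1$ for some $\mathcal G=\bigcap_{n\ge0}\varphi^n(S^1\times U)$, where $U$ is open, $\overline U\subsetneq I$ and $\varphi(S^1\times\overline U)\subset S^1\times U$. * $\varphi$ is *$\varepsilon$-$C^3$-close* to $\varphi_\alpha$ if there are $c_0<c_1<\dots<c_d=c_0+1$ and $C^3$ functions $G_i$, $F_i$ ($0\le i<d$) with $\varphi(t,x)=(G_i(t)\bmod 1,\,F_i(t,x))$ for $t\in(c_i,c_{i+1}]$, with $G_i(c_i)=c_0+i$, $G_i(c_{i+1})=c_0+i+1$, $\inf_{[c_i,c_{i+1}]}G_i'>1$, and such that, if $A_i$ is the increasing affine map of $[i/d,(i+1)/d]$ onto $[c_i,c_{i+1}]$, all derivatives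 of order $0,\dots,3$ of $G_i(A_i t)-dt$ and of $F_i(A_i t,x)-(a_0+\alpha\sin(2\pi t)-x^2)$ are smaller than $\varepsilon$ in norm for $t\in[i/d,(i+1)/d]$, $x\in I$. -/

import Mathlib

open MeasureTheory Set Filter Topology
open scoped BoundedContinuousFunction

namespace Viana

noncomputable section

/-- The cylinder `S¹ × ℝ`, where `S¹ = ℝ / ℤ`. Its `volume` is Lebesgue measure. -/
abbrev Cylinder : Type := UnitAddCircle × ℝ

/-- The quadratic map `h(x) = a₀ - x²`. -/
def quad (a₀ : ℝ) (x : ℝ) : ℝ := a₀ - x ^ 2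

theorem sin_two_pi_mul_periodic :
    Function.Periodic (fun t : ℝ => Real.sin (2 * Real.pi * t)) 1 := by
  intro t
  simp only [mul_add, mul_one, Real.sin_add_two_pi]

/-- The function `θ ↦ sin (2πθ)` on the circle `ℝ / ℤ`. -/
def circleSin : UnitAddCircle → ℝ := sin_two_pi_mul_periodic.lift

theorem circleSin_coe (t : ℝ) :
    circleSin (t : UnitAddCircle) = Real.sin (2 * Real.pi * t) := rfl

/-- The skew product `φ_α(θ, x) = (dθ mod 1, a₀ + α sin(2πθ) - x²)`. -/
def vianaMap (d : ℕ) (a₀ α : ℝ) (z : Cylinder) : Cylinder :=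
  (d • z.1, a₀ + α * circleSin z.1 - z.2 ^ 2)

/-! ### Hyperbolic interval maps -/

/-- The hyperbolic attracting periodic points of `h` in `I`. -/
def attractingPeriodicPts (h : ℝ → ℝ) (I : Set ℝ) : Set ℝ :=
  {p | p ∈ I ∧ ∃ n : ℕ, 0 < n ∧ h^[n] p = p ∧ |deriv (h^[n]) p| < 1}

/-- The union of the basins of attraction of the attracting periodic orbits of `h` in `I`. -/
def attractingBasin (h : ℝ → ℝ) (I : Set ℝ) : Set ℝ :=
  {x | x ∈ I ∧ ∃ p ∈ attractingPeriodicPts h I,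
    Tendsto (fun n : ℕ => dist (h^[n] x) (h^[n] p)) atTop (𝓝 0)}

/-- The map `h` is hyperbolic on the compact interval `I`: it has finitely many hyperbolic
attracting periodic points, and the complement of their basins of attraction is a hyperbolic
(uniformly expanding) set. -/
def IsHyperbolicOn (h : ℝ → ℝ) (I : Set ℝ) : Prop :=
  (attractingPeriodicPts h I).Finite ∧
    ∃ C : ℝ, 0 < C ∧ ∃ σ : ℝ, 1 < σ ∧
      ∀ x ∈ I \ attractingBasin h I, ∀ n : ℕ, C * σ ^ n ≤ |deriv (h^[n]) x|

/-! ### SRB measures -/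

/-- The basin of `ν` in `S¹ × I`: the points whose empirical measures
`(1/n) ∑_{j<n} δ_{φ^j z}` converge weakly to `ν`. -/
def basin (φ : Cylinder → Cylinder) (I : Set ℝ) (ν : Measure Cylinder) : Set Cylinder :=
  {z | z.2 ∈ I ∧ ∀ u : Cylinder →ᵇ ℝ,
    Tendsto (fun n : ℕ => (∑ j ∈ Finset.range n, u (φ^[j] z)) / (n : ℝ)) atTop
      (𝓝 (∫ w, u w ∂ν))}

/-- `ν` is an SRB measure of `φ` on `S¹ × I`: an ergodic invariant probability measure
whose basin has positive Lebesgue measure. -/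
structure IsSRB (φ : Cylinder → Cylinder) (I : Set ℝ) (ν : Measure Cylinder) : Prop where
  prob : IsProbabilityMeasure ν
  ergodic : Ergodic φ ν
  basin_pos : 0 < volume (basin φ I ν)

/-! ### Lyapunov exponents -/

/-- The covering map `ℝ × ℝ → S¹ × ℝ`. -/
def cover (p : ℝ × ℝ) : Cylinder := ((p.1 : UnitAddCircle), p.2)

/-- The map `ψ` of the cylinder is differentiable at `z` with derivative `L`, where tangent
spaces are identified with `ℝ × ℝ` through the covering: `L` is the derivative of a local lift of
`ψ`. Such an `L` is unique. -/
def HasCylinderDerivAt (ψ : Cylinder → Cylinder) (z : Cylinder)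
    (L : (ℝ × ℝ) →L[ℝ] (ℝ × ℝ)) : Prop :=
  ∃ (t : ℝ) (Ψ : ℝ × ℝ → ℝ × ℝ), (t : UnitAddCircle) = z.1 ∧
    (∀ᶠ p in 𝓝 (t, z.2), cover (Ψ p) = ψ (cover p)) ∧ HasFDerivAt Ψ L (t, z.2)

/-- `lim (1/n) log ‖L n v‖ = χ`, with `log 0 = -∞`. -/
def HasExponent (L : ℕ → (ℝ × ℝ) →L[ℝ] (ℝ × ℝ)) (v : ℝ × ℝ) (χ : EReal) : Prop :=
  Tendsto (fun n : ℕ => ENNReal.log ‖L n v‖ₑ / (n : EReal)) atTop (𝓝 χ)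

/-- The (ergodic) measure `ν` is hyperbolic: its Lyapunov exponents are nonzero and not all of
the same sign. As the cylinder is two-dimensional, there is one negative exponent `χs` (possibly
`-∞`, since `φ` has critical points), attained along a line `E` of the tangent space at `z`, and one
positive exponent `χu`, attained at all tangent vectors outside `E`. -/
def IsHyperbolicMeasure (φ : Cylinder → Cylinder) (ν : Measure Cylinder) : Prop :=
  ∃ (χs : EReal) (χu : ℝ), χs < 0 ∧ 0 < χu ∧
    ∀ᵐ z ∂ν, ∃ L : ℕ → (ℝ × ℝ) →L[ℝ] (ℝ × ℝ),
      (∀ n, HasCylinderDerivAt (φ^[n]) z (L n)) ∧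
      ∃ E : Submodule ℝ (ℝ × ℝ), Module.finrank ℝ E = 1 ∧
        (∀ v ∈ E, v ≠ 0 → HasExponent L v χs) ∧
        (∀ v ∉ E, HasExponent L v (χu : EReal))

/-! ### Attractors -/

/-- `𝒢` is a proper attractor of `φ` in `S¹ × I`: it is the maximal invariant set
`⋂ φⁿ(S¹ × U)` of a trapping region `S¹ × U`, with `U` open and `φ (S¹ × closure U) ⊆ S¹ × U`,
which is not dense in `S¹ × I`. -/
def IsProperAttractor (φ : Cylinder → Cylinder) (I : Set ℝ) (𝒢 : Set Cylinder) : Prop :=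
  ∃ U : Set ℝ, IsOpen U ∧ closure U ⊂ I ∧
    MapsTo φ (univ ×ˢ closure U) (univ ×ˢ U) ∧
    𝒢 = ⋂ n : ℕ, φ^[n] '' (univ ×ˢ U)

/-- `φ` maps `S¹ × I` into itself and has a hyperbolic SRB measure supported in a proper
attractor. -/
def HasHyperbolicSRBOnProperAttractor (φ : Cylinder → Cylinder) (I : Set ℝ) : Prop :=
  MapsTo φ (univ ×ˢ I) (univ ×ˢ I) ∧
  ∃ ν : Measure Cylinder, IsSRB φ I ν ∧ IsHyperbolicMeasure φ ν ∧
    ∃ 𝒢 : Set Cylinder, IsProperAttractor φ I 𝒢 ∧ ∀ᵐ z ∂ν, z ∈ 𝒢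

/-! ### `C³`-closeness -/

/-- The affine map taking `[i/d, (i+1)/d]` to `[c i, c (i+1)]`. -/
def rescale (d : ℕ) (c : ℕ → ℝ) (i : ℕ) (t : ℝ) : ℝ :=
  c i + (c (i + 1) - c i) / (1 / (d : ℝ)) * (t - (i : ℝ) / d)

/-- The circle is cut into the arcs `(c i, c (i+1)]`, `i < d`; on the strip over the `i`-th arc,
`φ` is the skew product `(t, x) ↦ (G i t mod 1, F i (t, x))`, with `C³` maps up to the boundary;
`G i` is uniformly expanding and maps the arc onto the whole circle cut at `c 0`; after rescaling the
arcs to `(i/d, (i+1)/d]`, the maps `G i` and `F i` are `ε`-close in `C³` to the ones defining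
`φ_α`, over `x ∈ I`. -/
structure IsC3CloseVia (d : ℕ) (a₀ α ε : ℝ) (I : Set ℝ) (φ : Cylinder → Cylinder)
    (c : ℕ → ℝ) (G : ℕ → ℝ → ℝ) (F : ℕ → ℝ × ℝ → ℝ) : Prop where
  partition_total : c d = c 0 + 1
  partition_lt : ∀ i < d, c i < c (i + 1)
  map_eq : ∀ i < d, ∀ t ∈ Ioc (c i) (c (i + 1)), ∀ x : ℝ,
    φ ((t : UnitAddCircle), x) = ((G i t : UnitAddCircle), F i (t, x))
  markov_left : ∀ i < d, G i (c i) = c 0 + i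
  markov_right : ∀ i < d, G i (c (i + 1)) = c 0 + i + 1
  smooth_base : ∀ i < d, ContDiff ℝ 3 (G i)
  smooth_fiber : ∀ i < d, ContDiff ℝ 3 (F i)
  expanding : ∃ σ : ℝ, 1 < σ ∧ ∀ i < d, ∀ t ∈ Icc (c i) (c (i + 1)), σ ≤ deriv (G i) t
  close_base : ∀ i < d, ∀ k ≤ 3, ∀ t ∈ Icc ((i : ℝ) / d) ((i + 1 : ℝ) / d),
    |iteratedDeriv k (fun s => G i (rescale d c i s) - d * s) t| < ε
  close_fiber : ∀ i < d, ∀ k ≤ 3, ∀ t ∈ Icc ((i : ℝ) / d) ((i + 1 : ℝ) / d), ∀ x ∈ I,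
    ‖iteratedFDeriv ℝ k (fun p : ℝ × ℝ => F i (rescale d c i p.1, p.2)
      - (a₀ + α * Real.sin (2 * Real.pi * p.1) - p.2 ^ 2)) (t, x)‖ < ε

/-- The skew product `φ` is `ε`-`C³`-close to `φ_α` over `S¹ × I`. The fibre maps may be
discontinuous at the end points of the arcs. For `c 0 = 0` these are the piecewise `C³` perturbations
of `φ_α` on `(0, 1] × I`. The base point `c 0` may move, so the `C³` skew products of `S¹ × I` that
are `C³`-close to `φ_α` on the circle are included too: cut at the fixed point of the base map
near `0`. -/
def IsC3Close (d : ℕ) (a₀ α ε : ℝ) (I : Set ℝ) (φ : Cylinder → Cylinder) : Prop :=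
  ∃ (c : ℕ → ℝ) (G : ℕ → ℝ → ℝ) (F : ℕ → ℝ × ℝ → ℝ), IsC3CloseVia d a₀ α ε I φ c G F

end

end Viana

/-! The theorem reduces to skew products that contract fibres over an expanding base. If `h` had no
attracting periodic point in `I`, the basins would be empty and `|(h^n)'| ≥ Cσ^n` would hold on all
of `I`, which the mean value theorem forbids because `h^n` maps `I` into itself
(`exists_attractingPeriodicPt`). Around an attracting orbit `p j`, with `j` in `ZMod k`, there are
widths `ω j` such that `h` maps the `j`-th interval strictly into the next one and contracts by `κ <
1` after each interval is scaled to `[-1, 1]` (`exists_weights`, `exists_trapping_strips`). Both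
properties survive a perturbation of size `η` of the values of `h` and of its derivative. The
forcing `α sin` and the `ε`-perturbation together stay within `η` as soon as `α + ε ≤ η`. This turns
the strips over the circle into a `ContractingSkewProduct`.

The base is a piecewise `C²` expanding map `T` with full branches. Its transfer operator maps a cone
of densities with Lipschitz logarithm into itself. A fixed multiple of the constant density can be
split off at every step with a remainder in the cone, so distances between normalized densities
decay geometrically (`exists_transfer_contraction`). Hence there is an invariant measure equivalent
to Lebesgue measure and ergodic for every power of `T` (`exists_ergodic_measure`). Ergodicity of
`T^k` makes `(θ, j) ↦ (T θ, j + 1)` ergodic on the product with `ZMod k` (`ergodic_prod_add_one`).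

Over this ergodic base, fibre contraction yields exactly one invariant measure, which is therefore
ergodic (`exists_ergodic_skewProduct`). Points of one fibre have asymptotic orbits, so almost every
fibre consists of generic points (`ae_forall_tendsto_birkhoffSum`). Pushed to the cylinder, this
gives a basin that contains almost all of the strip around `p 0`.

The derivative is triangular. Vertical vectors are multiplied by the fibre derivatives, with
exponent at most `log κ`. The exponent may be `-∞` because of the critical point, hence a version of
Birkhoff's theorem for functions with values in `[0, ∞]`. All other vectors grow like the base
derivative, with exponent at least `log σ > 0` (`isHyperbolicMeasure`). -/

namespace Viana

/-! ### Birkhoff's ergodic theorem -/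

section Birkhoff

variable {X : Type*} {T : X → X}

/-- The maximum of `0` and the first `n` Birkhoff sums. -/
noncomputable def maxSum (T : X → X) (f : X → ℝ) : ℕ → X → ℝ
  | 0, _ => 0
  | n + 1, x => max 0 (f x + maxSum T f n (T x))

theorem maxSum_nonneg (f : X → ℝ) (n : ℕ) (x : X) : 0 ≤ maxSum T f n x := by
  cases n with
  | zero => exact le_rfl
  | succ n => exact le_max_left _ _

theorem maxSum_le_succ (f : X → ℝ) (n : ℕ) (x : X) : maxSum T f n x ≤ maxSum T f (n + 1) x := by
  induction n generalizing x with
  | zero => exact le_max_left _ _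
  | succ n ih => exact max_le_max le_rfl (by have := ih (T x); gcongr)

theorem birkhoffSum_le_maxSum (f : X → ℝ) (n : ℕ) (x : X) :
    birkhoffSum T f n x ≤ maxSum T f n x := by
  induction n generalizing x with
  | zero => simp [maxSum]
  | succ n ih =>
    rw [birkhoffSum_succ']
    exact le_max_of_le_right (by have := ih (T x); gcongr)

variable [MeasurableSpace X] {μ : Measure X}

theorem measurable_maxSum (hT : Measurable T) {f : X → ℝ} (hf : Measurable f) (n : ℕ) :
    Measurable (maxSum T f n) := by
  induction n with
  | zero => exact measurable_const
  | succ n ih => exact measurable_const.max (hf.add (ih.comp hT))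

theorem measurable_birkhoffSum {M : Type*} [AddCommMonoid M] [MeasurableSpace M]
    [MeasurableAdd₂ M] (hT : Measurable T) {f : X → M} (hf : Measurable f) (n : ℕ) :
    Measurable (birkhoffSum T f n) :=
  Finset.measurable_fun_sum _ fun k _ => hf.comp (hT.iterate k)

theorem integrable_maxSum [IsFiniteMeasure μ] (hT : MeasurePreserving T μ μ) {f : X → ℝ}
    (hf : Integrable f μ) (n : ℕ) : Integrable (maxSum T f n) μ := by
  induction n with
  | zero => exact integrable_const _
  | succ n ih =>
    exact (integrable_const (0 : ℝ)).sup (hf.add (hT.integrable_comp_of_integrable ih))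

/-- If `f` has negative mean, its Birkhoff sums are almost everywhere bounded above. -/
theorem ae_bddAbove_birkhoffSum [IsProbabilityMeasure μ] (hT : Ergodic T μ) {f : X → ℝ}
    (hfm : Measurable f) (hf : Integrable f μ) (hneg : ∫ x, f x ∂μ < 0) :
    ∀ᵐ x ∂μ, BddAbove (range fun n => birkhoffSum T f n x) := by
  have hA : MeasurableSet {x | BddAbove (range fun n => birkhoffSum T f n x)} :=
    measurableSet_bddAbove_range fun n => measurable_birkhoffSum hT.measurable hfm n
  have hinv : T ⁻¹' {x | BddAbove (range fun n => birkhoffSum T f n x)} =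
      {x | BddAbove (range fun n => birkhoffSum T f n x)} := by
    ext x
    simp only [mem_preimage, mem_ofPred_eq, bddAbove_def, forall_mem_range]
    constructor
    · rintro ⟨B, hB⟩
      refine ⟨max 0 (f x + B), fun n => ?_⟩
      cases n with
      | zero => simp
      | succ n =>
        rw [birkhoffSum_succ']
        exact le_max_of_le_right (by have := hB n; gcongr)
    · rintro ⟨B, hB⟩
      refine ⟨B - f x, fun n => ?_⟩
      have := hB (n + 1)
      rw [birkhoffSum_succ'] at this
      linarith
  rcases hT.toPreErgodic.ae_mem_or_ae_notMem hA hinv with h | h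
  · exact h
  exfalso
  -- The integrand is `maxSum (n + 1) - maxSum n ∘ T`. If the Birkhoff sums are almost everywhere
  -- unbounded, it becomes equal to `f` for large `n`, and `|f|` dominates it because `maxSum` is
  -- nonnegative.
  have hlim : Tendsto (fun n => ∫ x, max (-maxSum T f n (T x)) (f x) ∂μ) atTop
      (𝓝 (∫ x, f x ∂μ)) := by
    refine tendsto_integral_of_dominated_convergence (fun x => |f x|) (fun n => ?_) hf.abs
      (fun n => .of_forall fun x => ?_) ?_
    · exact (((measurable_maxSum hT.measurable hfm n).comp hT.measurable).neg.max
        hfm).aestronglyMeasurable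
    · have := maxSum_nonneg (T := T) f n (T x)
      rw [Real.norm_eq_abs]
      rcases le_total (-maxSum T f n (T x)) (f x) with h1 | h1
      · rw [max_eq_right h1]
      · rw [max_eq_left h1, abs_of_nonpos (by linarith), abs_of_nonpos (by linarith)]
        linarith
    · filter_upwards [h] with x hx
      have hmono : Monotone fun n => maxSum T f n (T x) :=
        monotone_nat_of_le_succ fun n => maxSum_le_succ f n (T x)
      have hx' : ¬ BddAbove (range fun n => maxSum T f n (T x)) := by
        rintro ⟨B, hB⟩
        have hx2 : T x ∉ {x | BddAbove (range fun n => birkhoffSum T f n x)} := by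
          rwa [← mem_preimage, hinv]
        exact hx2 ⟨B, forall_mem_range.2 fun n =>
          (birkhoffSum_le_maxSum f n (T x)).trans (hB (mem_range_self n))⟩
      have ht := tendsto_atTop_of_monotone hmono
      have htop : Tendsto (fun n => maxSum T f n (T x)) atTop atTop :=
        tendsto_atTop_mono' _ .rfl (tendsto_atTop_atTop_of_monotone hmono fun b => by
          by_contra! hb
          exact hx' ⟨b, forall_mem_range.2 fun n => (hb n).le⟩)
      refine tendsto_const_nhds.congr' ?_
      filter_upwards [htop.eventually_ge_atTop (-f x)] with n hn
      rw [max_eq_right (by linarith)]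
  -- By invariance the integral is `∫ maxSum (n + 1) - ∫ maxSum n`, which is nonnegative by
  -- monotonicity. So the limit `∫ f` could not be negative.
  have hnn : ∀ n, 0 ≤ ∫ x, max (-maxSum T f n (T x)) (f x) ∂μ := by
    intro n
    have hi := integrable_maxSum hT.toMeasurePreserving hf
    have hc : Integrable (fun x => maxSum T f n (T x)) μ :=
      hT.toMeasurePreserving.integrable_comp_of_integrable (hi n)
    have h1 : ∀ x, max (-maxSum T f n (T x)) (f x) = maxSum T f (n + 1) x - maxSum T f n (T x) := by
      intro x
      rw [maxSum, max_sub_sub_right 0 (f x + maxSum T f n (T x)) (maxSum T f n (T x)) |>.symm]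
      simp
    simp_rw [h1]
    rw [integral_sub (hi (n + 1)) hc]
    have h2 : ∫ x, maxSum T f n (T x) ∂μ = ∫ x, maxSum T f n x ∂μ := by
      have := integral_map (μ := μ) hT.measurable.aemeasurable
        (f := maxSum T f n) (measurable_maxSum hT.measurable hfm n).aestronglyMeasurable
      rw [hT.toMeasurePreserving.map_eq] at this
      exact this.symm
    rw [h2, sub_nonneg]
    exact integral_mono (hi n) (hi (n + 1)) fun x => maxSum_le_succ f n x
  exact absurd (ge_of_tendsto' hlim hnn) (not_le.2 hneg)

/-- For `c'` strictly between the mean and `c`, the function `f - c'` has negative mean, so its sums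
have an upper bound `B`. The averages of `f` are then at most `c' + B / n`. -/
theorem ae_eventually_birkhoffSum_div_le [IsProbabilityMeasure μ] (hT : Ergodic T μ) {f : X → ℝ}
    (hfm : Measurable f) (hf : Integrable f μ) {c : ℝ} (hc : ∫ x, f x ∂μ < c) :
    ∀ᵐ x ∂μ, ∀ᶠ n : ℕ in atTop, birkhoffSum T f n x / n < c := by
  obtain ⟨c', h1, h2⟩ := exists_between hc
  have := ae_bddAbove_birkhoffSum hT (f := fun x => f x - c') (hfm.sub_const _)
    (hf.sub (integrable_const _)) (by
      rw [integral_sub hf (integrable_const _)]; simpa using h1)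
  filter_upwards [this] with x ⟨B, hB⟩
  have hB' : ∀ n : ℕ, birkhoffSum T f n x ≤ B + n * c' := by
    intro n
    have := hB (mem_range_self n)
    simp only [birkhoffSum, Finset.sum_sub_distrib, Finset.sum_const, Finset.card_range,
      nsmul_eq_mul] at this ⊢
    linarith
  have hlim : Tendsto (fun n : ℕ => B / (n : ℝ)) atTop (𝓝 0) :=
    tendsto_const_div_atTop_nhds_zero_nat B
  filter_upwards [hlim.eventually_lt_const (sub_pos.2 h2), eventually_gt_atTop 0] with n hn hn0
  have hn0' : (0 : ℝ) < n := by exact_mod_cast hn0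
  rw [div_lt_iff₀ hn0'] at hn ⊢
  linarith [hB' n, mul_comm (n : ℝ) c']

/-- **Birkhoff's ergodic theorem** for ergodic maps. -/
theorem ae_tendsto_birkhoffSum_div [IsProbabilityMeasure μ] (hT : Ergodic T μ) {f : X → ℝ}
    (hfm : Measurable f) (hf : Integrable f μ) :
    ∀ᵐ x ∂μ, Tendsto (fun n : ℕ => birkhoffSum T f n x / n) atTop (𝓝 (∫ x, f x ∂μ)) := by
  have h1 : ∀ᵐ x ∂μ, ∀ m : ℕ, ∀ᶠ n : ℕ in atTop,
      birkhoffSum T f n x / n < ∫ x, f x ∂μ + 1 / (m + 1) :=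
    ae_all_iff.2 fun m => ae_eventually_birkhoffSum_div_le hT hfm hf (by
      have : (0 : ℝ) < 1 / (m + 1) := Nat.one_div_pos_of_nat
      linarith)
  have h2 : ∀ᵐ x ∂μ, ∀ m : ℕ, ∀ᶠ n : ℕ in atTop,
      birkhoffSum T (fun x => - f x) n x / n < ∫ x, - f x ∂μ + 1 / (m + 1) :=
    ae_all_iff.2 fun m => ae_eventually_birkhoffSum_div_le hT hfm.neg hf.neg (by
      have : (0 : ℝ) < 1 / (m + 1) := Nat.one_div_pos_of_nat
      simpa using Nat.cast_add_one_pos m)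
  filter_upwards [h1, h2] with x hx1 hx2
  refine tendsto_order.2 ⟨fun a ha => ?_, fun a ha => ?_⟩
  · obtain ⟨m, hm⟩ := exists_nat_one_div_lt (sub_pos.2 ha)
    filter_upwards [hx2 m] with n hn
    simp only [birkhoffSum, Finset.sum_neg_distrib, integral_neg, neg_div] at hn ⊢
    linarith
  · obtain ⟨m, hm⟩ := exists_nat_one_div_lt (sub_pos.2 ha)
    filter_upwards [hx1 m] with n hn
    linarith

/-- Birkhoff's ergodic theorem for functions with values in `[0, ∞]`. -/
theorem ae_tendsto_birkhoffSum_div_ennreal [IsProbabilityMeasure μ] (hT : Ergodic T μ)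
    {f : X → ENNReal} (hfm : Measurable f) :
    ∀ᵐ x ∂μ, Tendsto (fun n : ℕ => birkhoffSum T f n x / n) atTop (𝓝 (∫⁻ x, f x ∂μ)) := by
  have key : ∀ g : X → ENNReal, Measurable g → ∫⁻ x, g x ∂μ ≠ ⊤ →
      ∀ᵐ x ∂μ, Tendsto (fun n : ℕ => birkhoffSum T g n x / n) atTop (𝓝 (∫⁻ x, g x ∂μ)) := by
    intro g hg hfin
    have hint : Integrable (fun x => (g x).toReal) μ :=
      integrable_toReal_of_lintegral_ne_top hg.aemeasurable hfin
    have h0 : ∀ᵐ x ∂μ, ∀ n : ℕ, g (T^[n] x) < ⊤ := ae_all_iff.2 fun n =>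
      (hT.toMeasurePreserving.iterate n).quasiMeasurePreserving.ae (ae_lt_top hg hfin)
    filter_upwards [ae_tendsto_birkhoffSum_div hT hg.ennreal_toReal hint, h0] with x hx hx0
    rw [integral_toReal hg.aemeasurable (ae_lt_top hg hfin)] at hx
    have := ENNReal.tendsto_ofReal hx
    rw [ENNReal.ofReal_toReal hfin] at this
    refine this.congr' ?_
    filter_upwards [eventually_gt_atTop 0] with n hn
    rw [ENNReal.ofReal_div_of_pos (by exact_mod_cast hn), ENNReal.ofReal_natCast, birkhoffSum,
      ENNReal.ofReal_sum_of_nonneg fun _ _ => ENNReal.toReal_nonneg]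
    congr 1
    exact Finset.sum_congr rfl fun j _ => ENNReal.ofReal_toReal (hx0 j).ne
  by_cases hfin : ∫⁻ x, f x ∂μ = ⊤
  -- If the integral is infinite, the truncations `min f m` have finite integrals that increase to
  -- `∞`. The averages of `f` dominate theirs.
  · have hmin : ∀ m : ℕ, ∫⁻ x, min (f x) m ∂μ ≠ ⊤ := fun m => ne_top_of_le_ne_top
      (ENNReal.natCast_ne_top m) ((lintegral_mono fun x => min_le_right _ _).trans (by simp))
    have hall : ∀ᵐ x ∂μ, ∀ m : ℕ, Tendsto (fun n : ℕ =>
        birkhoffSum T (fun x => min (f x) m) n x / n) atTop (𝓝 (∫⁻ x, min (f x) m ∂μ)) :=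
      ae_all_iff.2 fun m => key _ (hfm.min measurable_const) (hmin m)
    have hsup : ⨆ m : ℕ, ∫⁻ x, min (f x) m ∂μ = ⊤ := by
      rw [← lintegral_iSup (fun m => hfm.min measurable_const)
        (fun m m' h x => min_le_min le_rfl (by exact_mod_cast h)), ← hfin]
      refine lintegral_congr fun x => ?_
      have := inf_iSup_eq (f x) (fun m : ℕ => (m : ENNReal))
      rw [ENNReal.iSup_natCast] at this
      simpa using this.symm
    filter_upwards [hall] with x hx
    rw [hfin]
    refine tendsto_order.2 ⟨fun a ha => ?_, fun a ha => absurd ha not_top_lt⟩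
    obtain ⟨m, hm⟩ := lt_iSup_iff.1 (hsup ▸ ha)
    filter_upwards [(hx m).eventually_const_lt hm] with n hn
    refine hn.trans_le (ENNReal.div_le_div_right ?_ _)
    exact Finset.sum_le_sum fun j _ => min_le_left _ _
  · exact key f hfm hfin

end Birkhoff

/-! ### Invariant measures of skew products with contracting fibres -/

/-- Continuous mapping theorem: weak convergence is preserved by a map that is continuous off a
closed null set. -/
theorem tendsto_map_of_continuousAt_compl {Ω ι : Type*} [MeasurableSpace Ω] [TopologicalSpace Ω]
    [OpensMeasurableSpace Ω] [HasOuterApproxClosed Ω] {L : Filter ι} [L.IsCountablyGenerated]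
    {νs : ι → ProbabilityMeasure Ω} {ν : ProbabilityMeasure Ω} (h : Tendsto νs L (𝓝 ν))
    {Φ : Ω → Ω} (hΦ : Measurable Φ) {C : Set Ω} (hC : IsClosed C) (hC0 : (ν : Measure Ω) C = 0)
    (hcont : ∀ z ∉ C, ContinuousAt Φ z) :
    Tendsto (fun i => (νs i).map hΦ.aemeasurable) L (𝓝 (ν.map hΦ.aemeasurable)) := by
  refine tendsto_of_forall_isClosed_limsup_le' fun F hF => ?_
  -- A limit point of the preimage of `F` that is missing from it must lie in `C`. Adding `C` gives
  -- a closed set at no cost in `ν`-measure.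
  have hcl : IsClosed (Φ ⁻¹' F ∪ C) := by
    rw [← isOpen_compl_iff, isOpen_iff_mem_nhds]
    intro z hz
    simp only [mem_compl_iff, mem_union, mem_preimage, not_or] at hz
    filter_upwards [hC.isOpen_compl.mem_nhds hz.2,
      (hcont z hz.2).preimage_mem_nhds (hF.isOpen_compl.mem_nhds hz.1)] with w h1 h2
    simpa only [mem_compl_iff, mem_union, mem_preimage, not_or] using And.intro h2 h1
  have h1 := ProbabilityMeasure.limsup_measure_closed_le_of_tendsto h hcl
  have h2 : (ν : Measure Ω) (Φ ⁻¹' F ∪ C) ≤ (ν : Measure Ω) (Φ ⁻¹' F) :=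
    (measure_union_le _ _).trans (by rw [hC0, add_zero])
  simp only [ProbabilityMeasure.toMeasure_map _ hΦ.aemeasurable,
    Measure.map_apply hΦ hF.measurableSet]
  refine le_trans ?_ (h1.trans h2)
  exact limsup_le_limsup (.of_forall fun i => measure_mono subset_union_left)

section SkewProduct

variable {X D : Type*} {T : X → X} {Φ : X × D → X × D}

theorem iterate_fst (hbase : ∀ z, (Φ z).1 = T z.1) (n : ℕ) (z : X × D) :
    (Φ^[n] z).1 = T^[n] z.1 := by
  induction n generalizing z with
  | zero => rfl
  | succ n ih => rw [Function.iterate_succ_apply, ih, hbase, Function.iterate_succ_apply]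

variable [MetricSpace X] [MetricSpace D]

/-- The two orbits always share their base point, so the sup metric of the product sees only the
distance in the fibre. -/
theorem dist_iterate_le (hbase : ∀ z, (Φ z).1 = T z.1) {κ : ℝ} (hκ : 0 ≤ κ)
    (hfib : ∀ b y y', dist (Φ (b, y)).2 (Φ (b, y')).2 ≤ κ * dist y y') (n : ℕ) (b : X) (y y' : D) :
    dist (Φ^[n] (b, y)) (Φ^[n] (b, y')) ≤ κ ^ n * dist y y' := by
  induction n generalizing b y y' with
  | zero => simp [Prod.dist_eq]
  | succ n ih =>
    rw [Function.iterate_succ_apply, Function.iterate_succ_apply]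
    have h1 : ∀ y, Φ (b, y) = (T b, (Φ (b, y)).2) := fun y => Prod.ext (hbase _) rfl
    rw [h1 y, h1 y']
    calc _ ≤ κ ^ n * dist (Φ (b, y)).2 (Φ (b, y')).2 := ih _ _ _
      _ ≤ κ ^ n * (κ * dist y y') := by gcongr; exact hfib _ _ _
      _ = κ ^ (n + 1) * dist y y' := by ring

variable [CompactSpace X] [CompactSpace D]

/-- The orbits of two points of the same fibre are asymptotic, uniformly. -/
theorem exists_forall_dist_iterate_lt (hbase : ∀ z, (Φ z).1 = T z.1) {κ : ℝ} (hκ : 0 ≤ κ)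
    (hκ1 : κ < 1) (hfib : ∀ b y y', dist (Φ (b, y)).2 (Φ (b, y')).2 ≤ κ * dist y y')
    {u : X × D → ℝ} (hu : Continuous u) {ε : ℝ} (hε : 0 < ε) :
    ∃ N, ∀ n ≥ N, ∀ b y y', |u (Φ^[n] (b, y)) - u (Φ^[n] (b, y'))| < ε := by
  obtain ⟨δ, hδ, hu⟩ := Metric.uniformContinuous_iff.1
    (CompactSpace.uniformContinuous_of_continuous hu) ε hε
  have hlim : Tendsto (fun n : ℕ => κ ^ n * Metric.diam (univ : Set D)) atTop (𝓝 0) := by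
    simpa using (tendsto_pow_atTop_nhds_zero_of_lt_one hκ hκ1).mul_const _
  obtain ⟨N, hN⟩ := eventually_atTop.1 (hlim.eventually_lt_const hδ)
  refine ⟨N, fun n hn b y y' => hu (lt_of_le_of_lt ?_ (hN n hn))⟩
  refine (dist_iterate_le hbase hκ hfib n b y y').trans ?_
  gcongr
  exact Metric.dist_le_diam_of_mem isCompact_univ.isBounded (mem_univ _) (mem_univ _)

variable [MeasurableSpace X] [BorelSpace X] [MeasurableSpace D] [BorelSpace D]
  {μ : Measure X}

/-- By invariance `∫ u ∂ν = ∫ u ∘ Φ^n ∂ν`, and moving the fibre coordinate to `y₀` changes `u ∘ Φ^n`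
uniformly little. The limit is thus computed from `μ` alone, which is the source of uniqueness. -/
theorem tendsto_integral_iterate (hbase : ∀ z, (Φ z).1 = T z.1) {κ : ℝ} (hκ : 0 ≤ κ)
    (hκ1 : κ < 1) (hfib : ∀ b y y', dist (Φ (b, y)).2 (Φ (b, y')).2 ≤ κ * dist y y')
    {ν : Measure (X × D)} [IsProbabilityMeasure ν] (hν : MeasurePreserving Φ ν ν)
    (hπ : ν.map Prod.fst = μ) (y₀ : D) (u : X × D →ᵇ ℝ) :
    Tendsto (fun n => ∫ b, u (Φ^[n] (b, y₀)) ∂μ) atTop (𝓝 (∫ z, u z ∂ν)) := by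
  rw [Metric.tendsto_atTop]
  intro ε hε
  obtain ⟨N, hN⟩ := exists_forall_dist_iterate_lt hbase hκ hκ1 hfib u.continuous (half_pos hε)
  refine ⟨N, fun n hn => ?_⟩
  have hm : Measurable fun b : X => u (Φ^[n] (b, y₀)) :=
    u.continuous.measurable.comp ((hν.measurable.iterate n).comp measurable_prodMk_right)
  have h1 : ∫ b, u (Φ^[n] (b, y₀)) ∂μ = ∫ z, u (Φ^[n] (z.1, y₀)) ∂ν := by
    rw [← hπ, integral_map measurable_fst.aemeasurable hm.aestronglyMeasurable]
  have h2 : ∫ z, u z ∂ν = ∫ z, u (Φ^[n] z) ∂ν := by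
    have h := hν.iterate n
    conv_lhs => rw [← h.map_eq]
    exact integral_map h.measurable.aemeasurable u.continuous.measurable.aestronglyMeasurable
  have hb : ∀ f : X × D → X × D, Measurable f → Integrable (fun z => u (f z)) ν := fun f hf =>
    Integrable.of_bound (u.continuous.measurable.comp hf).aestronglyMeasurable ‖u‖
      (.of_forall fun z => u.norm_coe_le_norm _)
  have h3 : Integrable (fun z : X × D => u (Φ^[n] (z.1, y₀))) ν :=
    hb _ ((hν.measurable.iterate n).comp (measurable_fst.prodMk measurable_const))
  rw [h1, h2, Real.dist_eq, ← integral_sub h3 (hb _ (hν.measurable.iterate n))]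
  have := norm_integral_le_of_norm_le_const (μ := ν) (C := ε / 2)
    (f := fun z : X × D => u (Φ^[n] (z.1, y₀)) - u (Φ^[n] z))
    (.of_forall fun z => (hN n hn z.1 y₀ z.2).le)
  rw [Real.norm_eq_abs, probReal_univ, mul_one] at this
  linarith

/-- Over a given invariant measure of the base, a skew product with contracting fibres has at most
one invariant measure. -/
theorem eq_of_map_fst_eq (hbase : ∀ z, (Φ z).1 = T z.1) {κ : ℝ} (hκ : 0 ≤ κ)
    (hκ1 : κ < 1) (hfib : ∀ b y y', dist (Φ (b, y)).2 (Φ (b, y')).2 ≤ κ * dist y y')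
    {ν ν' : Measure (X × D)} [IsProbabilityMeasure ν] [IsProbabilityMeasure ν']
    (hν : MeasurePreserving Φ ν ν) (hν' : MeasurePreserving Φ ν' ν')
    (hπ : ν.map Prod.fst = μ) (hπ' : ν'.map Prod.fst = μ) : ν = ν' := by
  have : Nonempty D := ⟨(nonempty_of_isProbabilityMeasure ν).some.2⟩
  exact ext_of_forall_integral_eq_of_IsFiniteMeasure fun u => tendsto_nhds_unique
    (tendsto_integral_iterate hbase hκ hκ1 hfib hν hπ (Classical.arbitrary D) u)
    (tendsto_integral_iterate hbase hκ hκ1 hfib hν' hπ' (Classical.arbitrary D) u)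

/-- The measure is a weak limit of the images of `μ` on the section `y = y₀` under `Φ^n`. The
discontinuities over `S` do not matter because every limit projects to `μ`. -/
theorem exists_invariant_skewProduct [IsProbabilityMeasure μ] [Nonempty D] (hT : MeasurePreserving T μ μ)
    (hΦ : Measurable Φ) (hbase : ∀ z, (Φ z).1 = T z.1) {κ : ℝ} (hκ : 0 ≤ κ)
    (hκ1 : κ < 1) (hfib : ∀ b y y', dist (Φ (b, y)).2 (Φ (b, y')).2 ≤ κ * dist y y')
    {S : Set X} (hS : IsClosed S) (hS0 : μ S = 0) (hcont : ∀ z : X × D, z.1 ∉ S → ContinuousAt Φ z) :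
    ∃ ν : Measure (X × D), IsProbabilityMeasure ν ∧ MeasurePreserving Φ ν ν ∧
      ν.map Prod.fst = μ := by
  obtain ⟨y₀⟩ := ‹Nonempty D›
  let f : ℕ → X → X × D := fun n b => Φ^[n] (b, y₀)
  have hf : ∀ n, Measurable (f n) := fun n => (hΦ.iterate n).comp measurable_prodMk_right
  let νs : ℕ → ProbabilityMeasure (X × D) := fun n =>
    ProbabilityMeasure.map (⟨μ, inferInstance⟩ : ProbabilityMeasure X) (hf n).aemeasurable
  have hνs : ∀ n, (νs n : Measure (X × D)) = μ.map (f n) := fun n =>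
    ProbabilityMeasure.toMeasure_map _ (hf n).aemeasurable
  obtain ⟨ν, s, hs, hlim⟩ := CompactSpace.tendsto_subseq νs
  have hπ : (ν : Measure (X × D)).map Prod.fst = μ := by
    have h1 := ProbabilityMeasure.tendsto_map_of_tendsto_of_continuous _ _ hlim
      (continuous_fst : Continuous (Prod.fst : X × D → X))
    have h2 : ∀ n, (νs n).map (measurable_fst.aemeasurable : AEMeasurable (Prod.fst : X × D → X) _) =
        ⟨μ, inferInstance⟩ := by
      intro n
      apply ProbabilityMeasure.toMeasure_injective
      rw [ProbabilityMeasure.toMeasure_map _ measurable_fst.aemeasurable, hνs,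
        Measure.map_map measurable_fst (hf n)]
      have : Prod.fst ∘ f n = T^[n] := funext fun b => iterate_fst hbase n (b, y₀)
      rw [this]
      exact (hT.iterate n).map_eq
    simp only [Function.comp_def, h2] at h1
    have h3 := tendsto_nhds_unique h1 tendsto_const_nhds
    have h4 := congrArg (fun m : ProbabilityMeasure X => (m : Measure X)) h3
    simp only [ProbabilityMeasure.toMeasure_map _ measurable_fst.aemeasurable] at h4
    exact h4
  have hC0 : (ν : Measure (X × D)) (Prod.fst ⁻¹' S) = 0 := by
    rw [← Measure.map_apply measurable_fst hS.measurableSet, hπ, hS0]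
  have hmap := tendsto_map_of_continuousAt_compl hlim hΦ (hS.preimage continuous_fst) hC0 hcont
  have hsucc : ∀ n, (νs n).map hΦ.aemeasurable = νs (n + 1) := by
    intro n
    apply ProbabilityMeasure.toMeasure_injective
    rw [ProbabilityMeasure.toMeasure_map _ hΦ.aemeasurable, hνs, hνs, Measure.map_map hΦ (hf n)]
    congr 1
    exact funext fun b => (Function.iterate_succ_apply' Φ n (b, y₀)).symm
  refine ⟨ν, inferInstance, ⟨hΦ, ?_⟩, hπ⟩
  rw [← ProbabilityMeasure.toMeasure_map _ hΦ.aemeasurable]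
  refine ext_of_forall_integral_eq_of_IsFiniteMeasure fun u => ?_
  have h1 := (ProbabilityMeasure.tendsto_iff_forall_integral_tendsto.1 hmap) u
  have h2 := (ProbabilityMeasure.tendsto_iff_forall_integral_tendsto.1 hlim) u
  -- No averaging over `n` is needed. Since `μ` is `T`-invariant, consecutive terms compare `Φ^n` at
  -- two points of the fibre over `T b`, and the contraction makes the difference vanish. The limit
  -- is therefore invariant.
  have h3 : Tendsto (fun n => ∫ z, u z ∂(νs (n + 1) : Measure (X × D)) -
      ∫ z, u z ∂(νs n : Measure (X × D))) atTop (𝓝 0) := by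
    rw [Metric.tendsto_atTop]
    intro ε hε
    obtain ⟨N, hN⟩ := exists_forall_dist_iterate_lt hbase hκ hκ1 hfib u.continuous (half_pos hε)
    refine ⟨N, fun n hn => ?_⟩
    have hb : ∀ g : X → X × D, Measurable g → Integrable (fun z => u (g z)) μ := fun g hg =>
      Integrable.of_bound (u.continuous.measurable.comp hg).aestronglyMeasurable ‖u‖
        (.of_forall fun z => u.norm_coe_le_norm _)
    have e1 : ∀ n, ∫ z, u z ∂(νs n : Measure (X × D)) = ∫ b, u (f n b) ∂μ := fun n => by
      rw [hνs, integral_map (hf n).aemeasurable u.continuous.measurable.aestronglyMeasurable]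
    have e2 : ∫ b, u (f n b) ∂μ = ∫ b, u (f n (T b)) ∂μ := by
      conv_lhs => rw [← hT.map_eq]
      exact integral_map hT.measurable.aemeasurable
        (u.continuous.measurable.comp (hf n)).aestronglyMeasurable
    rw [e1, e1, e2, Real.dist_0_eq_abs, ← integral_sub (hb _ (hf (n + 1)))
      (hb (fun b => f n (T b)) ((hf n).comp hT.measurable))]
    have := norm_integral_le_of_norm_le_const (μ := μ) (C := ε / 2)
      (f := fun b => u (f (n + 1) b) - u (f n (T b))) (.of_forall fun b => by
        have e3 : f (n + 1) b = Φ^[n] (T b, (Φ (b, y₀)).2) := by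
          simp only [f, Function.iterate_succ_apply]
          congr 1
          exact Prod.ext (hbase _) rfl
        rw [e3]
        exact (hN n hn (T b) _ y₀).le)
    rw [Real.norm_eq_abs, probReal_univ, mul_one] at this
    linarith
  have h4 := (h3.comp hs.tendsto_atTop).add h2
  simp only [Function.comp_def, sub_add_cancel, zero_add] at h4
  simp only [Function.comp_def, hsucc] at h1
  exact tendsto_nhds_unique h1 h4

/-- A skew product with contracting fibres over an ergodic base has an ergodic measure. -/
theorem exists_ergodic_skewProduct [IsProbabilityMeasure μ] [Nonempty D] (hT : Ergodic T μ)
    (hΦ : Measurable Φ) (hbase : ∀ z, (Φ z).1 = T z.1) {κ : ℝ} (hκ : 0 ≤ κ)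
    (hκ1 : κ < 1) (hfib : ∀ b y y', dist (Φ (b, y)).2 (Φ (b, y')).2 ≤ κ * dist y y')
    {S : Set X} (hS : IsClosed S) (hS0 : μ S = 0) (hcont : ∀ z : X × D, z.1 ∉ S → ContinuousAt Φ z) :
    ∃ ν : Measure (X × D), IsProbabilityMeasure ν ∧ Ergodic Φ ν ∧ ν.map Prod.fst = μ := by
  obtain ⟨ν, hν, hinv, hπ⟩ := exists_invariant_skewProduct hT.toMeasurePreserving hΦ hbase hκ hκ1
    hfib hS hS0 hcont
  refine ⟨ν, hν, Ergodic.of_mem_extremePoints ?_, hπ⟩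
  rw [mem_extremePoints_iff_left]
  refine ⟨⟨hinv, hν⟩, ?_⟩
  -- A component of a convex decomposition of `ν` projects to a `T`-invariant probability measure
  -- that is absolutely continuous with respect to `μ`. Ergodicity identifies it with `μ`, and
  -- uniqueness over `μ` identifies the component with `ν`.
  rintro ν₁ ⟨hinv₁, hp₁⟩ ν₂ ⟨hinv₂, hp₂⟩ ⟨a, b, ha, hb, hab, h⟩
  refine eq_of_map_fst_eq hbase hκ hκ1 hfib hinv₁ hinv ?_ hπ
  have := Measure.isProbabilityMeasure_map (μ := ν₁)
    (measurable_fst : Measurable (Prod.fst : X × D → X)).aemeasurable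
  have hfst : ∀ m : Measure (X × D), MeasurePreserving Prod.fst m (m.map Prod.fst) := fun m =>
    ⟨measurable_fst, rfl⟩
  refine hT.eq_of_absolutelyContinuous
    ((hfst ν₁).of_semiconj hinv₁ (fun z => hbase z) hT.measurable) ?_
  rw [← hπ]
  refine Measure.AbsolutelyContinuous.map ?_ measurable_fst
  rw [← h]
  exact (Measure.absolutelyContinuous_smul ha.ne').add_right _

/-- Almost every fibre consists of points that are generic for `ν`. -/
theorem ae_forall_tendsto_birkhoffSum (hbase : ∀ z, (Φ z).1 = T z.1) {κ : ℝ} (hκ : 0 ≤ κ)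
    (hκ1 : κ < 1) (hfib : ∀ b y y', dist (Φ (b, y)).2 (Φ (b, y')).2 ≤ κ * dist y y')
    {ν : Measure (X × D)} [IsProbabilityMeasure ν] (hν : Ergodic Φ ν) (hπ : ν.map Prod.fst = μ) :
    ∀ᵐ b ∂μ, ∀ (y : D) (u : C(X × D, ℝ)),
      Tendsto (fun n : ℕ => birkhoffSum Φ u n (b, y) / n) atTop (𝓝 (∫ z, u z ∂ν)) := by
  have hfibre : ∀ (u : C(X × D, ℝ)) (b : X) (y y' : D),
      Tendsto (fun n : ℕ => birkhoffSum Φ u n (b, y) / n) atTop (𝓝 (∫ z, u z ∂ν)) →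
      Tendsto (fun n : ℕ => birkhoffSum Φ u n (b, y') / n) atTop (𝓝 (∫ z, u z ∂ν)) := by
    -- Along one fibre the values of `u` differ by a null sequence, whose Cesàro means also tend to
    -- zero.
    intro u b y y' h
    have h0 : Tendsto (fun n => u (Φ^[n] (b, y')) - u (Φ^[n] (b, y))) atTop (𝓝 0) := by
      rw [Metric.tendsto_atTop]
      intro ε hε
      obtain ⟨N, hN⟩ := exists_forall_dist_iterate_lt hbase hκ hκ1 hfib u.continuous hε
      exact ⟨N, fun n hn => by rw [Real.dist_0_eq_abs]; exact hN n hn b y' y⟩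
    have h1 := h0.cesaro.add h
    rw [zero_add] at h1
    refine h1.congr fun n => ?_
    simp only [birkhoffSum, Finset.sum_sub_distrib]
    ring
  obtain ⟨y₀⟩ : Nonempty D := ⟨(nonempty_of_isProbabilityMeasure ν).some.2⟩
  -- Once the fibre coordinate is frozen at `y₀`, the condition concerns `b` only and passes from
  -- `ν` to its projection `μ`.
  have hone : ∀ u : C(X × D, ℝ), ∀ᵐ b ∂μ,
      Tendsto (fun n : ℕ => birkhoffSum Φ u n (b, y₀) / n) atTop (𝓝 (∫ z, u z ∂ν)) := by
    intro u
    rw [← hπ, ae_map_iff measurable_fst.aemeasurable]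
    · have hint : Integrable u ν := Integrable.of_bound
        u.continuous.measurable.aestronglyMeasurable ‖u‖ (.of_forall fun z => u.norm_coe_le_norm _)
      filter_upwards [ae_tendsto_birkhoffSum_div hν u.continuous.measurable hint] with z hz
      exact hfibre u z.1 z.2 y₀ hz
    · refine measurableSet_tendsto _ fun n => ?_
      exact ((measurable_birkhoffSum hν.measurable u.continuous.measurable n).comp
        measurable_prodMk_right).div_const _
  -- One exceptional null set must serve all `u`. Separability of `C(X × D, ℝ)` reduces this to
  -- countably many functions and an `ε / 4` approximation.
  have hall := ae_all_iff.2 fun i : ℕ => hone (TopologicalSpace.denseSeq C(X × D, ℝ) i)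
  filter_upwards [hall] with b hb y u
  refine hfibre u b y₀ y ?_
  rw [Metric.tendsto_atTop]
  intro ε hε
  obtain ⟨i, hi⟩ := (TopologicalSpace.denseRange_denseSeq C(X × D, ℝ)).exists_dist_lt u
    (show 0 < ε / 4 by linarith)
  set v := TopologicalSpace.denseSeq C(X × D, ℝ) i
  have hd : ∀ z, |u z - v z| ≤ ε / 4 := fun z =>
    (ContinuousMap.dist_apply_le_dist z).trans hi.le
  obtain ⟨N, hN⟩ := Metric.tendsto_atTop.1 (hb i) (ε / 4) (by linarith)
  refine ⟨N, fun n hn => ?_⟩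
  have h1 := hN n hn
  have h2 : |birkhoffSum Φ u n (b, y₀) / n - birkhoffSum Φ v n (b, y₀) / n| ≤ ε / 4 := by
    rw [← sub_div, abs_div, Nat.abs_cast]
    refine div_le_of_le_mul₀ (by positivity) (by linarith) ?_
    simp only [birkhoffSum, ← Finset.sum_sub_distrib]
    refine (Finset.abs_sum_le_sum_abs _ _).trans ((Finset.sum_le_sum fun j _ => hd _).trans ?_)
    simp [mul_comm]
  have h3 : |∫ z, u z ∂ν - ∫ z, v z ∂ν| ≤ ε / 4 := by
    have hint : ∀ w : C(X × D, ℝ), Integrable w ν := fun w => Integrable.of_bound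
        w.continuous.measurable.aestronglyMeasurable ‖w‖ (.of_forall fun z => w.norm_coe_le_norm _)
    rw [← integral_sub (hint u) (hint v)]
    have := norm_integral_le_of_norm_le_const (μ := ν) (f := fun z => u z - v z) (.of_forall hd)
    rwa [Real.norm_eq_abs, probReal_univ, mul_one] at this
  rw [Real.dist_eq] at h1 ⊢
  rw [abs_lt] at h1 ⊢
  rw [abs_le] at h2 h3
  constructor <;> linarith [h1.1, h1.2, h2.1, h2.2, h3.1, h3.2]

end SkewProduct

/-! ### Log-Lipschitz densities -/

/-- Positive functions on `s` whose logarithm is `a`-Lipschitz. -/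
structure LogLip (a : ℝ) (s : Set ℝ) (f : ℝ → ℝ) : Prop where
  pos : ∀ x ∈ s, 0 < f x
  le_exp : ∀ x ∈ s, ∀ y ∈ s, f x ≤ Real.exp (a * |x - y|) * f y

namespace LogLip

variable {a b : ℝ} {s : Set ℝ} {f h : ℝ → ℝ}

theorem continuousOn (hf : LogLip a s f) : ContinuousOn f s := by
  intro y hy
  have h1 : Tendsto (fun x => Real.exp (a * |x - y|) * f y) (𝓝[s] y) (𝓝 (f y)) := by
    have : Continuous fun x => Real.exp (a * |x - y|) * f y := by fun_prop
    simpa using (this.tendsto y).mono_left nhdsWithin_le_nhds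
  have h2 : Tendsto (fun x => Real.exp (-(a * |x - y|)) * f y) (𝓝[s] y) (𝓝 (f y)) := by
    have : Continuous fun x => Real.exp (-(a * |x - y|)) * f y := by fun_prop
    simpa using (this.tendsto y).mono_left nhdsWithin_le_nhds
  refine tendsto_of_tendsto_of_tendsto_of_le_of_le' h2 h1 ?_ ?_
  · filter_upwards [self_mem_nhdsWithin] with x hx
    rw [Real.exp_neg, inv_mul_le_iff₀ (Real.exp_pos _), abs_sub_comm]
    exact hf.le_exp y hy x hx
  · filter_upwards [self_mem_nhdsWithin] with x hx
    exact hf.le_exp x hx y hy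

theorem mono (hf : LogLip a s f) (hab : a ≤ b) : LogLip b s f where
  pos := hf.pos
  le_exp x hx y hy := (hf.le_exp x hx y hy).trans (by
    have := (hf.pos y hy).le
    gcongr)

theorem mul (hf : LogLip a s f) (hh : LogLip b s h) : LogLip (a + b) s fun x => f x * h x where
  pos x hx := mul_pos (hf.pos x hx) (hh.pos x hx)
  le_exp x hx y hy := by
    have := mul_le_mul (hf.le_exp x hx y hy) (hh.le_exp x hx y hy) (hh.pos x hx).le
      (mul_nonneg (Real.exp_pos _).le (hf.pos y hy).le)
    rw [add_mul, Real.exp_add]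
    linarith

theorem finset_sum {ι : Type*} {F : ι → ℝ → ℝ} {t : Finset ι} (ht : t.Nonempty)
    (hF : ∀ i ∈ t, LogLip a s (F i)) : LogLip a s fun x => ∑ i ∈ t, F i x where
  pos x hx := Finset.sum_pos (fun i hi => (hF i hi).pos x hx) ht
  le_exp x hx y hy := by
    rw [Finset.mul_sum]
    exact Finset.sum_le_sum fun i hi => (hF i hi).le_exp x hx y hy

/-- Composition with a contraction improves the constant. Applied to inverse branches, this is what
makes a cone of log-Lipschitz densities invariant. -/
theorem comp {κ : ℝ} (ha : 0 ≤ a) (hf : LogLip a s f) {v : ℝ → ℝ} (hv : MapsTo v s s)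
    (hκ : ∀ x ∈ s, ∀ y ∈ s, |v x - v y| ≤ κ * |x - y|) : LogLip (a * κ) s fun x => f (v x) where
  pos x hx := hf.pos _ (hv hx)
  le_exp x hx y hy := (hf.le_exp _ (hv hx) _ (hv hy)).trans (by
    have := (hf.pos _ (hv hy)).le
    have := hκ x hx y hy
    rw [mul_assoc]
    gcongr)

/-- Subtracting a small constant from a log-Lipschitz function only slightly worsens its
constant. -/
theorem sub_const {a' m δ : ℝ} (hf : LogLip a' s f) (ha' : 0 ≤ a') (haa : a' < a)
    (hs : ∀ x ∈ s, ∀ y ∈ s, |x - y| ≤ 1) (hm : ∀ x ∈ s, m ≤ f x) (hm0 : 0 < m)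
    (hδ : δ = (a - a') * m / (a * Real.exp a)) : LogLip a s fun x => f x - δ := by
  have ha0 : 0 < a := by linarith
  have hexp : (1 : ℝ) ≤ Real.exp a := Real.one_le_exp ha0.le
  have hδa : δ * (a * Real.exp a) = (a - a') * m := by rw [hδ]; field_simp
  have hδ0 : 0 < δ := by
    rw [hδ]
    have : 0 < a - a' := sub_pos.2 haa
    positivity
  have hδm : δ < m := by
    rw [hδ, div_lt_iff₀ (by positivity)]
    have h1 : 0 ≤ m * a' := by positivity
    have h2 : 0 < Real.exp a - 1 := by linarith [Real.add_one_lt_exp ha0.ne']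
    have h3 : 0 < m * a * (Real.exp a - 1) := by positivity
    have h4 : m * a * 1 ≤ m * a * Real.exp a := by gcongr
    rcases ha'.eq_or_lt with h | h
    · subst h; linarith
    · have : 0 < m * a' := by positivity
      linarith
  refine ⟨fun x hx => by linarith [hm x hx], fun x hx y hy => ?_⟩
  set t := |x - y|
  have ht0 : 0 ≤ t := abs_nonneg _
  have ht1 : t ≤ 1 := hs x hx y hy
  -- The subtraction costs `δ (exp (a t) - 1) ≤ δ a t exp a`. Relaxing `a'` to `a` gains at least
  -- `(a - a') t m`. The value of `δ` makes these two bounds equal.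
  have h1 : Real.exp (a * t) - 1 ≤ a * t * Real.exp a := by
    have e1 : 1 - a * t ≤ Real.exp (-(a * t)) := by linarith [Real.add_one_le_exp (-(a * t))]
    have e2 := mul_le_mul_of_nonneg_right e1 (Real.exp_pos (a * t)).le
    rw [← Real.exp_add, neg_add_cancel, Real.exp_zero] at e2
    have e3 : Real.exp (a * t) ≤ Real.exp a := Real.exp_le_exp.2 (by nlinarith)
    have e4 : a * t * Real.exp (a * t) ≤ a * t * Real.exp a := by gcongr
    linarith
  have h2 : (a - a') * t ≤ Real.exp (a * t) - Real.exp (a' * t) := by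
    have e1 : Real.exp (a * t) = Real.exp (a' * t) * Real.exp ((a - a') * t) := by
      rw [← Real.exp_add]; ring_nf
    have e2 : 1 ≤ Real.exp (a' * t) := Real.one_le_exp (by positivity)
    have e3 := Real.add_one_le_exp ((a - a') * t)
    have e4 : 0 ≤ (a - a') * t := mul_nonneg (by linarith) ht0
    rw [e1]
    nlinarith
  have h3 := hf.le_exp x hx y hy
  have h4 : δ * (Real.exp (a * t) - 1) ≤ (Real.exp (a * t) - Real.exp (a' * t)) * f y := by
    calc δ * (Real.exp (a * t) - 1) ≤ δ * (a * t * Real.exp a) := by gcongr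
      _ = (a - a') * t * m := by linear_combination t * hδa
      _ ≤ (Real.exp (a * t) - Real.exp (a' * t)) * f y := by
        have : 0 ≤ (a - a') * t := mul_nonneg (by linarith) ht0
        exact mul_le_mul h2 (hm y hy) hm0.le (this.trans h2)
  linarith

end LogLip

theorem logLip_one {a : ℝ} (ha : 0 ≤ a) (s : Set ℝ) : LogLip a s fun _ => 1 where
  pos _ _ := one_pos
  le_exp x _ y _ := by simpa using mul_nonneg ha (abs_nonneg (x - y))

/-! ### Full-branch expanding maps -/

/-- The data of a piecewise expanding map of `(c 0, c 0 + 1]` with `d` full increasing branches. -/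
structure ExpandingBranches (d : ℕ) (c : ℕ → ℝ) (g : ℕ → ℝ → ℝ) (σ : ℝ) : Prop where
  total : c d = c 0 + 1
  lt : ∀ i < d, c i < c (i + 1)
  left : ∀ i < d, g i (c i) = c 0
  right : ∀ i < d, g i (c (i + 1)) = c 0 + 1
  smooth : ∀ i < d, ContDiff ℝ 2 (g i)
  one_lt : 1 < σ
  le_deriv : ∀ i < d, ∀ t ∈ Icc (c i) (c (i + 1)), σ ≤ deriv (g i) t

/-- The inverse of the `i`-th branch. -/
noncomputable def invBranch (c : ℕ → ℝ) (g : ℕ → ℝ → ℝ) (i : ℕ) : ℝ → ℝ :=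
  Function.invFunOn (g i) (Ioc (c i) (c (i + 1)))

/-- The transfer operator with respect to Lebesgue measure. -/
noncomputable def transfer (d : ℕ) (c : ℕ → ℝ) (g : ℕ → ℝ → ℝ) (f : ℝ → ℝ) (y : ℝ) : ℝ :=
  ∑ i ∈ Finset.range d, f (invBranch c g i y) * (deriv (g i) (invBranch c g i y))⁻¹

namespace ExpandingBranches

variable {d : ℕ} {c : ℕ → ℝ} {g : ℕ → ℝ → ℝ} {σ : ℝ}

theorem d_pos (H : ExpandingBranches d c g σ) : 0 < d := by
  rcases Nat.eq_zero_or_pos d with rfl | h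
  · have := H.total; linarith
  · exact h

theorem mono_c (H : ExpandingBranches d c g σ) {i j : ℕ} (hij : i ≤ j) (hj : j ≤ d) :
    c i ≤ c j := by
  induction j, hij using Nat.le_induction with
  | base => exact le_rfl
  | succ j _ ih => exact (ih (by omega)).trans (H.lt j (by omega)).le

theorem Ioc_subset (H : ExpandingBranches d c g σ) {i : ℕ} (hi : i < d) :
    Ioc (c i) (c (i + 1)) ⊆ Ioc (c 0) (c 0 + 1) :=
  Ioc_subset_Ioc (H.mono_c (Nat.zero_le _) hi.le) (H.total ▸ H.mono_c (by omega) le_rfl)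

theorem differentiable (H : ExpandingBranches d c g σ) {i : ℕ} (hi : i < d) :
    Differentiable ℝ (g i) := (H.smooth i hi).differentiable (by norm_num)

theorem sub_le (H : ExpandingBranches d c g σ) {i : ℕ} (hi : i < d) {x y : ℝ}
    (hx : x ∈ Icc (c i) (c (i + 1))) (hy : y ∈ Icc (c i) (c (i + 1))) (hxy : x ≤ y) :
    σ * (y - x) ≤ g i y - g i x :=
  (convex_Icc _ _).mul_sub_le_image_sub_of_le_deriv (H.differentiable hi).continuous.continuousOn
    (H.differentiable hi).differentiableOn
    (fun t ht => H.le_deriv i hi t (interior_subset ht)) x hx y hy hxy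

theorem strictMonoOn (H : ExpandingBranches d c g σ) {i : ℕ} (hi : i < d) :
    StrictMonoOn (g i) (Icc (c i) (c (i + 1))) := by
  intro x hx y hy hxy
  have h1 := H.sub_le hi hx hy hxy.le
  have h2 : 0 < σ * (y - x) := mul_pos (by linarith [H.one_lt]) (sub_pos.2 hxy)
  linarith

theorem image_Ioc (H : ExpandingBranches d c g σ) {i : ℕ} (hi : i < d) :
    g i '' Ioc (c i) (c (i + 1)) = Ioc (c 0) (c 0 + 1) := by
  have hlt := H.lt i hi
  have hl : c i ∈ Icc (c i) (c (i + 1)) := left_mem_Icc.2 hlt.le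
  have hr : c (i + 1) ∈ Icc (c i) (c (i + 1)) := right_mem_Icc.2 hlt.le
  refine Subset.antisymm ?_ fun y hy => ?_
  · rintro _ ⟨t, ht, rfl⟩
    refine ⟨?_, ?_⟩
    · rw [← H.left i hi]
      exact H.strictMonoOn hi hl (Ioc_subset_Icc_self ht) ht.1
    · rw [← H.right i hi]
      exact (H.strictMonoOn hi).monotoneOn (Ioc_subset_Icc_self ht) hr ht.2
  · have := intermediate_value_Ioc hlt.le (H.differentiable hi).continuous.continuousOn
    rw [H.left i hi, H.right i hi] at this
    exact this hy

theorem invBranch_mem (H : ExpandingBranches d c g σ) {i : ℕ} (hi : i < d) {y : ℝ}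
    (hy : y ∈ Ioc (c 0) (c 0 + 1)) : invBranch c g i y ∈ Ioc (c i) (c (i + 1)) :=
  Function.invFunOn_mem (by rwa [← H.image_Ioc hi] at hy)

theorem apply_invBranch (H : ExpandingBranches d c g σ) {i : ℕ} (hi : i < d) {y : ℝ}
    (hy : y ∈ Ioc (c 0) (c 0 + 1)) : g i (invBranch c g i y) = y :=
  Function.invFunOn_eq (by rwa [← H.image_Ioc hi] at hy)

theorem invBranch_apply (H : ExpandingBranches d c g σ) {i : ℕ} (hi : i < d) {t : ℝ}
    (ht : t ∈ Ioc (c i) (c (i + 1))) : invBranch c g i (g i t) = t :=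
  ((H.strictMonoOn hi).injOn.mono Ioc_subset_Icc_self).leftInvOn_invFunOn ht

theorem abs_invBranch_sub_le (H : ExpandingBranches d c g σ) {i : ℕ} (hi : i < d) {x y : ℝ}
    (hx : x ∈ Ioc (c 0) (c 0 + 1)) (hy : y ∈ Ioc (c 0) (c 0 + 1)) :
    |invBranch c g i x - invBranch c g i y| ≤ σ⁻¹ * |x - y| := by
  have hσ := H.one_lt
  wlog hxy : invBranch c g i y ≤ invBranch c g i x generalizing x y
  · rw [abs_sub_comm, abs_sub_comm x]
    exact this hy hx (le_of_not_ge hxy)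
  have h := H.sub_le hi (Ioc_subset_Icc_self (H.invBranch_mem hi hy))
    (Ioc_subset_Icc_self (H.invBranch_mem hi hx)) hxy
  rw [H.apply_invBranch hi hx, H.apply_invBranch hi hy] at h
  rw [abs_of_nonneg (sub_nonneg.2 hxy), ← div_eq_inv_mul, le_div_iff₀ (by linarith), mul_comm]
  exact h.trans (le_abs_self _)

/-- Bounded distortion. -/
theorem exists_logLip_weight (H : ExpandingBranches d c g σ) : ∃ K : ℝ, 0 ≤ K ∧ ∀ i < d,
    LogLip K (Ioc (c 0) (c 0 + 1)) fun y => (deriv (g i) (invBranch c g i y))⁻¹ := by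
  have hσ := H.one_lt
  have h1 : ∀ i : Fin d, ∃ K : ℝ, 0 ≤ K ∧ ∀ x ∈ Icc (c i) (c (i + 1)),
      ∀ y ∈ Icc (c i) (c (i + 1)), |deriv (g i) x - deriv (g i) y| ≤ K * |x - y| := by
    intro i
    have hs : ContDiff ℝ 1 (deriv (g i)) := by
      have := H.smooth i i.2
      rw [show (2 : WithTop ℕ∞) = 1 + 1 by norm_num, contDiff_succ_iff_deriv] at this
      exact this.2.2
    obtain ⟨K, hK⟩ := isCompact_Icc.exists_bound_of_continuousOn
      (s := Icc (c i) (c (i + 1))) (hs.continuous_deriv le_rfl).continuousOn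
    refine ⟨max K 0, le_max_right _ _, fun x hx y hy => ?_⟩
    refine (convex_Icc _ _).norm_image_sub_le_of_norm_deriv_le
      (fun z _ => (hs.differentiable (by norm_num)) z)
      (fun z hz => (hK z hz).trans (le_max_left _ _)) hy hx
  choose K hK0 hK using h1
  -- The sum of the Lipschitz constants of the branch derivatives serves all branches at once.
  refine ⟨∑ i, K i, Finset.sum_nonneg fun i _ => hK0 i, fun i hi => ⟨fun y hy => ?_, ?_⟩⟩
  · have := H.le_deriv i hi _ (Ioc_subset_Icc_self (H.invBranch_mem hi hy))
    exact inv_pos.2 (by linarith)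
  · intro x hx y hy
    have mx := Ioc_subset_Icc_self (H.invBranch_mem hi hx)
    have my := Ioc_subset_Icc_self (H.invBranch_mem hi hy)
    have dx := H.le_deriv i hi _ mx
    have dy := H.le_deriv i hi _ my
    have h1 := hK ⟨i, hi⟩ _ my _ mx
    have h2 := H.abs_invBranch_sub_le hi hy hx
    have h3 : K ⟨i, hi⟩ ≤ ∑ i, K i := Finset.single_le_sum (fun i _ => hK0 i) (Finset.mem_univ _)
    have hS : 0 ≤ ∑ i, K i := Finset.sum_nonneg fun i _ => hK0 i
    set A := deriv (g i) (invBranch c g i x)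
    set B := deriv (g i) (invBranch c g i y)
    have hA : 0 < A := by linarith
    have hB : 0 < B := by linarith
    have h4 : |invBranch c g i y - invBranch c g i x| ≤ |x - y| := by
      rw [abs_sub_comm x]
      refine h2.trans (mul_le_of_le_one_left (abs_nonneg _) (inv_le_one_of_one_le₀ hσ.le))
    have h5 : B - A ≤ (∑ i, K i) * |x - y| := by
      refine (le_abs_self _).trans (h1.trans ?_)
      have := hK0 ⟨i, hi⟩
      gcongr
    -- The bound `A ≥ σ > 1` turns the additive error `B - A` into the factor `1 + K |x - y|`.
    have h6 : B ≤ Real.exp ((∑ i, K i) * |x - y|) * A := by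
      have e := Real.add_one_le_exp ((∑ i, K i) * |x - y|)
      have h0 : 0 ≤ (∑ i, K i) * |x - y| :=
        mul_nonneg hS (abs_nonneg _)
      nlinarith
    rw [inv_eq_one_div, inv_eq_one_div, mul_one_div, div_le_div_iff₀ hA hB]
    linarith

end ExpandingBranches

/-! ### Measures on the circle given by densities on a fundamental domain -/

theorem volume_restrict_Ioc_univ (a : ℝ) : (volume.restrict (Ioc a (a + 1))) univ = 1 := by
  simp

instance isProbabilityMeasure_restrict_Ioc (a : ℝ) :
    IsProbabilityMeasure (volume.restrict (Ioc a (a + 1))) := ⟨volume_restrict_Ioc_univ a⟩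

/-- The measure on the circle with density `f` on the fundamental domain `(a, a + 1]`. -/
noncomputable def circleMeasure (a : ℝ) (f : ℝ → ℝ) : Measure UnitAddCircle :=
  ((volume.restrict (Ioc a (a + 1))).withDensity fun t => ENNReal.ofReal (f t)).map (↑)

theorem measurable_coe_circle : Measurable ((↑) : ℝ → UnitAddCircle) :=
  (AddCircle.continuous_mk' 1).measurable

theorem circleMeasure_apply (a : ℝ) (f : ℝ → ℝ) {A : Set UnitAddCircle} (hA : MeasurableSet A) :
    circleMeasure a f A =
      ∫⁻ t in Ioc a (a + 1), ((↑) ⁻¹' A : Set ℝ).indicator (fun t => ENNReal.ofReal (f t)) t := by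
  rw [circleMeasure, Measure.map_apply measurable_coe_circle hA,
    withDensity_apply _ (measurable_coe_circle hA), lintegral_indicator (measurable_coe_circle hA)]

theorem circleMeasure_congr {a : ℝ} {f h : ℝ → ℝ} (hfh : ∀ t ∈ Ioc a (a + 1), f t = h t) :
    circleMeasure a f = circleMeasure a h := by
  refine Measure.ext fun A hA => ?_
  rw [circleMeasure_apply a f hA, circleMeasure_apply a h hA]
  refine setLIntegral_congr_fun measurableSet_Ioc fun t ht => ?_
  simp only [indicator, hfh t ht]

namespace LogLip

variable {a b : ℝ} {f : ℝ → ℝ}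

theorem aestronglyMeasurable (hf : LogLip a (Ioc b (b + 1)) f) :
    AEStronglyMeasurable f (volume.restrict (Ioc b (b + 1))) :=
  hf.continuousOn.aestronglyMeasurable measurableSet_Ioc

/-- The domain has length one, so the log-Lipschitz bound is a Harnack inequality with constant `exp
a`. For densities of integral one it gives two-sided pointwise bounds. -/
theorem le_mul (ha : 0 ≤ a) (hf : LogLip a (Ioc b (b + 1)) f) {x y : ℝ} (hx : x ∈ Ioc b (b + 1))
    (hy : y ∈ Ioc b (b + 1)) : f x ≤ Real.exp a * f y := by
  refine (hf.le_exp x hx y hy).trans ?_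
  have h1 : |x - y| ≤ 1 := abs_le.2 ⟨by linarith [hx.1, hy.2], by linarith [hx.2, hy.1]⟩
  have := (hf.pos y hy).le
  gcongr
  nlinarith

theorem integrable (ha : 0 ≤ a) (hf : LogLip a (Ioc b (b + 1)) f) :
    Integrable f (volume.restrict (Ioc b (b + 1))) := by
  refine Integrable.of_bound hf.aestronglyMeasurable (Real.exp a * f (b + 1)) ?_
  filter_upwards [ae_restrict_mem measurableSet_Ioc] with x hx
  rw [Real.norm_of_nonneg (hf.pos x hx).le]
  exact hf.le_mul ha hx ⟨by linarith, le_rfl⟩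

theorem circleMeasure_univ (ha : 0 ≤ a) (hf : LogLip a (Ioc b (b + 1)) f) :
    circleMeasure b f univ = ENNReal.ofReal (∫ t in Ioc b (b + 1), f t) := by
  rw [circleMeasure_apply b f MeasurableSet.univ, ofReal_integral_eq_lintegral_ofReal
    (hf.integrable ha)]
  · simp
  · filter_upwards [ae_restrict_mem measurableSet_Ioc] with x hx using (hf.pos x hx).le

theorem circleMeasure_real (hf : LogLip a (Ioc b (b + 1)) f) {A : Set UnitAddCircle}
    (hA : MeasurableSet A) : (circleMeasure b f).real A =
      ∫ t in Ioc b (b + 1), ((↑) ⁻¹' A : Set ℝ).indicator f t := by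
  have hm := measurable_coe_circle hA
  rw [Measure.real, circleMeasure_apply b f hA, integral_eq_lintegral_of_nonneg_ae
    ?_ (hf.aestronglyMeasurable.indicator hm)]
  · congr 2
    ext x
    by_cases hx : x ∈ ((↑) ⁻¹' A : Set ℝ) <;> simp [hx]
  · filter_upwards [ae_restrict_mem measurableSet_Ioc] with x hx
    exact indicator_apply_nonneg fun _ => (hf.pos x hx).le

theorem le_exp_of_integral_eq (ha : 0 ≤ a) (hf : LogLip a (Ioc b (b + 1)) f)
    (h1 : ∫ t in Ioc b (b + 1), f t = 1) {x : ℝ} (hx : x ∈ Ioc b (b + 1)) : f x ≤ Real.exp a := by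
  have h2 : ∫ _ in Ioc b (b + 1), f x ≤ ∫ t in Ioc b (b + 1), Real.exp a * f t := by
    refine setIntegral_mono_on (integrable_const _) ((hf.integrable ha).const_mul _)
      measurableSet_Ioc fun y hy => hf.le_mul ha hx hy
  rw [integral_const_mul, h1] at h2
  simpa using h2

theorem exp_le_of_integral_eq (ha : 0 ≤ a) (hf : LogLip a (Ioc b (b + 1)) f)
    (h1 : ∫ t in Ioc b (b + 1), f t = 1) {x : ℝ} (hx : x ∈ Ioc b (b + 1)) : Real.exp (-a) ≤ f x := by
  have h2 : ∫ t in Ioc b (b + 1), f t ≤ ∫ _ in Ioc b (b + 1), Real.exp a * f x := by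
    refine setIntegral_mono_on (hf.integrable ha) (integrable_const _)
      measurableSet_Ioc fun y hy => hf.le_mul ha hy hx
  rw [h1] at h2
  rw [Real.exp_neg, inv_le_iff_one_le_mul₀' (Real.exp_pos _)]
  simpa using h2

end LogLip

namespace ExpandingBranches

variable {d : ℕ} {c : ℕ → ℝ} {g : ℕ → ℝ → ℝ} {σ : ℝ}

theorem setLIntegral_Ioc_eq_sum (H : ExpandingBranches d c g σ) (F : ℝ → ENNReal) :
    ∫⁻ t in Ioc (c 0) (c 0 + 1), F t =
      ∑ i ∈ Finset.range d, ∫⁻ t in Ioc (c i) (c (i + 1)), F t := by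
  rw [← H.total]
  have : ∀ n ≤ d, ∫⁻ t in Ioc (c 0) (c n), F t =
      ∑ i ∈ Finset.range n, ∫⁻ t in Ioc (c i) (c (i + 1)), F t := by
    intro n hn
    induction n with
    | zero => simp
    | succ n ih =>
      rw [Finset.sum_range_succ, ← ih (by omega), ← lintegral_union measurableSet_Ioc
        (Ioc_disjoint_Ioc_of_le le_rfl), Ioc_union_Ioc_eq_Ioc
        (H.mono_c (Nat.zero_le _) (by omega)) (H.lt n (by omega)).le]
  exact this d le_rfl

theorem setLIntegral_branch (H : ExpandingBranches d c g σ) {i : ℕ} (hi : i < d)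
    (f : ℝ → ℝ) (B : Set ℝ) :
    ∫⁻ t in Ioc (c i) (c (i + 1)), (g i ⁻¹' B).indicator (fun t => ENNReal.ofReal (f t)) t =
      ∫⁻ y in Ioc (c 0) (c 0 + 1), B.indicator (fun y => ENNReal.ofReal
        (f (invBranch c g i y) * (deriv (g i) (invBranch c g i y))⁻¹)) y := by
  rw [← H.image_Ioc hi, lintegral_image_eq_lintegral_abs_deriv_mul measurableSet_Ioc
    (fun t _ => (H.differentiable hi t).hasDerivAt.hasDerivWithinAt)
    ((H.strictMonoOn hi).injOn.mono Ioc_subset_Icc_self)]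
  refine setLIntegral_congr_fun measurableSet_Ioc fun t ht => ?_
  have hpos : 0 < deriv (g i) t := by
    linarith [H.le_deriv i hi t (Ioc_subset_Icc_self ht), H.one_lt]
  by_cases hB : g i t ∈ B
  · simp only [indicator, mem_preimage, hB, if_true, H.invBranch_apply hi ht]
    rw [← ENNReal.ofReal_mul (abs_nonneg _), abs_of_pos hpos]
    congr 1
    field_simp
  · simp [indicator, hB]

theorem logLip_branch (H : ExpandingBranches d c g σ) {a K : ℝ} (ha : 0 ≤ a)
    (hK : ∀ i < d, LogLip K (Ioc (c 0) (c 0 + 1)) fun y => (deriv (g i) (invBranch c g i y))⁻¹)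
    {f : ℝ → ℝ} (hf : LogLip a (Ioc (c 0) (c 0 + 1)) f) {i : ℕ} (hi : i < d) :
    LogLip (a * σ⁻¹ + K) (Ioc (c 0) (c 0 + 1))
      fun y => f (invBranch c g i y) * (deriv (g i) (invBranch c g i y))⁻¹ :=
  (hf.comp ha (fun _ hy => H.Ioc_subset hi (H.invBranch_mem hi hy))
    (fun _ hx _ hy => H.abs_invBranch_sub_le hi hx hy)).mul (hK i hi)

/-- The inverse branches divide the constant by `σ` and distortion adds `K`. For large `a` the new
constant is strictly smaller than `a`, which leaves room to subtract a constant density. -/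
theorem logLip_transfer (H : ExpandingBranches d c g σ) {a K : ℝ} (ha : 0 ≤ a)
    (hK : ∀ i < d, LogLip K (Ioc (c 0) (c 0 + 1)) fun y => (deriv (g i) (invBranch c g i y))⁻¹)
    {f : ℝ → ℝ} (hf : LogLip a (Ioc (c 0) (c 0 + 1)) f) :
    LogLip (a * σ⁻¹ + K) (Ioc (c 0) (c 0 + 1)) (transfer d c g f) :=
  LogLip.finset_sum (Finset.nonempty_range_iff.2 H.d_pos.ne')
    fun _ hi => H.logLip_branch ha hK hf (Finset.mem_range.1 hi)

theorem transfer_congr (H : ExpandingBranches d c g σ) {f h : ℝ → ℝ}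
    (hfh : ∀ t ∈ Ioc (c 0) (c 0 + 1), f t = h t) {y : ℝ} (hy : y ∈ Ioc (c 0) (c 0 + 1)) :
    transfer d c g f y = transfer d c g h y :=
  Finset.sum_congr rfl fun i hi => by
    have hi := Finset.mem_range.1 hi
    rw [hfh _ (H.Ioc_subset hi (H.invBranch_mem hi hy))]

/-- The transfer operator describes the action of the map on densities. -/
theorem map_circleMeasure (H : ExpandingBranches d c g σ) {T : UnitAddCircle → UnitAddCircle}
    (hT : Measurable T) (hTg : ∀ i < d, ∀ t ∈ Ioc (c i) (c (i + 1)), T t = (g i t : UnitAddCircle))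
    {a : ℝ} (ha : 0 ≤ a) {f : ℝ → ℝ} (hf : LogLip a (Ioc (c 0) (c 0 + 1)) f) :
    (circleMeasure (c 0) f).map T = circleMeasure (c 0) (transfer d c g f) := by
  obtain ⟨K, hK0, hK⟩ := H.exists_logLip_weight
  refine Measure.ext fun A hA => ?_
  rw [Measure.map_apply hT hA, circleMeasure_apply _ _ (hT hA), circleMeasure_apply _ _ hA,
    H.setLIntegral_Ioc_eq_sum]
  have h1 : ∀ i ∈ Finset.range d,
      ∫⁻ t in Ioc (c i) (c (i + 1)), ((↑) ⁻¹' (T ⁻¹' A) : Set ℝ).indicator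
        (fun t => ENNReal.ofReal (f t)) t =
      ∫⁻ y in Ioc (c 0) (c 0 + 1), ((↑) ⁻¹' A : Set ℝ).indicator (fun y => ENNReal.ofReal
        (f (invBranch c g i y) * (deriv (g i) (invBranch c g i y))⁻¹)) y := by
    intro i hi
    rw [← H.setLIntegral_branch (Finset.mem_range.1 hi)]
    refine setLIntegral_congr_fun measurableSet_Ioc fun t ht => ?_
    have h2 : t ∈ ((↑) ⁻¹' (T ⁻¹' A) : Set ℝ) ↔ t ∈ g i ⁻¹' ((↑) ⁻¹' A : Set ℝ) := by
      rw [mem_preimage, mem_preimage, mem_preimage, mem_preimage,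
        hTg i (Finset.mem_range.1 hi) t ht]
    by_cases h3 : t ∈ ((↑) ⁻¹' (T ⁻¹' A) : Set ℝ)
    · rw [indicator_of_mem h3, indicator_of_mem (h2.1 h3)]
    · rw [indicator_of_notMem h3, indicator_of_notMem (mt h2.2 h3)]
  rw [Finset.sum_congr rfl h1, ← lintegral_finsetSum']
  · refine setLIntegral_congr_fun measurableSet_Ioc fun y hy => ?_
    by_cases hyA : y ∈ ((↑) ⁻¹' A : Set ℝ)
    · simp only [indicator_of_mem hyA, transfer]
      refine (ENNReal.ofReal_sum_of_nonneg fun i hi => ?_).symm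
      exact ((H.logLip_branch ha hK hf (Finset.mem_range.1 hi)).pos y hy).le
    · simp only [indicator_of_notMem hyA, Finset.sum_const_zero]
  · intro i hi
    exact (H.logLip_branch ha hK hf
      (Finset.mem_range.1 hi)).aestronglyMeasurable.aemeasurable.ennreal_ofReal.indicator
      (measurable_coe_circle hA)

end ExpandingBranches

/-! ### Contraction of the transfer operator and the invariant density -/

namespace ExpandingBranches

variable {d : ℕ} {c : ℕ → ℝ} {g : ℕ → ℝ → ℝ} {σ : ℝ} {T : UnitAddCircle → UnitAddCircle}

theorem transfer_iterate_linear (f h : ℝ → ℝ) (α β : ℝ) (n : ℕ) :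
    (transfer d c g)^[n] (fun x => α * f x + β * h x) =
      fun y => α * (transfer d c g)^[n] f y + β * (transfer d c g)^[n] h y := by
  induction n generalizing f h with
  | zero => rfl
  | succ n ih =>
    simp only [Function.iterate_succ_apply]
    rw [← ih]
    congr 1
    ext y
    simp only [transfer, Finset.mul_sum, ← Finset.sum_add_distrib]
    exact Finset.sum_congr rfl fun i _ => by ring

theorem integral_transfer (H : ExpandingBranches d c g σ) (hT : Measurable T)
    (hTg : ∀ i < d, ∀ t ∈ Ioc (c i) (c (i + 1)), T t = (g i t : UnitAddCircle))
    {a : ℝ} (ha : 0 ≤ a) {f : ℝ → ℝ} (hf : LogLip a (Ioc (c 0) (c 0 + 1)) f) :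
    ∫ t in Ioc (c 0) (c 0 + 1), transfer d c g f t = ∫ t in Ioc (c 0) (c 0 + 1), f t := by
  obtain ⟨K, hK0, hK⟩ := H.exists_logLip_weight
  have hσ := H.one_lt
  have hP := H.logLip_transfer ha hK hf
  have h1 := congrArg (fun m => m univ) (H.map_circleMeasure hT hTg ha hf)
  simp only [Measure.map_apply hT MeasurableSet.univ, preimage_univ] at h1
  rw [hf.circleMeasure_univ ha, hP.circleMeasure_univ (by positivity)] at h1
  refine ((ENNReal.ofReal_eq_ofReal_iff ?_ ?_).1 h1).symm
  · exact setIntegral_nonneg measurableSet_Ioc fun x hx => (hf.pos x hx).le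
  · exact setIntegral_nonneg measurableSet_Ioc fun x hx => (hP.pos x hx).le

/-- The transfer operator contracts the normalized log-Lipschitz densities. -/
theorem exists_transfer_contraction (H : ExpandingBranches d c g σ) (hT : Measurable T)
    (hTg : ∀ i < d, ∀ t ∈ Ioc (c i) (c (i + 1)), T t = (g i t : UnitAddCircle)) :
    ∃ a θ : ℝ, 0 < a ∧ 0 ≤ θ ∧ θ < 1 ∧
      (∀ f, LogLip a (Ioc (c 0) (c 0 + 1)) f →
        LogLip a (Ioc (c 0) (c 0 + 1)) (transfer d c g f)) ∧
      ∀ (n : ℕ) (f h : ℝ → ℝ), LogLip a (Ioc (c 0) (c 0 + 1)) f →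
        LogLip a (Ioc (c 0) (c 0 + 1)) h →
        ∫ t in Ioc (c 0) (c 0 + 1), f t = 1 → ∫ t in Ioc (c 0) (c 0 + 1), h t = 1 →
        ∀ y ∈ Ioc (c 0) (c 0 + 1),
          |(transfer d c g)^[n] f y - (transfer d c g)^[n] h y| ≤ θ ^ n * Real.exp a := by
  obtain ⟨K, hK0, hK⟩ := H.exists_logLip_weight
  have hσ := H.one_lt
  have hσi : σ⁻¹ < 1 := inv_lt_one_of_one_lt₀ hσ
  have hσ0 : 0 < σ⁻¹ := inv_pos.2 (by linarith)
  -- This `a` solves `a (1 - σ⁻¹) = K + 1`, so one application of the operator lowers the constant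
  -- by exactly one.
  set a := (K + 1) / (1 - σ⁻¹) with ha
  have ha0 : 0 < a := div_pos (by linarith) (by linarith)
  set a' := a * σ⁻¹ + K with ha'
  have haa : a' < a := by
    have : a * (1 - σ⁻¹) = K + 1 := div_mul_cancel₀ _ (by linarith)
    linarith
  have ha'0 : 0 ≤ a' := by positivity
  have hcone : ∀ f, LogLip a (Ioc (c 0) (c 0 + 1)) f →
      LogLip a' (Ioc (c 0) (c 0 + 1)) (transfer d c g f) :=
    fun f hf => H.logLip_transfer ha0.le hK hf
  -- This is the amount that `LogLip.sub_const` allows, with the lower bound `m = exp (-a')` of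
  -- normalized densities of constant `a'`.
  set δ := (a - a') * Real.exp (-a') / (a * Real.exp a) with hδ
  have hδ0 : 0 < δ := div_pos (mul_pos (by linarith) (Real.exp_pos _)) (by positivity)
  have hδ1 : δ < 1 := by
    rw [hδ, div_lt_one (by positivity)]
    have h1 : Real.exp (-a') ≤ 1 := Real.exp_le_one_iff.2 (by linarith)
    have h2 : 1 < Real.exp a := Real.one_lt_exp_iff.2 ha0
    nlinarith
  have hd1 : ∀ x ∈ Ioc (c 0) (c 0 + 1), ∀ y ∈ Ioc (c 0) (c 0 + 1), |x - y| ≤ 1 :=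
    fun x hx y hy => abs_le.2 ⟨by linarith [hx.1, hy.2], by linarith [hx.2, hy.1]⟩
  -- After one step all normalized densities share the part `δ`, and the rest is `1 - δ` times
  -- another normalized density of the cone. In a difference the common part cancels, so each step
  -- contributes a factor `1 - δ`.
  have hstep : ∀ f, LogLip a (Ioc (c 0) (c 0 + 1)) f → ∫ t in Ioc (c 0) (c 0 + 1), f t = 1 →
      ∃ r, LogLip a (Ioc (c 0) (c 0 + 1)) r ∧ ∫ t in Ioc (c 0) (c 0 + 1), r t = 1 ∧
        transfer d c g f = fun x => δ * 1 + (1 - δ) * r x := by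
    intro f hf hf1
    have hP := hcone f hf
    have hP1 : ∫ t in Ioc (c 0) (c 0 + 1), transfer d c g f t = 1 := by
      rw [H.integral_transfer hT hTg ha0.le hf, hf1]
    have hsub := hP.sub_const ha'0 haa hd1 (fun x hx => hP.exp_le_of_integral_eq ha'0 hP1 hx)
      (Real.exp_pos _) hδ
    refine ⟨fun x => (1 - δ)⁻¹ * (transfer d c g f x - δ), ⟨fun x hx => ?_, fun x hx y hy => ?_⟩,
      ?_, ?_⟩
    · exact mul_pos (inv_pos.2 (by linarith)) (hsub.pos x hx)
    · have := mul_le_mul_of_nonneg_left (hsub.le_exp x hx y hy)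
        (inv_pos.2 (show 0 < 1 - δ by linarith)).le
      linarith
    · rw [integral_const_mul, integral_sub (hP.integrable ha'0) (integrable_const _), hP1]
      simp only [integral_const, probReal_univ, smul_eq_mul, one_mul]
      exact inv_mul_cancel₀ (by linarith)
    · ext x
      rw [mul_inv_cancel_left₀ (by linarith)]
      ring
  refine ⟨a, 1 - δ, ha0, by linarith, by linarith, fun f hf => (hcone f hf).mono haa.le, ?_⟩
  intro n
  induction n with
  | zero =>
    intro f h hf hh hf1 hh1 y hy
    have e1 := hf.le_exp_of_integral_eq ha0.le hf1 hy
    have e2 := hh.le_exp_of_integral_eq ha0.le hh1 hy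
    have e3 := hf.pos y hy
    have e4 := hh.pos y hy
    simp only [Function.iterate_zero, id, pow_zero, one_mul]
    exact abs_le.2 ⟨by linarith, by linarith⟩
  | succ n ih =>
    intro f h hf hh hf1 hh1 y hy
    obtain ⟨rf, hrf, hrf1, ef⟩ := hstep f hf hf1
    obtain ⟨rh, hrh, hrh1, eh⟩ := hstep h hh hh1
    rw [Function.iterate_succ_apply, Function.iterate_succ_apply, ef, eh,
      transfer_iterate_linear (fun _ => 1) rf, transfer_iterate_linear (fun _ => 1) rh]
    simp only [add_sub_add_left_eq_sub, ← mul_sub]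
    rw [abs_mul, abs_of_pos (by linarith), pow_succ', mul_assoc]
    exact mul_le_mul_of_nonneg_left (ih rf rh hrf hrh hrf1 hrh1 y hy) (by linarith)

/-- There is an invariant density, to which the images of all normalized log-Lipschitz densities
converge. -/
theorem exists_invariant_density (H : ExpandingBranches d c g σ) (hT : Measurable T)
    (hTg : ∀ i < d, ∀ t ∈ Ioc (c i) (c (i + 1)), T t = (g i t : UnitAddCircle)) :
    ∃ (a θ : ℝ) (ρ : ℝ → ℝ), 0 < a ∧ 0 ≤ θ ∧ θ < 1 ∧ LogLip a (Ioc (c 0) (c 0 + 1)) ρ ∧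
      ∫ t in Ioc (c 0) (c 0 + 1), ρ t = 1 ∧
      (∀ y ∈ Ioc (c 0) (c 0 + 1), transfer d c g ρ y = ρ y) ∧
      ∀ f, LogLip a (Ioc (c 0) (c 0 + 1)) f → ∫ t in Ioc (c 0) (c 0 + 1), f t = 1 →
        ∀ n, LogLip a (Ioc (c 0) (c 0 + 1)) ((transfer d c g)^[n] f) ∧
          ∀ y ∈ Ioc (c 0) (c 0 + 1),
            |(transfer d c g)^[n] f y - ρ y| ≤ θ ^ n * Real.exp a := by
  obtain ⟨a, θ, ha, hθ0, hθ1, hcone, hcontr⟩ := H.exists_transfer_contraction hT hTg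
  have hiter : ∀ f, LogLip a (Ioc (c 0) (c 0 + 1)) f → ∀ n,
      LogLip a (Ioc (c 0) (c 0 + 1)) ((transfer d c g)^[n] f) ∧
      ∫ t in Ioc (c 0) (c 0 + 1), (transfer d c g)^[n] f t =
        ∫ t in Ioc (c 0) (c 0 + 1), f t := by
    intro f hf n
    induction n with
    | zero => exact ⟨hf, rfl⟩
    | succ n ih =>
      rw [Function.iterate_succ_apply']
      exact ⟨hcone _ ih.1, (H.integral_transfer hT hTg ha.le ih.1).trans ih.2⟩
  set u : ℕ → ℝ → ℝ := fun n => (transfer d c g)^[n] fun _ => 1 with hu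
  have h1 : LogLip a (Ioc (c 0) (c 0 + 1)) fun _ => 1 := logLip_one ha.le _
  have h11 : ∫ _ in Ioc (c 0) (c 0 + 1), (1 : ℝ) = 1 := by simp
  -- The operator preserves the cone and the integral, so `u (n + m)` and `u n` are the `n`-th
  -- images of two normalized densities, `u m` and `1`.
  have hcauchy : ∀ y ∈ Ioc (c 0) (c 0 + 1), ∀ n m, |u (n + m) y - u n y| ≤ θ ^ n * Real.exp a := by
    intro y hy n m
    simp only [hu, Function.iterate_add_apply]
    exact hcontr n _ _ (hiter _ h1 m).1 h1 ((hiter _ h1 m).2.trans h11) h11 y hy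
  have hlim0 : Tendsto (fun n : ℕ => θ ^ n * Real.exp a) atTop (𝓝 0) := by
    simpa using (tendsto_pow_atTop_nhds_zero_of_lt_one hθ0 hθ1).mul_const (Real.exp a)
  have hconv : ∀ y ∈ Ioc (c 0) (c 0 + 1), ∃ l, Tendsto (fun n => u n y) atTop (𝓝 l) := by
    intro y hy
    refine cauchySeq_tendsto_of_complete (cauchySeq_of_le_tendsto_0' _ (fun n m hnm => ?_) hlim0)
    obtain ⟨k, rfl⟩ := Nat.exists_eq_add_of_le hnm
    rw [dist_comm]
    exact hcauchy y hy n k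
  choose! ρ hρ using hconv
  have hle : ∀ y ∈ Ioc (c 0) (c 0 + 1), ∀ n, |u n y - ρ y| ≤ θ ^ n * Real.exp a := by
    intro y hy n
    have h2 : Tendsto (fun m => |u (n + m) y - u n y|) atTop (𝓝 |ρ y - u n y|) := by
      have := (hρ y hy).comp (tendsto_add_atTop_nat n)
      simp only [Function.comp_def, add_comm _ n] at this
      exact (this.sub_const _).abs
    rw [abs_sub_comm]
    exact le_of_tendsto' h2 fun m => hcauchy y hy n m
  have hu1 : ∀ n, ∫ t in Ioc (c 0) (c 0 + 1), u n t = 1 := fun n => (hiter _ h1 n).2.trans h11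
  have hlow : ∀ y ∈ Ioc (c 0) (c 0 + 1), Real.exp (-a) ≤ ρ y := fun y hy =>
    ge_of_tendsto' (hρ y hy) fun n => (hiter _ h1 n).1.exp_le_of_integral_eq ha.le (hu1 n) hy
  have hρcone : LogLip a (Ioc (c 0) (c 0 + 1)) ρ := by
    refine ⟨fun y hy => (Real.exp_pos _).trans_le (hlow y hy), fun x hx y hy => ?_⟩
    exact le_of_tendsto_of_tendsto' (hρ x hx) ((hρ y hy).const_mul _)
      fun n => (hiter _ h1 n).1.le_exp x hx y hy
  have hρ1 : ∫ t in Ioc (c 0) (c 0 + 1), ρ t = 1 := by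
    have h3 : Tendsto (fun n => ∫ t in Ioc (c 0) (c 0 + 1), u n t) atTop
        (𝓝 (∫ t in Ioc (c 0) (c 0 + 1), ρ t)) := by
      refine tendsto_integral_of_dominated_convergence (fun _ => Real.exp a)
        (fun n => (hiter _ h1 n).1.aestronglyMeasurable) (integrable_const _) (fun n => ?_) ?_
      · filter_upwards [ae_restrict_mem measurableSet_Ioc] with y hy
        rw [Real.norm_of_nonneg ((hiter _ h1 n).1.pos y hy).le]
        exact (hiter _ h1 n).1.le_exp_of_integral_eq ha.le (hu1 n) hy
      · filter_upwards [ae_restrict_mem measurableSet_Ioc] with y hy using hρ y hy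
    simp only [hu1] at h3
    exact tendsto_nhds_unique h3 tendsto_const_nhds
  have hfix : ∀ y ∈ Ioc (c 0) (c 0 + 1), transfer d c g ρ y = ρ y := by
    intro y hy
    have h3 : Tendsto (fun n => u (n + 1) y) atTop (𝓝 (transfer d c g ρ y)) := by
      simp only [hu, Function.iterate_succ_apply']
      refine tendsto_finsetSum _ fun i hi => Tendsto.mul_const _ ?_
      have hi := Finset.mem_range.1 hi
      exact hρ _ (H.Ioc_subset hi (H.invBranch_mem hi hy))
    exact tendsto_nhds_unique h3 ((hρ y hy).comp (tendsto_add_atTop_nat 1))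
  refine ⟨a, θ, ρ, ha, hθ0, hθ1, hρcone, hρ1, hfix, fun f hf hf1 n => ⟨(hiter f hf n).1, ?_⟩⟩
  -- The density `ρ` is fixed only on the fundamental domain, so iterating needs `transfer_congr`.
  have hfixn : ∀ n, ∀ y ∈ Ioc (c 0) (c 0 + 1), (transfer d c g)^[n] ρ y = ρ y := by
    intro n
    induction n with
    | zero => exact fun y _ => rfl
    | succ n ih =>
      intro y hy
      rw [Function.iterate_succ_apply', H.transfer_congr ih hy, hfix y hy]
  intro y hy
  have := hcontr n f ρ hf hρcone hf1 hρ1 y hy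
  rwa [hfixn n y hy] at this

end ExpandingBranches

/-! ### Ergodicity of all powers of the expanding map -/

/-- Small perturbations of the constant density stay in the cone. By linearity, an identity known on
the cone thus extends to arbitrary smooth test functions. -/
theorem logLip_one_add_smul {a M L δ : ℝ} {s : Set ℝ} {ψ : ℝ → ℝ} (hM : ∀ x, |ψ x| ≤ M)
    (hL : ∀ x y, |ψ x - ψ y| ≤ L * |x - y|) (hδ0 : 0 ≤ δ) (hδM : δ * M ≤ 1 / 2)
    (hδL : δ * L ≤ a / 2) : LogLip a s fun x => 1 + δ * ψ x := by
  have hlow : ∀ x, 1 / 2 ≤ 1 + δ * ψ x := fun x => by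
    have := mul_le_mul_of_nonneg_left (neg_le_of_abs_le (hM x)) hδ0
    linarith
  refine ⟨fun x _ => by linarith [hlow x], fun x _ y _ => ?_⟩
  have h1 : δ * (ψ x - ψ y) ≤ a / 2 * |x - y| := by
    calc δ * (ψ x - ψ y) ≤ δ * (L * |x - y|) := by gcongr; exact (le_abs_self _).trans (hL x y)
      _ = δ * L * |x - y| := by ring
      _ ≤ a / 2 * |x - y| := by gcongr
  have h2 := Real.add_one_le_exp (a * |x - y|)
  have h3 := hlow y
  -- No sign of `a` is assumed. For `x ≠ y`, a negative `a` contradicts `δ * L ≤ a / 2`.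
  by_cases h4 : 0 ≤ a * |x - y|
  · nlinarith
  · have h5 : |x - y| = 0 ∨ 0 < |x - y| := (abs_nonneg _).eq_or_lt.imp Eq.symm id
    rcases h5 with h5 | h5
    · simp [h5] at h4
    · have ha : a < 0 := by
        by_contra! h
        exact h4 (mul_nonneg h h5.le)
      have h6 : |x - y| ≠ 0 := h5.ne'
      have h7 : δ * L < 0 := by linarith
      have h8 : 0 ≤ L * |x - y| := (abs_nonneg _).trans (hL x y)
      have h9 : 0 ≤ L := nonneg_of_mul_nonneg_left h8 h5
      nlinarith [mul_nonneg hδ0 h9]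

theorem map_coe_restrict_Ioc (a : ℝ) :
    (volume.restrict (Ioc a (a + 1))).map ((↑) : ℝ → UnitAddCircle) = volume :=
  (UnitAddCircle.measurePreserving_mk a).map_eq

theorem ae_circle_iff (a : ℝ) {A : Set UnitAddCircle} (hA : MeasurableSet A) :
    (∀ᵐ x : UnitAddCircle, x ∈ A) ↔
      ∀ᵐ t : ℝ ∂(volume.restrict (Ioc a (a + 1))), (t : UnitAddCircle) ∈ A := by
  have h := ae_map_iff (μ := volume.restrict (Ioc a (a + 1))) (p := fun x => x ∈ A)
    measurable_coe_circle.aemeasurable hA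
  rw [map_coe_restrict_Ioc] at h
  exact h

theorem circleMeasure_absolutelyContinuous (a : ℝ) (f : ℝ → ℝ) : circleMeasure a f ≪ volume := by
  rw [← map_coe_restrict_Ioc a]
  exact (withDensity_absolutelyContinuous _ _).map measurable_coe_circle

theorem LogLip.absolutelyContinuous_circleMeasure {a b : ℝ} {f : ℝ → ℝ}
    (hf : LogLip a (Ioc b (b + 1)) f) : volume ≪ circleMeasure b f := by
  rw [← map_coe_restrict_Ioc b]
  refine (withDensity_absolutelyContinuous' hf.aestronglyMeasurable.aemeasurable.ennreal_ofReal
    ?_).map measurable_coe_circle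
  filter_upwards [ae_restrict_mem measurableSet_Ioc] with x hx
  simpa using hf.pos x hx

namespace ExpandingBranches

variable {d : ℕ} {c : ℕ → ℝ} {g : ℕ → ℝ → ℝ} {σ : ℝ} {T : UnitAddCircle → UnitAddCircle}

/-- A piecewise `C²` expanding map of the circle with full branches has an invariant probability
measure which is equivalent to Lebesgue measure and ergodic for all iterates of the map. -/
theorem exists_ergodic_measure (H : ExpandingBranches d c g σ) (hT : Measurable T)
    (hTg : ∀ i < d, ∀ t ∈ Ioc (c i) (c (i + 1)), T t = (g i t : UnitAddCircle)) :
    ∃ μ : Measure UnitAddCircle, IsProbabilityMeasure μ ∧ μ ≪ volume ∧ volume ≪ μ ∧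
      MeasurePreserving T μ μ ∧ ∀ k > 0, Ergodic T^[k] μ := by
  obtain ⟨a, θ, ρ, ha, hθ0, hθ1, hρ, hρ1, hfix, hconv⟩ := H.exists_invariant_density hT hTg
  have hpres : MeasurePreserving T (circleMeasure (c 0) ρ) (circleMeasure (c 0) ρ) :=
    ⟨hT, (H.map_circleMeasure hT hTg ha.le hρ).trans (circleMeasure_congr hfix)⟩
  have hprob : IsProbabilityMeasure (circleMeasure (c 0) ρ) :=
    ⟨by rw [hρ.circleMeasure_univ ha.le, hρ1, ENNReal.ofReal_one]⟩
  refine ⟨circleMeasure (c 0) ρ, hprob, circleMeasure_absolutelyContinuous _ _,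
    hρ.absolutelyContinuous_circleMeasure, hpres, fun k hk => ⟨hpres.iterate k, ⟨fun A hA hAk => ?_⟩⟩⟩
  have hm := measurable_coe_circle hA
  have hind : ∀ f, LogLip a (Ioc (c 0) (c 0 + 1)) f → Integrable
      (((↑) ⁻¹' A : Set ℝ).indicator f) (volume.restrict (Ioc (c 0) (c 0 + 1))) :=
    fun f hf => (hf.integrable ha.le).indicator hm
  set m := (circleMeasure (c 0) ρ).real A with hmdef
  have hmap : ∀ f, LogLip a (Ioc (c 0) (c 0 + 1)) f → ∫ t in Ioc (c 0) (c 0 + 1), f t = 1 →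
      ∀ n, (circleMeasure (c 0) f).map T^[n] =
        circleMeasure (c 0) ((transfer d c g)^[n] f) := by
    intro f hf hf1 n
    induction n with
    | zero => exact Measure.map_id
    | succ n ih =>
      rw [Function.iterate_succ', ← Measure.map_map hT (hT.iterate n), ih,
        H.map_circleMeasure hT hTg ha.le (hconv f hf hf1 n).1, Function.iterate_succ_apply']
  -- Invariance of `A` under `T^k` means that applying the transfer operator `k * n` times does not
  -- change the mass of `A`. As the densities converge to `ρ`, every normalized density of the cone
  -- gives `A` the same mass `m`.
  have hnorm : ∀ f, LogLip a (Ioc (c 0) (c 0 + 1)) f → ∫ t in Ioc (c 0) (c 0 + 1), f t = 1 →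
      ∫ t in Ioc (c 0) (c 0 + 1), ((↑) ⁻¹' A : Set ℝ).indicator f t = m := by
    intro f hf hf1
    have h1 : ∀ n, |(∫ t in Ioc (c 0) (c 0 + 1), ((↑) ⁻¹' A : Set ℝ).indicator f t) - m| ≤
        θ ^ (k * n) * Real.exp a := by
      intro n
      have h2 : T^[k * n] ⁻¹' A = A := by
        rw [Function.iterate_mul]
        exact Function.IsFixedPt.preimage_iterate hAk n
      have h3 : (circleMeasure (c 0) f).real A =
          (circleMeasure (c 0) ((transfer d c g)^[k * n] f)).real A := by
        rw [← hmap f hf hf1, Measure.real, Measure.real, Measure.map_apply (hT.iterate _) hA, h2]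
      obtain ⟨h4, h5⟩ := hconv f hf hf1 (k * n)
      rw [← hf.circleMeasure_real hA, h3, h4.circleMeasure_real hA, hmdef,
        hρ.circleMeasure_real hA, ← integral_sub (hind _ h4) (hind _ hρ)]
      have h6 := norm_integral_le_of_norm_le_const (μ := volume.restrict (Ioc (c 0) (c 0 + 1)))
        (C := θ ^ (k * n) * Real.exp a) (f := fun t =>
          ((↑) ⁻¹' A : Set ℝ).indicator ((transfer d c g)^[k * n] f) t -
          ((↑) ⁻¹' A : Set ℝ).indicator ρ t) (by
            filter_upwards [ae_restrict_mem measurableSet_Ioc] with t ht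
            by_cases htA : t ∈ ((↑) ⁻¹' A : Set ℝ)
            · simp only [indicator_of_mem htA, Real.norm_eq_abs]
              exact h5 t ht
            · simp only [indicator_of_notMem htA, sub_self, norm_zero]
              positivity)
      rwa [probReal_univ, mul_one, Real.norm_eq_abs] at h6
    have h2 : Tendsto (fun n => θ ^ (k * n) * Real.exp a) atTop (𝓝 0) := by
      simpa using ((tendsto_pow_atTop_nhds_zero_of_lt_one hθ0 hθ1).comp
        (tendsto_id.const_mul_atTop' hk)).mul_const (Real.exp a)
    have h3 := ge_of_tendsto' h2 h1
    exact sub_eq_zero.1 (abs_eq_zero.1 (le_antisymm h3 (abs_nonneg _)))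
  have hgen : ∀ f, LogLip a (Ioc (c 0) (c 0 + 1)) f →
      ∫ t in Ioc (c 0) (c 0 + 1), ((↑) ⁻¹' A : Set ℝ).indicator f t =
        m * ∫ t in Ioc (c 0) (c 0 + 1), f t := by
    intro f hf
    set I := ∫ t in Ioc (c 0) (c 0 + 1), f t
    have hI : 0 < I := by
      have hc : c 0 + 1 ∈ Ioc (c 0) (c 0 + 1) := ⟨by linarith, le_rfl⟩
      have h2 : ∫ _ in Ioc (c 0) (c 0 + 1), (Real.exp a)⁻¹ * f (c 0 + 1) ≤ I := by
        refine setIntegral_mono_on (integrable_const _) (hf.integrable ha.le) measurableSet_Ioc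
          fun y hy => ?_
        rw [inv_mul_le_iff₀ (Real.exp_pos _)]
        exact hf.le_mul ha.le hc hy
      refine lt_of_lt_of_le ?_ h2
      rw [integral_const, probReal_univ, one_smul]
      exact mul_pos (inv_pos.2 (Real.exp_pos a)) (hf.pos _ hc)
    have h1 := hnorm (fun t => I⁻¹ * f t)
      ⟨fun x hx => mul_pos (inv_pos.2 hI) (hf.pos x hx), fun x hx y hy => by
        have := mul_le_mul_of_nonneg_left (hf.le_exp x hx y hy) (inv_pos.2 hI).le
        linarith⟩ (by rw [integral_const_mul]; exact inv_mul_cancel₀ hI.ne')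
    have h2 : ∀ t, ((↑) ⁻¹' A : Set ℝ).indicator (fun t => I⁻¹ * f t) t =
        I⁻¹ * ((↑) ⁻¹' A : Set ℝ).indicator f t := fun t => by
      by_cases htA : t ∈ ((↑) ⁻¹' A : Set ℝ)
      · simp only [indicator_of_mem htA]
      · simp only [indicator_of_notMem htA, mul_zero]
    simp only [h2, integral_const_mul] at h1
    rw [← h1]
    field_simp
  -- Testing with `1` and with `1 + δ ψ` gives `∫ ψ (1_A - m) = 0` for every bump function `ψ`. So
  -- the indicator of `A` is almost everywhere the constant `m`, and `A` is null or of full measure.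
  have hae : ∀ᵐ x : ℝ, x ∈ Ioo (c 0) (c 0 + 1) →
      ((↑) ⁻¹' A : Set ℝ).indicator (fun _ => (1 : ℝ)) x - m = 0 := by
    refine isOpen_Ioo.ae_eq_zero_of_integral_contDiff_smul_eq_zero ?_ ?_
    · refine LocallyIntegrable.locallyIntegrableOn ?_ _
      refine LocallyIntegrable.sub ?_ (locallyIntegrable_const m)
      exact (locallyIntegrable_const (1 : ℝ)).indicator hm
    · intro ψ hψ hψc hψU
      obtain ⟨L, hL⟩ := (hψ.of_le (m := 1) (by norm_cast)).lipschitzWith_of_hasCompactSupport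
        hψc (by norm_num)
      obtain ⟨M, hM⟩ := hψc.exists_bound_of_continuous hψ.continuous
      have hM0 : 0 ≤ M := (norm_nonneg _).trans (hM 0)
      set δ := min (1 / (2 * (M + 1))) (a / (2 * (L + 1)))
      have hδ0 : 0 < δ := by positivity
      have hf := logLip_one_add_smul (a := a) (L := L) (M := M) (δ := δ)
        (s := Ioc (c 0) (c 0 + 1)) hM
        (fun x y => by simpa [Real.dist_eq] using hL.dist_le_mul x y) hδ0.le (by
          calc δ * M ≤ 1 / (2 * (M + 1)) * (M + 1) := by
                gcongr
                · exact min_le_left _ _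
                · linarith
            _ = 1 / 2 := by field_simp) (by
          calc δ * L ≤ a / (2 * (L + 1)) * (L + 1) := by
                gcongr
                · exact min_le_right _ _
                · linarith
            _ = a / 2 := by field_simp)
      have e1 := hgen _ hf
      have e2 := hgen _ (logLip_one ha.le _)
      have hψi : Integrable ψ (volume.restrict (Ioc (c 0) (c 0 + 1))) :=
        (hψ.continuous.integrable_of_hasCompactSupport hψc).restrict
      have e3 : ∀ t, ((↑) ⁻¹' A : Set ℝ).indicator (fun t => 1 + δ * ψ t) t =
          ((↑) ⁻¹' A : Set ℝ).indicator (fun _ => 1) t +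
            δ * ((↑) ⁻¹' A : Set ℝ).indicator ψ t := fun t => by
        by_cases htA : t ∈ ((↑) ⁻¹' A : Set ℝ)
        · simp only [indicator_of_mem htA]
        · simp only [indicator_of_notMem htA, mul_zero, add_zero]
      simp only [e3] at e1
      rw [integral_add (hind _ (logLip_one ha.le _)) ((hψi.indicator hm).const_mul _),
        integral_add (integrable_const _) (hψi.const_mul _), e2, integral_const_mul,
        integral_const_mul] at e1
      have e4 : ∫ t in Ioc (c 0) (c 0 + 1), ((↑) ⁻¹' A : Set ℝ).indicator ψ t =
          m * ∫ t in Ioc (c 0) (c 0 + 1), ψ t :=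
        mul_left_cancel₀ hδ0.ne' (by linarith)
      rw [← setIntegral_eq_integral_of_forall_compl_eq_zero (s := Ioc (c 0) (c 0 + 1))]
      · have e5 : ∀ t, ψ t • (((↑) ⁻¹' A : Set ℝ).indicator (fun _ => (1 : ℝ)) t - m) =
            ((↑) ⁻¹' A : Set ℝ).indicator ψ t - m * ψ t := fun t => by
          by_cases htA : t ∈ ((↑) ⁻¹' A : Set ℝ)
          · simp only [indicator_of_mem htA, smul_eq_mul]; ring
          · simp only [indicator_of_notMem htA, smul_eq_mul]; ring
        simp only [e5]
        rw [integral_sub (hψi.indicator hm) (hψi.const_mul _), e4, integral_const_mul, sub_self]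
      · intro x hx
        have : ψ x = 0 := by
          by_contra h
          exact hx (Ioo_subset_Ioc_self (hψU (subset_tsupport ψ h)))
        simp [this]
  have hae2 : ∀ᵐ x ∂(volume.restrict (Ioc (c 0) (c 0 + 1))),
      ((↑) ⁻¹' A : Set ℝ).indicator (fun _ => (1 : ℝ)) x = m := by
    rw [← restrict_Ioo_eq_restrict_Ioc]
    rw [ae_restrict_iff' measurableSet_Ioo]
    filter_upwards [hae] with x hx hxI using sub_eq_zero.1 (hx hxI)
  have hac : circleMeasure (c 0) ρ ≪ volume := circleMeasure_absolutelyContinuous _ _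
  rw [eventuallyConst_set]
  by_cases hm1 : m = 1
  · left
    refine hac.ae_le ((ae_circle_iff (c 0) hA).2 ?_)
    filter_upwards [hae2] with x hx
    by_contra h
    rw [indicator_of_notMem (show x ∉ ((↑) ⁻¹' A : Set ℝ) from h), hm1] at hx
    exact zero_ne_one hx
  · right
    refine hac.ae_le ((ae_circle_iff (c 0) hA.compl).2 ?_)
    filter_upwards [hae2] with x hx h
    rw [indicator_of_mem (show x ∈ ((↑) ⁻¹' A : Set ℝ) from h)] at hx
    exact hm1 hx.symm

end ExpandingBranches

/-! ### Product with a cyclic permutation -/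

section Cyclic

variable {X : Type*} [MeasurableSpace X] {T : X → X} {μ : Measure X} {k : ℕ}

/-- The uniform probability measure on `ℤ / k`. -/
noncomputable def uniformZMod (k : ℕ) : Measure (ZMod k) := (k : ENNReal)⁻¹ • Measure.count

theorem uniformZMod_singleton_ne_zero (i : ZMod k) : uniformZMod k {i} ≠ 0 := by
  rw [uniformZMod, Measure.smul_apply, Measure.count_singleton, smul_eq_mul, mul_one]
  simp

variable [NeZero k]

instance isProbabilityMeasure_uniformZMod : IsProbabilityMeasure (uniformZMod k) := by
  constructor
  rw [uniformZMod, Measure.smul_apply, Measure.count_univ, smul_eq_mul,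
    ENat.card_eq_coe_fintype_card, ZMod.card]
  exact ENNReal.inv_mul_cancel (by simp [NeZero.ne k]) (by simp)

theorem measurePreserving_add_one_uniformZMod :
    MeasurePreserving (fun i : ZMod k => i + 1) (uniformZMod k) (uniformZMod k) := by
  refine MeasurePreserving.smul_measure ⟨measurable_of_countable _, ?_⟩ _
  refine Measure.ext fun s hs => ?_
  rw [Measure.map_apply (measurable_of_countable _) hs,
    Measure.count_apply ((measurable_of_countable _) hs), Measure.count_apply hs]
  congr 1
  exact Set.encard_preimage_of_bijective (Equiv.addRight (1 : ZMod k)).bijective s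

theorem ae_prod_uniformZMod [SFinite μ] {s : Set (X × ZMod k)} (hs : MeasurableSet s)
    (h : ∀ i, ∀ᵐ x ∂μ, (x, i) ∈ s) : ∀ᵐ z ∂(μ.prod (uniformZMod k)), z ∈ s := by
  rw [ae_iff]
  change (μ.prod (uniformZMod k)) sᶜ = 0
  rw [Measure.prod_apply_symm hs.compl]
  have : ∀ i : ZMod k, μ ((fun x => (x, i)) ⁻¹' sᶜ) = 0 := fun i => h i
  simp only [this, lintegral_zero]

/-- An invariant set is determined by its section over `0`, and that section is invariant under
`T^k` only. Hence the ergodicity hypothesis is on `T^k`. -/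
theorem ergodic_prod_add_one [IsProbabilityMeasure μ] (hT : MeasurePreserving T μ μ)
    (hTk : Ergodic T^[k] μ) :
    Ergodic (fun z : X × ZMod k => (T z.1, z.2 + 1)) (μ.prod (uniformZMod k)) := by
  have hpres : MeasurePreserving (fun z : X × ZMod k => (T z.1, z.2 + 1))
      (μ.prod (uniformZMod k)) (μ.prod (uniformZMod k)) :=
    hT.prod measurePreserving_add_one_uniformZMod
  refine ⟨hpres, ⟨fun s hs hinv => ?_⟩⟩
  have hsec : ∀ i : ZMod k, MeasurableSet {x | (x, i) ∈ s} := fun i => measurable_prodMk_right hs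
  have hstep : ∀ i : ZMod k, T ⁻¹' {x | (x, i + 1) ∈ s} = {x | (x, i) ∈ s} := by
    intro i
    ext x
    conv_rhs => rw [mem_ofPred_eq, ← hinv]
    rfl
  have hiter : ∀ (n : ℕ) (i : ZMod k), T^[n] ⁻¹' {x | (x, i + n) ∈ s} = {x | (x, i) ∈ s} := by
    intro n
    induction n with
    | zero => intro i; simp
    | succ n ih =>
      intro i
      rw [Function.iterate_succ, preimage_comp, Nat.cast_succ, add_comm (n : ZMod k) 1, ← add_assoc,
        ih, hstep]
  have hk : T^[k] ⁻¹' {x | (x, (0 : ZMod k)) ∈ s} = {x | (x, (0 : ZMod k)) ∈ s} := by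
    simpa using hiter k 0
  have hback : ∀ i : ZMod k, ∃ n : ℕ, i + n = 0 := fun i =>
    ⟨(-i).val, by rw [ZMod.natCast_zmod_val, add_neg_cancel]⟩
  rw [eventuallyConst_set]
  rcases hTk.toPreErgodic.ae_mem_or_ae_notMem (hsec 0) hk with h | h
  · left
    refine ae_prod_uniformZMod hs fun i => ?_
    obtain ⟨n, hn⟩ := hback i
    have := (hT.iterate n).quasiMeasurePreserving.ae h
    filter_upwards [this] with x hx
    have h2 := hiter n i
    rw [hn] at h2
    exact h2.subset hx
  · right
    refine ae_prod_uniformZMod (s := sᶜ) hs.compl fun i => ?_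
    obtain ⟨n, hn⟩ := hback i
    have := (hT.iterate n).quasiMeasurePreserving.ae h
    filter_upwards [this] with x hx
    have h2 := hiter n i
    rw [hn] at h2
    exact fun hxs => hx (h2.symm.subset hxs)

end Cyclic

/-! ### Contracting skew products of the cylinder -/

/-- A piecewise smooth skew product over an expanding map which permutes cyclically the strips
`|x - p j| ≤ ω j` and contracts their fibres. -/
structure ContractingSkewProduct (d : ℕ) (c : ℕ → ℝ) (g : ℕ → ℝ → ℝ) (σ : ℝ) (F : ℕ → ℝ × ℝ → ℝ)
    (k : ℕ) (p ω : ZMod k → ℝ) (κ : ℝ) (φ : Cylinder → Cylinder) : Prop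
    extends ExpandingBranches d c g σ where
  map_eq : ∀ i < d, ∀ t ∈ Ioc (c i) (c (i + 1)), ∀ x : ℝ,
    φ ((t : UnitAddCircle), x) = ((g i t : UnitAddCircle), F i (t, x))
  smooth_fibre : ∀ i < d, ContDiff ℝ 1 (F i)
  width_pos : ∀ j, 0 < ω j
  rate_pos : 0 < κ
  rate_lt_one : κ < 1
  trapping : ∀ i < d, ∀ t ∈ Ioc (c i) (c (i + 1)), ∀ j x, |x - p j| ≤ ω j →
    |F i (t, x) - p (j + 1)| < ω (j + 1)
  contraction : ∀ i < d, ∀ t ∈ Ioc (c i) (c (i + 1)), ∀ j x, |x - p j| ≤ ω j →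
    |fderiv ℝ (F i) (t, x) (0, 1)| ≤ κ * (ω (j + 1) / ω j)

/-- The representative of a point of the circle in `(a, a + 1]`. -/
noncomputable def rep (a : ℝ) (θ : UnitAddCircle) : ℝ := AddCircle.equivIoc 1 a θ

theorem rep_mem (a : ℝ) (θ : UnitAddCircle) : rep a θ ∈ Ioc a (a + 1) :=
  (AddCircle.equivIoc 1 a θ).2

theorem coe_rep (a : ℝ) (θ : UnitAddCircle) : (rep a θ : UnitAddCircle) = θ :=
  AddCircle.coe_equivIoc

theorem measurable_rep (a : ℝ) : Measurable (rep a) :=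
  measurable_subtype_coe.comp (AddCircle.measurableEquivIoc 1 a).measurable

namespace ExpandingBranches

variable {d : ℕ} {c : ℕ → ℝ} {g : ℕ → ℝ → ℝ} {σ : ℝ}

theorem exists_mem_Ioc (H : ExpandingBranches d c g σ) {t : ℝ} (ht : t ∈ Ioc (c 0) (c 0 + 1)) :
    ∃ i < d, t ∈ Ioc (c i) (c (i + 1)) := by
  rw [← H.total] at ht
  have : ∀ n ≤ d, t ∈ Ioc (c 0) (c n) → ∃ i < n, t ∈ Ioc (c i) (c (i + 1)) := by
    intro n
    induction n with
    | zero => intro _ h; exact absurd (h.1.trans_le h.2) (lt_irrefl _)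
    | succ n ih =>
      intro hn h
      by_cases h1 : t ≤ c n
      · obtain ⟨i, hi, h2⟩ := ih (by omega) ⟨h.1, h1⟩
        exact ⟨i, by omega, h2⟩
      · exact ⟨n, by omega, not_le.1 h1, h.2⟩
  exact this d le_rfl ht

theorem eq_of_mem_Ioc (H : ExpandingBranches d c g σ) {t : ℝ} {i j : ℕ} (hi : i < d) (hj : j < d)
    (hti : t ∈ Ioc (c i) (c (i + 1))) (htj : t ∈ Ioc (c j) (c (j + 1))) : i = j := by
  rcases lt_trichotomy i j with h | h | h
  · have := H.mono_c (show i + 1 ≤ j by omega) hj.le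
    linarith [hti.2, htj.1]
  · exact h
  · have := H.mono_c (show j + 1 ≤ i by omega) hi.le
    linarith [htj.2, hti.1]

end ExpandingBranches

open Classical in
/-- The index of the arc `(c i, c (i + 1)]` containing a point of the circle. -/
noncomputable def arcIndex (d : ℕ) (c : ℕ → ℝ) (θ : UnitAddCircle) : ℕ :=
  if h : ∃ i < d, rep (c 0) θ ∈ Ioc (c i) (c (i + 1)) then h.choose else 0

namespace ExpandingBranches

variable {d : ℕ} {c : ℕ → ℝ} {g : ℕ → ℝ → ℝ} {σ : ℝ}

theorem arcIndex_spec (H : ExpandingBranches d c g σ) (θ : UnitAddCircle) :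
    arcIndex d c θ < d ∧ rep (c 0) θ ∈ Ioc (c (arcIndex d c θ)) (c (arcIndex d c θ + 1)) := by
  have h := H.exists_mem_Ioc (rep_mem (c 0) θ)
  rw [arcIndex, dif_pos h]
  exact h.choose_spec

theorem arcIndex_eq (H : ExpandingBranches d c g σ) {θ : UnitAddCircle} {i : ℕ} (hi : i < d)
    (h : rep (c 0) θ ∈ Ioc (c i) (c (i + 1))) : arcIndex d c θ = i :=
  H.eq_of_mem_Ioc (H.arcIndex_spec θ).1 hi (H.arcIndex_spec θ).2 h

theorem measurable_arcIndex (H : ExpandingBranches d c g σ) : Measurable (arcIndex d c) := by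
  refine measurable_to_countable' fun i => ?_
  by_cases hi : i < d
  · have : arcIndex d c ⁻¹' {i} = rep (c 0) ⁻¹' Ioc (c i) (c (i + 1)) := by
      ext θ
      refine ⟨?_, fun h => H.arcIndex_eq hi h⟩
      rintro rfl
      exact (H.arcIndex_spec θ).2
    rw [this]
    exact measurable_rep _ measurableSet_Ioc
  · convert MeasurableSet.empty
    ext θ
    simp only [mem_preimage, mem_singleton_iff, mem_empty_iff_false, iff_false]
    rintro rfl
    exact hi (H.arcIndex_spec θ).1

/-- A function given by a measurable formula over each arc is measurable. -/
theorem measurable_piecewise (H : ExpandingBranches d c g σ) {Y Z : Type*} [MeasurableSpace Y]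
    [MeasurableSpace Z] {q : Y → UnitAddCircle} (hq : Measurable q) {f : ℕ → Y → Z}
    (hf : ∀ i < d, Measurable (f i)) : Measurable fun y => f (arcIndex d c (q y)) y := by
  intro s hs
  have : (fun y => f (arcIndex d c (q y)) y) ⁻¹' s =
      ⋃ i ∈ Finset.range d, ((fun y => arcIndex d c (q y)) ⁻¹' {i} ∩ f i ⁻¹' s) := by
    ext y
    simp only [mem_preimage, mem_iUnion, mem_inter_iff, mem_singleton_iff, Finset.mem_range]
    exact ⟨fun h => ⟨_, (H.arcIndex_spec _).1, rfl, h⟩, by rintro ⟨i, _, rfl, h⟩; exact h⟩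
  rw [this]
  exact Finset.measurableSet_biUnion _ fun i hi =>
    ((H.measurable_arcIndex.comp hq) (measurableSet_singleton i)).inter
      (hf i (Finset.mem_range.1 hi) hs)

end ExpandingBranches

/-! ### Regularity of the skew product away from the arc end points -/

theorem continuous_cover : Continuous cover :=
  ((AddCircle.continuous_mk' 1).comp continuous_fst).prodMk continuous_snd

theorem isOpenMap_cover : IsOpenMap cover :=
  (QuotientAddGroup.isOpenMap_coe).prodMap IsOpenMap.id

theorem map_nhds_cover (q : ℝ × ℝ) : map cover (𝓝 q) = 𝓝 (cover q) :=
  isOpenMap_cover.map_nhds_eq continuous_cover.continuousAt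

/-- The first coordinate of a skew product. -/
def baseMap (φ : Cylinder → Cylinder) (θ : UnitAddCircle) : UnitAddCircle := (φ (θ, 0)).1

/-- The end points of the arcs. -/
def arcEnds (d : ℕ) (c : ℕ → ℝ) : Set UnitAddCircle := (fun i => (c i : UnitAddCircle)) '' Iic d

theorem finite_arcEnds (d : ℕ) (c : ℕ → ℝ) : (arcEnds d c).Finite := (finite_Iic d).image _

/-- Off the end points the representative is interior to its arc, so near such a point a single
smooth branch describes the map. -/
theorem rep_mem_Ioo {d : ℕ} {c : ℕ → ℝ} {g : ℕ → ℝ → ℝ} {σ : ℝ}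
    (H : ExpandingBranches d c g σ) {θ : UnitAddCircle} (hθ : θ ∉ arcEnds d c) :
    rep (c 0) θ ∈ Ioo (c (arcIndex d c θ)) (c (arcIndex d c θ + 1)) := by
  obtain ⟨h1, h2⟩ := H.arcIndex_spec θ
  refine ⟨h2.1, lt_of_le_of_ne h2.2 fun h => hθ ⟨arcIndex d c θ + 1, ?_, ?_⟩⟩
  · simpa using h1
  · change ((c (arcIndex d c θ + 1) : ℝ) : UnitAddCircle) = θ
    rw [← h, coe_rep]

namespace ContractingSkewProduct

variable {d : ℕ} {c : ℕ → ℝ} {g : ℕ → ℝ → ℝ} {σ : ℝ} {F : ℕ → ℝ × ℝ → ℝ} {k : ℕ}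
  {p ω : ZMod k → ℝ} {κ : ℝ} {φ : Cylinder → Cylinder}

theorem apply_eq (H : ContractingSkewProduct d c g σ F k p ω κ φ) (z : Cylinder) :
    φ z = ((g (arcIndex d c z.1) (rep (c 0) z.1) : UnitAddCircle),
      F (arcIndex d c z.1) (rep (c 0) z.1, z.2)) := by
  obtain ⟨h1, h2⟩ := H.arcIndex_spec z.1
  have := H.map_eq _ h1 _ h2 z.2
  rwa [coe_rep] at this

theorem fst_apply (H : ContractingSkewProduct d c g σ F k p ω κ φ) (z : Cylinder) :
    (φ z).1 = baseMap φ z.1 := by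
  rw [baseMap, H.apply_eq, H.apply_eq]

theorem baseMap_coe (H : ContractingSkewProduct d c g σ F k p ω κ φ) :
    ∀ i < d, ∀ t ∈ Ioc (c i) (c (i + 1)), baseMap φ t = (g i t : UnitAddCircle) := by
  intro i hi t ht
  rw [baseMap, H.map_eq i hi t ht]

protected theorem measurable (H : ContractingSkewProduct d c g σ F k p ω κ φ) : Measurable φ := by
  rw [funext H.apply_eq]
  refine H.measurable_piecewise (Y := Cylinder) (Z := Cylinder) (q := Prod.fst)
    (f := fun i z => (((g i (rep (c 0) z.1) : ℝ) : UnitAddCircle), F i (rep (c 0) z.1, z.2)))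
    measurable_fst fun i hi => ?_
  have hr : Measurable fun z : Cylinder => rep (c 0) z.1 := (measurable_rep _).comp measurable_fst
  have hg : Measurable (g i) := (H.differentiable hi).continuous.measurable
  have hF : Measurable (F i) := (H.smooth_fibre i hi).continuous.measurable
  exact (measurable_coe_circle.comp (hg.comp hr)).prodMk (hF.comp (hr.prodMk measurable_snd))

theorem measurable_baseMap (H : ContractingSkewProduct d c g σ F k p ω κ φ) :
    Measurable (baseMap φ) :=
  (H.measurable.comp (measurable_id.prodMk (measurable_const (a := (0 : ℝ))))).fst

theorem trapped (H : ContractingSkewProduct d c g σ F k p ω κ φ) {z : Cylinder} {j : ZMod k}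
    (hz : |z.2 - p j| ≤ ω j) : |(φ z).2 - p (j + 1)| < ω (j + 1) := by
  obtain ⟨h1, h2⟩ := H.arcIndex_spec z.1
  rw [H.apply_eq]
  exact H.trapping _ h1 _ h2 j _ hz

theorem abs_sub_le (H : ContractingSkewProduct d c g σ F k p ω κ φ) (θ : UnitAddCircle)
    {j : ZMod k} {x y : ℝ} (hx : |x - p j| ≤ ω j) (hy : |y - p j| ≤ ω j) :
    |(φ (θ, x)).2 - (φ (θ, y)).2| ≤ κ * (ω (j + 1) / ω j) * |x - y| := by
  obtain ⟨h1, h2⟩ := H.arcIndex_spec θ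
  rw [H.apply_eq, H.apply_eq]
  have hderiv : ∀ s, HasDerivAt (fun s => F (arcIndex d c θ) (rep (c 0) θ, s))
      (fderiv ℝ (F (arcIndex d c θ)) (rep (c 0) θ, s) (0, 1)) s := by
    intro s
    have hF := ((H.smooth_fibre _ h1).differentiable (by norm_num)) (rep (c 0) θ, s)
    exact hF.hasFDerivAt.comp_hasDerivAt s ((hasDerivAt_const s _).prodMk (hasDerivAt_id s))
  have hmem : ∀ s, s ∈ Icc (p j - ω j) (p j + ω j) ↔ |s - p j| ≤ ω j := fun s => by
    rw [abs_le, mem_Icc]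
    constructor <;> rintro ⟨h, h'⟩ <;> constructor <;> linarith
  refine (convex_Icc (p j - ω j) (p j + ω j)).norm_image_sub_le_of_norm_hasDerivWithin_le
    (fun s _ => (hderiv s).hasDerivWithinAt) (fun s hs => ?_) ((hmem y).2 hy) ((hmem x).2 hx)
  exact H.contraction _ h1 _ h2 j s ((hmem s).1 hs)

theorem eventually_lift (H : ContractingSkewProduct d c g σ F k p ω κ φ) {i : ℕ} (hi : i < d)
    {t : ℝ} (ht : t ∈ Ioo (c i) (c (i + 1))) (x : ℝ) :
    ∀ᶠ q in 𝓝 (t, x), cover (g i q.1, F i q) = φ (cover q) := by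
  have : ∀ᶠ q : ℝ × ℝ in 𝓝 (t, x), q.1 ∈ Ioo (c i) (c (i + 1)) :=
    continuousAt_fst.eventually (isOpen_Ioo.mem_nhds ht)
  filter_upwards [this] with q hq
  exact (H.map_eq i hi q.1 (Ioo_subset_Ioc_self hq) q.2).symm

theorem continuousAt (H : ContractingSkewProduct d c g σ F k p ω κ φ) {z : Cylinder}
    (hz : z.1 ∉ arcEnds d c) : ContinuousAt φ z := by
  have hi := (H.arcIndex_spec z.1).1
  have ht := rep_mem_Ioo H.toExpandingBranches hz
  have hzc : z = cover (rep (c 0) z.1, z.2) := by rw [cover, coe_rep]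
  have hev := H.eventually_lift hi ht z.2
  rw [ContinuousAt, hzc, ← map_nhds_cover, tendsto_map'_iff, ← hev.self_of_nhds]
  refine Tendsto.congr' hev ?_
  have h1 : Continuous fun q : ℝ × ℝ => cover (g (arcIndex d c z.1) q.1, F (arcIndex d c z.1) q) :=
    continuous_cover.comp (((H.differentiable hi).continuous.comp continuous_fst).prodMk
      (H.smooth_fibre _ hi).continuous)
  exact h1.continuousAt

end ContractingSkewProduct

/-! ### Strip coordinates and the physical measure -/

/-- The parametrization of the strips `|x - p j| ≤ ω j`. -/
def stripChart {k : ℕ} (p ω : ZMod k → ℝ) (w : (UnitAddCircle × ZMod k) × Icc (-1 : ℝ) 1) :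
    Cylinder := (w.1.1, p w.1.2 + ω w.1.2 * w.2)

/-- The action of a skew product on the strips, in coordinates. -/
noncomputable def stripMap {k : ℕ} (p ω : ZMod k → ℝ) (φ : Cylinder → Cylinder)
    (w : (UnitAddCircle × ZMod k) × Icc (-1 : ℝ) 1) : (UnitAddCircle × ZMod k) × Icc (-1 : ℝ) 1 :=
  ((baseMap φ w.1.1, w.1.2 + 1), projIcc (-1) 1 (by norm_num)
    (((φ (stripChart p ω w)).2 - p (w.1.2 + 1)) / ω (w.1.2 + 1)))

section

variable {k : ℕ} {p ω : ZMod k → ℝ}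

theorem continuous_stripChart : Continuous (stripChart p ω) := by
  have h : ∀ f : ZMod k → ℝ, Continuous fun w : (UnitAddCircle × ZMod k) × Icc (-1 : ℝ) 1 =>
      f w.1.2 := fun f => continuous_of_discreteTopology.comp (continuous_snd.comp continuous_fst)
  exact (continuous_fst.comp continuous_fst).prodMk
    ((h p).add ((h ω).mul (continuous_subtype_val.comp continuous_snd)))

instance borelSpace_zmod : BorelSpace (ZMod k) := ⟨borel_eq_top_of_discrete.symm⟩

instance secondCountable_zmod [NeZero k] : SecondCountableTopology (ZMod k) :=
  DiscreteTopology.secondCountableTopology_of_countable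

end

namespace ContractingSkewProduct

variable {d : ℕ} {c : ℕ → ℝ} {g : ℕ → ℝ → ℝ} {σ : ℝ} {F : ℕ → ℝ × ℝ → ℝ} {k : ℕ}
  {p ω : ZMod k → ℝ} {κ : ℝ} {φ : Cylinder → Cylinder}

theorem abs_stripChart_sub_le (H : ContractingSkewProduct d c g σ F k p ω κ φ)
    (w : (UnitAddCircle × ZMod k) × Icc (-1 : ℝ) 1) :
    |(stripChart p ω w).2 - p w.1.2| ≤ ω w.1.2 := by
  have h := H.width_pos w.1.2
  simp only [stripChart, add_sub_cancel_left, abs_mul, abs_of_pos h]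
  exact mul_le_of_le_one_right h.le (abs_le.2 w.2.2)

/-- Trapping keeps the normalized coordinate in `[-1, 1]`, so the projection in `stripMap` never
acts. -/
theorem coe_stripMap (H : ContractingSkewProduct d c g σ F k p ω κ φ)
    (w : (UnitAddCircle × ZMod k) × Icc (-1 : ℝ) 1) :
    ((stripMap p ω φ w).2 : ℝ) =
      ((φ (stripChart p ω w)).2 - p (w.1.2 + 1)) / ω (w.1.2 + 1) := by
  have h := H.width_pos (w.1.2 + 1)
  have h2 : ((φ (stripChart p ω w)).2 - p (w.1.2 + 1)) / ω (w.1.2 + 1) ∈ Icc (-1 : ℝ) 1 := by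
    rw [mem_Icc, ← abs_le, abs_div, abs_of_pos h, div_le_one h]
    exact (H.trapped (H.abs_stripChart_sub_le w)).le
  rw [stripMap, projIcc_of_mem _ h2]

/-- The strips may overlap, so the chart need not be injective. A semiconjugacy is enough, because
invariance, ergodicity and genericity all push forward. -/
theorem semiconj_stripChart (H : ContractingSkewProduct d c g σ F k p ω κ φ) :
    Function.Semiconj (stripChart p ω) (stripMap p ω φ) φ := by
  intro w
  have h := H.width_pos (w.1.2 + 1)
  refine Prod.ext ?_ ?_
  · rw [H.fst_apply]; rfl
  · change p (w.1.2 + 1) + ω (w.1.2 + 1) * ((stripMap p ω φ w).2 : ℝ) = _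
    rw [H.coe_stripMap]
    field_simp
    ring

/-- Normalizing the widths cancels the ratio `ω (j + 1) / ω j` and leaves the uniform rate `κ`. -/
theorem dist_stripMap_le (H : ContractingSkewProduct d c g σ F k p ω κ φ)
    (b : UnitAddCircle × ZMod k) (y y' : Icc (-1 : ℝ) 1) :
    dist (stripMap p ω φ (b, y)).2 (stripMap p ω φ (b, y')).2 ≤ κ * dist y y' := by
  rw [Subtype.dist_eq, Subtype.dist_eq, H.coe_stripMap, H.coe_stripMap, Real.dist_eq, Real.dist_eq]
  have h := H.width_pos (b.2 + 1)
  have h0 := H.width_pos b.2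
  have h1 := H.abs_sub_le b.1 (H.abs_stripChart_sub_le (b, y)) (H.abs_stripChart_sub_le (b, y'))
  simp only [stripChart] at h1 ⊢
  rw [← sub_div, sub_sub_sub_cancel_right, abs_div, abs_of_pos h, div_le_iff₀ h]
  refine h1.trans_eq ?_
  rw [add_sub_add_left_eq_sub, ← mul_sub, abs_mul, abs_of_pos h0]
  field_simp

theorem measurable_stripMap (H : ContractingSkewProduct d c g σ F k p ω κ φ) [NeZero k] :
    Measurable (stripMap p ω φ) := by
  have h : ∀ f : ZMod k → ℝ, Measurable fun w : (UnitAddCircle × ZMod k) × Icc (-1 : ℝ) 1 =>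
      f w.1.2 := fun f => (measurable_of_countable f).comp (measurable_snd.comp measurable_fst)
  have h2 : Measurable fun i : ZMod k => i + 1 := measurable_of_countable _
  refine Measurable.prodMk ((H.measurable_baseMap.comp (measurable_fst.comp measurable_fst)).prodMk
    (h2.comp (measurable_snd.comp measurable_fst))) ?_
  refine continuous_projIcc.measurable.comp ?_
  exact ((measurable_snd.comp (H.measurable.comp continuous_stripChart.measurable)).sub
    (h fun i => p (i + 1))).div (h fun i => ω (i + 1))

theorem continuousAt_stripMap (H : ContractingSkewProduct d c g σ F k p ω κ φ)
    {w : (UnitAddCircle × ZMod k) × Icc (-1 : ℝ) 1} (hw : w.1.1 ∉ arcEnds d c) :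
    ContinuousAt (stripMap p ω φ) w := by
  have h : ∀ f : ZMod k → ℝ, Continuous fun w : (UnitAddCircle × ZMod k) × Icc (-1 : ℝ) 1 =>
      f w.1.2 := fun f => continuous_of_discreteTopology.comp (continuous_snd.comp continuous_fst)
  have h1 : ContinuousAt (fun w => φ (stripChart p ω w)) w :=
    ContinuousAt.comp (f := stripChart p ω) (H.continuousAt hw) continuous_stripChart.continuousAt
  have h2 : ContinuousAt (fun w : (UnitAddCircle × ZMod k) × Icc (-1 : ℝ) 1 => baseMap φ w.1.1) w := by
    have : ContinuousAt (fun w => (φ (stripChart p ω w)).1) w := h1.fst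
    simp only [H.fst_apply] at this
    exact this
  have h3 : Continuous fun w : (UnitAddCircle × ZMod k) × Icc (-1 : ℝ) 1 => w.1.2 + 1 :=
    (continuous_of_discreteTopology (f := fun i : ZMod k => i + 1)).comp
      (continuous_snd.comp continuous_fst)
  refine (h2.prodMk h3.continuousAt).prodMk ?_
  refine continuous_projIcc.continuousAt.comp ?_
  exact (h1.snd.sub (h fun i => p (i + 1)).continuousAt).div (h fun i => ω (i + 1)).continuousAt
    (H.width_pos _).ne'

/-- The physical measure of a contracting skew product. -/
theorem exists_measure (H : ContractingSkewProduct d c g σ F k p ω κ φ) [NeZero k] :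
    ∃ (μ : Measure UnitAddCircle) (ν : Measure Cylinder), IsProbabilityMeasure μ ∧
      IsProbabilityMeasure ν ∧ μ ≪ volume ∧ volume ≪ μ ∧ Ergodic (baseMap φ) μ ∧ Ergodic φ ν ∧
      ν.map Prod.fst = μ ∧ (∀ᵐ z ∂ν, ∃ j, |z.2 - p j| < ω j) ∧
      ∀ᵐ θ ∂μ, ∀ x, |x - p 0| ≤ ω 0 → ∀ u : Cylinder →ᵇ ℝ,
        Tendsto (fun n : ℕ => (∑ j ∈ Finset.range n, u (φ^[j] (θ, x))) / (n : ℝ)) atTop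
          (𝓝 (∫ w, u w ∂ν)) := by
  obtain ⟨μ, hμ, hμv, hvμ, hpres, herg⟩ :=
    H.toExpandingBranches.exists_ergodic_measure H.measurable_baseMap H.baseMap_coe
  have hbase : Ergodic (baseMap φ) μ := by simpa using herg 1 one_pos
  have hcyc := ergodic_prod_add_one hpres (herg k (NeZero.pos k))
  let _ : MetricSpace (ZMod k) := TopologicalSpace.metrizableSpaceMetric (ZMod k)
  have hS : IsClosed (Prod.fst ⁻¹' arcEnds d c : Set (UnitAddCircle × ZMod k)) :=
    (finite_arcEnds d c).isClosed.preimage continuous_fst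
  have hS0 : (μ.prod (uniformZMod k)) (Prod.fst ⁻¹' arcEnds d c) = 0 := by
    have h0 : μ (arcEnds d c) = 0 := by
      refine hμv ?_
      rw [← biUnion_of_singleton (arcEnds d c)]
      refine (measure_biUnion_null_iff (finite_arcEnds d c).countable).2 fun x _ => ?_
      rw [← Metric.closedBall_zero, AddCircle.volume_closedBall]
      simp
    rw [← prod_univ, Measure.prod_prod, h0, zero_mul]
  have : Nonempty (Icc (-1 : ℝ) 1) := ⟨⟨0, by norm_num⟩⟩
  obtain ⟨ν, hν, hνe, hνπ⟩ := exists_ergodic_skewProduct hcyc H.measurable_stripMap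
    (fun _ => rfl) H.rate_pos.le H.rate_lt_one H.dist_stripMap_le hS hS0
    fun z hz => H.continuousAt_stripMap hz
  have hgen := ae_forall_tendsto_birkhoffSum
    (T := fun z : UnitAddCircle × ZMod k => (baseMap φ z.1, z.2 + 1)) (fun _ => rfl) H.rate_pos.le H.rate_lt_one
    H.dist_stripMap_le hνe hνπ
  have hJ : Measurable (stripChart p ω) := continuous_stripChart.measurable
  have hνφ : Ergodic φ (ν.map (stripChart p ω)) :=
    MeasurePreserving.ergodic_of_ergodic_semiconj ⟨hJ, rfl⟩ hνe H.measurable H.semiconj_stripChart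
  refine ⟨μ, ν.map (stripChart p ω), hμ, Measure.isProbabilityMeasure_map hJ.aemeasurable, hμv, hvμ,
    hbase, hνφ, ?_, ?_, ?_⟩
  · rw [Measure.map_map measurable_fst hJ]
    have h1 : Prod.fst ∘ stripChart p ω = (Prod.fst : UnitAddCircle × ZMod k → _) ∘ Prod.fst := rfl
    rw [h1, ← Measure.map_map measurable_fst measurable_fst, hνπ]
    exact measurePreserving_fst.map_eq
  · have hU : MeasurableSet {z : Cylinder | ∃ j, |z.2 - p j| < ω j} := by
      have : {z : Cylinder | ∃ j, |z.2 - p j| < ω j} =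
          ⋃ j, {z : Cylinder | |z.2 - p j| < ω j} := by ext; simp
      rw [this]
      exact MeasurableSet.iUnion fun j =>
        measurableSet_lt (measurable_snd.sub_const _).abs measurable_const
    -- The chart reaches the boundary of the strips. One application of `φ`, which preserves the
    -- measure, moves all points into the open strips.
    rw [← hνφ.map_eq]
    refine (ae_map_iff hνφ.measurable.aemeasurable hU).2 ?_
    refine (ae_map_iff hJ.aemeasurable (hνφ.measurable hU)).2 (.of_forall fun w => ?_)
    exact ⟨w.1.2 + 1, H.trapped (H.abs_stripChart_sub_le w)⟩
  · filter_upwards [Measure.ae_ae_of_ae_prod hgen] with θ hθ x hx u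
    -- The index `0` has positive mass in `ZMod k`, so the almost sure statement holds for it.
    have h0 := (ae_iff_of_countable.1 hθ) 0 (uniformZMod_singleton_ne_zero 0)
    have hω := H.width_pos 0
    have hy : (x - p 0) / ω 0 ∈ Icc (-1 : ℝ) 1 := by
      rw [mem_Icc, ← abs_le, abs_div, abs_of_pos hω, div_le_one hω]
      exact hx
    have h1 := h0 ⟨(x - p 0) / ω 0, hy⟩ ⟨fun w => u (stripChart p ω w),
      u.continuous.comp continuous_stripChart⟩
    rw [integral_map hJ.aemeasurable u.continuous.measurable.aestronglyMeasurable]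
    refine h1.congr fun n => ?_
    simp only [birkhoffSum, ContinuousMap.coe_mk]
    congr 1
    refine Finset.sum_congr rfl fun j _ => ?_
    rw [(H.semiconj_stripChart.iterate_right j).eq]
    congr 2
    simp only [stripChart]
    rw [mul_div_cancel₀ _ hω.ne']
    simp

end ContractingSkewProduct

/-! ### The attractor and the SRB property -/

/-- The attractor is an intersection of forward images under a map that is neither injective nor
continuous. Their measurability is obtained from σ-compactness. -/
theorem _root_.IsSigmaCompact.measurableSet {X : Type*} [TopologicalSpace X] [T2Space X]
    [MeasurableSpace X] [OpensMeasurableSpace X] {s : Set X} (hs : IsSigmaCompact s) :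
    MeasurableSet s := by
  obtain ⟨K, hK, rfl⟩ := hs
  exact MeasurableSet.iUnion fun n => (hK n).isClosed.measurableSet

/-- The union of the open strips `|x - p j| < ω j`, projected to the fibre. -/
def stripUnion {k : ℕ} (p ω : ZMod k → ℝ) : Set ℝ := {x | ∃ j, |x - p j| < ω j}

theorem isOpen_stripUnion {k : ℕ} (p ω : ZMod k → ℝ) : IsOpen (stripUnion p ω) := by
  have : stripUnion p ω = ⋃ j, {x | |x - p j| < ω j} := by ext; simp [stripUnion]
  rw [this]
  exact isOpen_iUnion fun j => isOpen_lt (by fun_prop) continuous_const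

theorem closure_stripUnion_subset {k : ℕ} [NeZero k] (p ω : ZMod k → ℝ) :
    closure (stripUnion p ω) ⊆ {x | ∃ j, |x - p j| ≤ ω j} := by
  have h : IsClosed {x | ∃ j, |x - p j| ≤ ω j} := by
    have : {x | ∃ j, |x - p j| ≤ ω j} = ⋃ j, {x | |x - p j| ≤ ω j} := by ext; simp
    rw [this]
    exact isClosed_iUnion_of_finite fun j => isClosed_le (by fun_prop) continuous_const
  exact closure_minimal (fun x ⟨j, hj⟩ => ⟨j, hj.le⟩) h

theorem isSigmaCompact_univ_prod_stripUnion {k : ℕ} [NeZero k] (p ω : ZMod k → ℝ) :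
    IsSigmaCompact ((univ : Set UnitAddCircle) ×ˢ stripUnion p ω) := by
  have : (univ : Set UnitAddCircle) ×ˢ stripUnion p ω = ⋃ x : ZMod k × ℕ,
      univ ×ˢ Metric.closedBall (p x.1) (ω x.1 - 1 / (x.2 + 1)) := by
    ext z
    simp only [mem_prod, mem_univ, true_and, mem_iUnion, Metric.mem_closedBall, Real.dist_eq,
      Prod.exists]
    constructor
    · rintro ⟨j, hj⟩
      obtain ⟨m, hm⟩ := exists_nat_one_div_lt (sub_pos.2 hj)
      exact ⟨j, m, by linarith⟩
    · rintro ⟨j, m, h⟩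
      have : (0 : ℝ) < 1 / (m + 1) := Nat.one_div_pos_of_nat
      exact ⟨j, by linarith⟩
  rw [this]
  exact isSigmaCompact_iUnion_of_isCompact _ fun x => isCompact_univ.prod (isCompact_closedBall _ _)

namespace ContractingSkewProduct

variable {d : ℕ} {c : ℕ → ℝ} {g : ℕ → ℝ → ℝ} {σ : ℝ} {F : ℕ → ℝ × ℝ → ℝ} {k : ℕ}
  {p ω : ZMod k → ℝ} {κ : ℝ} {φ : Cylinder → Cylinder}

/-- On each half-open arc the map agrees with a globally continuous formula. Exhausting the arcs by
`[c i + 1 / (m + 1), c (i + 1)]` and the heights by `[-m, m]` gives countably many compact images.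
-/
theorem isSigmaCompact_image (H : ContractingSkewProduct d c g σ F k p ω κ φ) {A : Set Cylinder}
    (hA : IsSigmaCompact A) : IsSigmaCompact (φ '' A) := by
  obtain ⟨K, hK, rfl⟩ := hA
  have : φ '' ⋃ n, K n = ⋃ x : Fin d × ℕ × ℕ, (fun q => cover (g x.1 q.1, F x.1 q)) ''
      (cover ⁻¹' K x.2.2 ∩ Icc (c x.1 + 1 / (x.2.1 + 1)) (c (x.1 + 1)) ×ˢ
        Icc (-(x.2.1 : ℝ)) x.2.1) := by
    ext w
    simp only [mem_image, mem_iUnion]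
    constructor
    · rintro ⟨z, ⟨n, hn⟩, rfl⟩
      obtain ⟨h1, h2⟩ := H.arcIndex_spec z.1
      obtain ⟨m₁, hm₁⟩ := exists_nat_one_div_lt (sub_pos.2 h2.1)
      obtain ⟨m₂, hm₂⟩ := exists_nat_ge |z.2|
      have hc : cover (rep (c 0) z.1, z.2) = z := by rw [cover, coe_rep]
      refine ⟨(⟨_, h1⟩, max m₁ m₂, n), (rep (c 0) z.1, z.2), ⟨?_, ⟨?_, h2.2⟩, ?_⟩, ?_⟩
      · rw [mem_preimage, hc]
        exact hn
      · have : (1 : ℝ) / ((max m₁ m₂ : ℕ) + 1) ≤ 1 / (m₁ + 1) := by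
          apply one_div_le_one_div_of_le (by positivity)
          gcongr
          exact le_max_left _ _
        simp only
        linarith
      · rw [mem_Icc, ← abs_le]
        exact hm₂.trans (by exact_mod_cast le_max_right _ _)
      · exact (H.apply_eq z).symm
    · rintro ⟨⟨i, m, n⟩, q, ⟨h1, h2, h3⟩, rfl⟩
      refine ⟨cover q, ⟨n, h1⟩, ?_⟩
      have hpos : (0 : ℝ) < 1 / (m + 1) := Nat.one_div_pos_of_nat
      exact H.map_eq i i.2 q.1 ⟨by linarith [h2.1], h2.2⟩ q.2
  rw [this]
  refine isSigmaCompact_iUnion_of_isCompact _ fun x => ?_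
  refine ((isCompact_Icc.prod isCompact_Icc).inter_left
    ((hK _).isClosed.preimage continuous_cover)).image ?_
  exact continuous_cover.comp (((H.differentiable x.1.2).continuous.comp continuous_fst).prodMk
    (H.smooth_fibre _ x.1.2).continuous)

theorem isSigmaCompact_image_iterate (H : ContractingSkewProduct d c g σ F k p ω κ φ)
    {A : Set Cylinder} (hA : IsSigmaCompact A) (n : ℕ) : IsSigmaCompact (φ^[n] '' A) := by
  induction n with
  | zero => simpa using hA
  | succ n ih =>
    rw [Function.iterate_succ', image_comp]
    exact H.isSigmaCompact_image ih

theorem isProperAttractor (H : ContractingSkewProduct d c g σ F k p ω κ φ) [NeZero k] {I : Set ℝ}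
    (hI : {x | ∃ j, |x - p j| ≤ ω j} ⊂ I) :
    IsProperAttractor φ I (⋂ n : ℕ, φ^[n] '' (univ ×ˢ stripUnion p ω)) := by
  refine ⟨stripUnion p ω, isOpen_stripUnion p ω,
    lt_of_le_of_lt (closure_stripUnion_subset p ω) hI, fun z hz => ?_, rfl⟩
  obtain ⟨j, hj⟩ := closure_stripUnion_subset p ω hz.2
  exact ⟨mem_univ _, j + 1, H.trapped hj⟩

/-- By invariance, almost every point may be tested after `n` iterations, where it is the image of a
point of the trapping region. -/
theorem ae_mem_attractor (H : ContractingSkewProduct d c g σ F k p ω κ φ) [NeZero k]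
    {ν : Measure Cylinder} (hν : MeasurePreserving φ ν ν)
    (hU : ∀ᵐ z ∂ν, ∃ j, |z.2 - p j| < ω j) :
    ∀ᵐ z ∂ν, z ∈ ⋂ n : ℕ, φ^[n] '' (univ ×ˢ stripUnion p ω) := by
  simp only [mem_iInter]
  refine ae_all_iff.2 fun n => ?_
  have hm := (H.isSigmaCompact_image_iterate
    (isSigmaCompact_univ_prod_stripUnion p ω) n).measurableSet
  have hn := hν.iterate n
  rw [← hn.map_eq]
  refine (ae_map_iff hn.measurable.aemeasurable hm).2 ?_
  filter_upwards [hU] with z hz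
  exact mem_image_of_mem _ ⟨mem_univ _, hz⟩

theorem isSRB (H : ContractingSkewProduct d c g σ F k p ω κ φ) {I : Set ℝ}
    (hI : {x | ∃ j, |x - p j| ≤ ω j} ⊆ I) {μ : Measure UnitAddCircle} {ν : Measure Cylinder}
    (hν : IsProbabilityMeasure ν) (hvμ : volume ≪ μ) (hνe : Ergodic φ ν)
    (hgen : ∀ᵐ θ ∂μ, ∀ x, |x - p 0| ≤ ω 0 → ∀ u : Cylinder →ᵇ ℝ,
        Tendsto (fun n : ℕ => (∑ j ∈ Finset.range n, u (φ^[j] (θ, x))) / (n : ℝ)) atTop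
          (𝓝 (∫ w, u w ∂ν))) : IsSRB φ I ν where
  prob := hν
  ergodic := hνe
  basin_pos := by
    have h1 : ∀ᵐ θ : UnitAddCircle, θ ∈ {θ | ∀ x, |x - p 0| ≤ ω 0 → ∀ u : Cylinder →ᵇ ℝ,
        Tendsto (fun n : ℕ => (∑ j ∈ Finset.range n, u (φ^[j] (θ, x))) / (n : ℝ)) atTop
          (𝓝 (∫ w, u w ∂ν))} := hvμ.ae_le hgen
    -- The set of good base points agrees almost everywhere with the whole circle. This gives its
    -- measure without any proof that it is measurable.
    have h2 := measure_congr (eventuallyEq_univ.2 h1)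
    have hsub : {θ | ∀ x, |x - p 0| ≤ ω 0 → ∀ u : Cylinder →ᵇ ℝ,
        Tendsto (fun n : ℕ => (∑ j ∈ Finset.range n, u (φ^[j] (θ, x))) / (n : ℝ)) atTop
          (𝓝 (∫ w, u w ∂ν))} ×ˢ Metric.closedBall (p 0) (ω 0) ⊆ basin φ I ν := by
      rintro ⟨θ, x⟩ ⟨hθ, hx⟩
      rw [Metric.mem_closedBall, Real.dist_eq] at hx
      exact ⟨hI ⟨0, hx⟩, fun u => hθ x hx u⟩
    refine lt_of_lt_of_le ?_ (measure_mono hsub)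
    rw [Measure.volume_eq_prod, Measure.prod_prod, Real.volume_closedBall]
    refine ENNReal.mul_pos (fun h => ?_) (by simpa using H.width_pos 0)
    have h3 := h2.symm.trans h
    simp at h3

end ContractingSkewProduct

/-! ### The derivative cocycle -/

theorem cover_add_int (q : ℝ × ℝ) (m : ℤ) : cover (q + ((m : ℝ), 0)) = cover q := by
  refine Prod.ext ?_ (by simp [cover])
  simp only [cover, Prod.fst_add, AddCircle.coe_add]
  have : ((m : ℝ) : UnitAddCircle) = 0 := by
    have := AddCircle.coe_eq_zero_iff (1 : ℝ) (x := (m : ℝ))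
    exact this.2 ⟨m, by simp⟩
  rw [this, add_zero]

theorem HasCylinderDerivAt.id (z : Cylinder) :
    HasCylinderDerivAt id z (ContinuousLinearMap.id ℝ (ℝ × ℝ)) :=
  ⟨rep 0 z.1, _root_.id, coe_rep 0 z.1, .of_forall fun _ => rfl, hasFDerivAt_id _⟩

/-- The chain rule on the cylinder. -/
theorem HasCylinderDerivAt.comp {ψ₁ ψ₂ : Cylinder → Cylinder} {z : Cylinder}
    {L₁ L₂ : (ℝ × ℝ) →L[ℝ] (ℝ × ℝ)} (h₂ : HasCylinderDerivAt ψ₂ (ψ₁ z) L₂)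
    (h₁ : HasCylinderDerivAt ψ₁ z L₁) : HasCylinderDerivAt (ψ₂ ∘ ψ₁) z (L₂.comp L₁) := by
  obtain ⟨t₁, Ψ₁, ht₁, he₁, hd₁⟩ := h₁
  obtain ⟨t₂, Ψ₂, ht₂, he₂, hd₂⟩ := h₂
  have hz : cover (t₁, z.2) = z := by rw [cover, ht₁]
  have h0 : cover (Ψ₁ (t₁, z.2)) = ψ₁ z := by rw [he₁.self_of_nhds, hz]
  have h1 : ((Ψ₁ (t₁, z.2)).1 : UnitAddCircle) = t₂ := by
    rw [ht₂, ← h0]; rfl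
  have h2 : (Ψ₁ (t₁, z.2)).2 = (ψ₁ z).2 := by rw [← h0]; rfl
  -- The two lifts may use different representatives of the intermediate point. They differ by an
  -- integer `m`, and translating the first lift by it allows composition.
  have h3 : ((t₂ - (Ψ₁ (t₁, z.2)).1 : ℝ) : UnitAddCircle) = 0 := by
    rw [AddCircle.coe_sub, h1, sub_self]
  obtain ⟨m, hm⟩ := (AddCircle.coe_eq_zero_iff (1 : ℝ)).1 h3
  have h4 : Ψ₁ (t₁, z.2) + ((m : ℝ), 0) = (t₂, (ψ₁ z).2) := by
    refine Prod.ext ?_ (by simpa using h2)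
    simp only [Prod.fst_add]
    simp only [zsmul_eq_mul, mul_one] at hm
    linarith
  have hd₁' : HasFDerivAt (fun q => Ψ₁ q + ((m : ℝ), 0)) L₁ (t₁, z.2) := hd₁.add_const _
  refine ⟨t₁, fun q => Ψ₂ (Ψ₁ q + ((m : ℝ), 0)), ht₁, ?_, ?_⟩
  · have hc : Tendsto (fun q => Ψ₁ q + ((m : ℝ), 0)) (𝓝 (t₁, z.2)) (𝓝 (t₂, (ψ₁ z).2)) := by
      rw [← h4]
      exact hd₁'.continuousAt
    filter_upwards [he₁, hc.eventually he₂] with q hq hq2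
    rw [hq2, cover_add_int, hq]
    rfl
  · rw [← h4] at hd₂
    exact hd₂.comp (t₁, z.2) hd₁'

/-- The derivative of the base map. -/
noncomputable def baseDeriv (d : ℕ) (c : ℕ → ℝ) (g : ℕ → ℝ → ℝ) (θ : UnitAddCircle) : ℝ :=
  deriv (g (arcIndex d c θ)) (rep (c 0) θ)

/-- The derivative of the fibre coordinate. -/
noncomputable def fibreFDeriv (d : ℕ) (c : ℕ → ℝ) (F : ℕ → ℝ × ℝ → ℝ) (z : Cylinder) :
    (ℝ × ℝ) →L[ℝ] ℝ :=
  fderiv ℝ (F (arcIndex d c z.1)) (rep (c 0) z.1, z.2)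

/-- The derivative of the `n`-th iterate of the skew product. -/
noncomputable def cocycle (d : ℕ) (c : ℕ → ℝ) (g : ℕ → ℝ → ℝ) (F : ℕ → ℝ × ℝ → ℝ)
    (φ : Cylinder → Cylinder) (z : Cylinder) : ℕ → (ℝ × ℝ) →L[ℝ] (ℝ × ℝ)
  | 0 => ContinuousLinearMap.id ℝ (ℝ × ℝ)
  | n + 1 => ((baseDeriv d c g (φ^[n] z).1 • ContinuousLinearMap.fst ℝ ℝ ℝ).prod
      (fibreFDeriv d c F (φ^[n] z))).comp (cocycle d c g F φ z n)

namespace ContractingSkewProduct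

variable {d : ℕ} {c : ℕ → ℝ} {g : ℕ → ℝ → ℝ} {σ : ℝ} {F : ℕ → ℝ × ℝ → ℝ} {k : ℕ}
  {p ω : ZMod k → ℝ} {κ : ℝ} {φ : Cylinder → Cylinder}

theorem hasCylinderDerivAt (H : ContractingSkewProduct d c g σ F k p ω κ φ) {z : Cylinder}
    (hz : z.1 ∉ arcEnds d c) : HasCylinderDerivAt φ z
      ((baseDeriv d c g z.1 • ContinuousLinearMap.fst ℝ ℝ ℝ).prod (fibreFDeriv d c F z)) := by
  have hi := (H.arcIndex_spec z.1).1
  refine ⟨rep (c 0) z.1, _, coe_rep _ _,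
    H.eventually_lift hi (rep_mem_Ioo H.toExpandingBranches hz) z.2, ?_⟩
  have h1 : HasFDerivAt (fun q : ℝ × ℝ => g (arcIndex d c z.1) q.1)
      (baseDeriv d c g z.1 • ContinuousLinearMap.fst ℝ ℝ ℝ) (rep (c 0) z.1, z.2) :=
    HasDerivAt.comp_hasFDerivAt (rep (c 0) z.1, z.2)
      (H.differentiable hi (rep (c 0) z.1)).hasDerivAt hasFDerivAt_fst
  exact h1.prodMk (((H.smooth_fibre _ hi).differentiable (by norm_num)) _).hasFDerivAt

theorem hasCylinderDerivAt_iterate (H : ContractingSkewProduct d c g σ F k p ω κ φ) {z : Cylinder}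
    (hz : ∀ n, (φ^[n] z).1 ∉ arcEnds d c) (n : ℕ) :
    HasCylinderDerivAt (φ^[n]) z (cocycle d c g F φ z n) := by
  induction n with
  | zero => exact HasCylinderDerivAt.id z
  | succ n ih =>
    rw [Function.iterate_succ']
    exact (H.hasCylinderDerivAt (hz n)).comp ih

theorem le_baseDeriv (H : ContractingSkewProduct d c g σ F k p ω κ φ) (θ : UnitAddCircle) :
    σ ≤ baseDeriv d c g θ := by
  obtain ⟨h1, h2⟩ := H.arcIndex_spec θ
  exact H.le_deriv _ h1 _ (Ioc_subset_Icc_self h2)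

theorem measurable_baseDeriv (H : ContractingSkewProduct d c g σ F k p ω κ φ) :
    Measurable (baseDeriv d c g) := by
  refine H.measurable_piecewise (Y := UnitAddCircle) (Z := ℝ) (q := fun θ => θ)
    (f := fun i θ => deriv (g i) (rep (c 0) θ)) measurable_id fun i hi => ?_
  exact ((H.smooth i hi).continuous_deriv (by norm_num)).measurable.comp (measurable_rep _)

theorem exists_baseDeriv_le (H : ContractingSkewProduct d c g σ F k p ω κ φ) :
    ∃ M, ∀ θ, baseDeriv d c g θ ≤ M := by
  have h : ∀ i : Fin d, ∃ M, ∀ t ∈ Icc (c i) (c (i + 1)), ‖deriv (g i) t‖ ≤ M := fun i =>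
    isCompact_Icc.exists_bound_of_continuousOn
      ((H.smooth i i.2).continuous_deriv (by norm_num)).continuousOn
  choose M hM using h
  refine ⟨∑ i, |M i|, fun θ => ?_⟩
  obtain ⟨h1, h2⟩ := H.arcIndex_spec θ
  calc baseDeriv d c g θ ≤ M ⟨_, h1⟩ :=
        (le_abs_self _).trans (hM ⟨_, h1⟩ _ (Ioc_subset_Icc_self h2))
    _ ≤ |M ⟨_, h1⟩| := le_abs_self _
    _ ≤ ∑ i, |M i| := Finset.single_le_sum (fun i _ => abs_nonneg (M i)) (Finset.mem_univ _)

theorem measurable_fibreFDeriv (H : ContractingSkewProduct d c g σ F k p ω κ φ) (v : ℝ × ℝ) :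
    Measurable fun z => fibreFDeriv d c F z v := by
  refine H.measurable_piecewise (Y := Cylinder) (Z := ℝ) (q := Prod.fst)
    (f := fun i z => fderiv ℝ (F i) (rep (c 0) z.1, z.2) v) measurable_fst fun i hi => ?_
  have h1 : Measurable fun q => fderiv ℝ (F i) q v :=
    (((H.smooth_fibre i hi).continuous_fderiv (by norm_num)).clm_apply continuous_const).measurable
  exact h1.comp (((measurable_rep _).comp measurable_fst).prodMk measurable_snd)

theorem abs_fibreFDeriv_le (H : ContractingSkewProduct d c g σ F k p ω κ φ) {z : Cylinder}
    {j : ZMod k} (hz : |z.2 - p j| ≤ ω j) :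
    |fibreFDeriv d c F z (0, 1)| ≤ κ * (ω (j + 1) / ω j) := by
  obtain ⟨h1, h2⟩ := H.arcIndex_spec z.1
  exact H.contraction _ h1 _ h2 j _ hz

theorem exists_fibreFDeriv_le (H : ContractingSkewProduct d c g σ F k p ω κ φ) [NeZero k] :
    ∃ M, 0 ≤ M ∧ ∀ z : Cylinder, ∀ j, |z.2 - p j| ≤ ω j → |fibreFDeriv d c F z (1, 0)| ≤ M := by
  set R := ∑ j, (|p j| + ω j) with hR
  have h : ∀ i : Fin d, ∃ M, ∀ q ∈ Icc (c i) (c (i + 1)) ×ˢ Icc (-R) R,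
      ‖fderiv ℝ (F i) q (1, 0)‖ ≤ M := fun i =>
    (isCompact_Icc.prod isCompact_Icc).exists_bound_of_continuousOn
      (((H.smooth_fibre i i.2).continuous_fderiv (by norm_num)).clm_apply
        continuous_const).continuousOn
  choose M hM using h
  refine ⟨∑ i, |M i|, Finset.sum_nonneg fun i _ => abs_nonneg _, fun z j hz => ?_⟩
  obtain ⟨h1, h2⟩ := H.arcIndex_spec z.1
  have h3 : |p j| + ω j ≤ R := Finset.single_le_sum (f := fun j => |p j| + ω j)
    (fun i _ => add_nonneg (abs_nonneg _) (H.width_pos i).le) (Finset.mem_univ j)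
  have h4 : |z.2| ≤ R := by
    have := abs_sub_abs_le_abs_sub z.2 (p j)
    linarith
  calc |fibreFDeriv d c F z (1, 0)| ≤ M ⟨_, h1⟩ :=
        hM ⟨_, h1⟩ (rep (c 0) z.1, z.2) ⟨Ioc_subset_Icc_self h2, abs_le.1 h4⟩
    _ ≤ |M ⟨_, h1⟩| := le_abs_self _
    _ ≤ ∑ i, |M i| := Finset.single_le_sum (fun i _ => abs_nonneg (M i)) (Finset.mem_univ _)

theorem trapped_iterate (H : ContractingSkewProduct d c g σ F k p ω κ φ) {z : Cylinder}
    {j : ZMod k} (hz : |z.2 - p j| ≤ ω j) (n : ℕ) :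
    |(φ^[n] z).2 - p (j + n)| ≤ ω (j + n) := by
  induction n with
  | zero => simpa using hz
  | succ n ih =>
    rw [Function.iterate_succ_apply', Nat.cast_succ, ← add_assoc]
    exact (H.trapped ih).le

/-- The derivative of a skew product is lower triangular, so the base alone drives the first
component. -/
theorem cocycle_fst (v : ℝ × ℝ) (z : Cylinder) (n : ℕ) :
    (cocycle d c g F φ z n v).1 =
      v.1 * ∏ m ∈ Finset.range n, baseDeriv d c g (φ^[m] z).1 := by
  induction n with
  | zero => simp [cocycle]
  | succ n ih =>
    rw [Finset.prod_range_succ]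
    simp only [cocycle, ContinuousLinearMap.comp_apply, ContinuousLinearMap.prod_apply,
      smul_apply, ContinuousLinearMap.coe_fst', smul_eq_mul, ih]
    ring

theorem cocycle_snd_succ (v : ℝ × ℝ) (z : Cylinder) (n : ℕ) :
    (cocycle d c g F φ z (n + 1) v).2 =
      (cocycle d c g F φ z n v).1 * fibreFDeriv d c F (φ^[n] z) (1, 0) +
      (cocycle d c g F φ z n v).2 * fibreFDeriv d c F (φ^[n] z) (0, 1) := by
  simp only [cocycle, ContinuousLinearMap.comp_apply, ContinuousLinearMap.prod_apply]
  set w := cocycle d c g F φ z n v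
  have : w = w.1 • ((1 : ℝ), (0 : ℝ)) + w.2 • ((0 : ℝ), (1 : ℝ)) := by ext <;> simp
  conv_lhs => rw [this]
  rw [map_add, map_smul, map_smul, smul_eq_mul, smul_eq_mul]

theorem cocycle_vertical (s : ℝ) (z : Cylinder) (n : ℕ) :
    cocycle d c g F φ z n (0, s) =
      (0, s * ∏ m ∈ Finset.range n, fibreFDeriv d c F (φ^[m] z) (0, 1)) := by
  induction n with
  | zero => simp [cocycle]
  | succ n ih =>
    refine Prod.ext (by rw [cocycle_fst]; simp) ?_
    rw [cocycle_snd_succ, ih, Finset.prod_range_succ]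
    ring

/-- The ratios of consecutive widths telescope along the orbit. -/
theorem abs_prod_fibreFDeriv_le (H : ContractingSkewProduct d c g σ F k p ω κ φ) {z : Cylinder}
    {j : ZMod k} (hz : |z.2 - p j| ≤ ω j) (n : ℕ) :
    |∏ m ∈ Finset.range n, fibreFDeriv d c F (φ^[m] z) (0, 1)| ≤ κ ^ n * (ω (j + n) / ω j) := by
  have h0 := H.width_pos j
  induction n with
  | zero => simp [h0.ne']
  | succ n ih =>
    have h1 := H.width_pos (j + n)
    have h2 := H.width_pos (j + n + 1)
    have hκ := H.rate_pos
    rw [Finset.prod_range_succ, abs_mul, Nat.cast_succ, ← add_assoc]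
    calc _ ≤ κ ^ n * (ω (j + n) / ω j) * (κ * (ω (j + n + 1) / ω (j + n))) := by
          gcongr
          exact H.abs_fibreFDeriv_le (H.trapped_iterate hz n)
      _ = κ ^ (n + 1) * (ω (j + n + 1) / ω j) := by field_simp; ring

/-- The growth of non-vertical vectors is governed by the base. -/
theorem exists_norm_cocycle_le (H : ContractingSkewProduct d c g σ F k p ω κ φ) [NeZero k]
    {z : Cylinder} {j : ZMod k} (hz : |z.2 - p j| ≤ ω j) {v : ℝ × ℝ} (hv : v.1 ≠ 0) :
    ∃ C : ℝ, 0 < C ∧ ∀ n, ‖cocycle d c g F φ z n v‖ ≤ C * |(cocycle d c g F φ z n v).1| := by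
  obtain ⟨M, hM0, hM⟩ := H.exists_fibreFDeriv_le
  have hκ := H.rate_pos
  have hκ1 := H.rate_lt_one
  have hω := H.width_pos
  have hS0 : 0 ≤ ∑ i, (ω i)⁻¹ := Finset.sum_nonneg fun i _ => (inv_pos.2 (hω i)).le
  -- The aim is a slope bound `|w| ≤ B ω |u|` for the components `(u, w)` of the image vector. The
  -- first summand of `B` accommodates the initial vector. The second makes `M ≤ B (1 - κ) ω i`, so
  -- that the shear is absorbed by the contraction.
  set B := |v.2| / (ω j * |v.1|) + M * (∑ i, (ω i)⁻¹) / (1 - κ) with hB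
  have hv1 : 0 < |v.1| := abs_pos.2 hv
  have h1κ : 0 < 1 - κ := by linarith
  have hj := hω j
  have hB0 : 0 ≤ B := by positivity
  have hBM : ∀ i, M ≤ B * (1 - κ) * ω i := by
    intro i
    have h1 : (ω i)⁻¹ ≤ ∑ i, (ω i)⁻¹ :=
      Finset.single_le_sum (fun i _ => (inv_pos.2 (hω i)).le) (Finset.mem_univ i)
    have hi := hω i
    have h2 : M * (∑ i, (ω i)⁻¹) ≤ B * (1 - κ) := by
      rw [hB, add_mul, div_mul_cancel₀ _ h1κ.ne']
      have : 0 ≤ |v.2| / (ω j * |v.1|) * (1 - κ) := by positivity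
      linarith
    calc M = M * (ω i)⁻¹ * ω i := by field_simp
      _ ≤ M * (∑ i, (ω i)⁻¹) * ω i := by gcongr
      _ ≤ B * (1 - κ) * ω i := by gcongr
  have hgrow : ∀ n, |(cocycle d c g F φ z n v).2| ≤
      B * ω (j + n) * |(cocycle d c g F φ z n v).1| := by
    intro n
    induction n with
    | zero =>
      simp only [cocycle, ContinuousLinearMap.id_apply, Nat.cast_zero, add_zero]
      have h2 : |v.2| / (ω j * |v.1|) ≤ B := by
        rw [hB]
        have : 0 ≤ M * (∑ i, (ω i)⁻¹) / (1 - κ) := by positivity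
        linarith
      rwa [div_le_iff₀ (by positivity), ← mul_assoc] at h2
    | succ n ih =>
      rw [cocycle_snd_succ]
      -- Base expansion keeps `|u|` from decreasing, so a bound relative to the old first component
      -- is also one relative to the new.
      have hu : |(cocycle d c g F φ z n v).1| ≤ |(cocycle d c g F φ z (n + 1) v).1| := by
        rw [cocycle_fst, cocycle_fst, Finset.prod_range_succ, ← mul_assoc, abs_mul (_ * _)]
        refine le_mul_of_one_le_right (abs_nonneg _) ?_
        exact (H.one_lt.le.trans (H.le_baseDeriv _)).trans (le_abs_self _)
      have h1 := hM (φ^[n] z) (j + n) (H.trapped_iterate hz n)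
      have h2 := H.abs_fibreFDeriv_le (H.trapped_iterate hz n)
      have h3 := hω (j + n)
      have h4 := hω (j + n + 1)
      rw [Nat.cast_succ, ← add_assoc]
      set u := (cocycle d c g F φ z n v).1
      set w := (cocycle d c g F φ z n v).2
      calc _ ≤ |u * fibreFDeriv d c F (φ^[n] z) (1, 0)| +
              |w * fibreFDeriv d c F (φ^[n] z) (0, 1)| := abs_add_le _ _
        _ ≤ |u| * M + B * ω (j + n) * |u| * (κ * (ω (j + n + 1) / ω (j + n))) := by
            rw [abs_mul, abs_mul]; gcongr
        _ = (M + κ * B * ω (j + n + 1)) * |u| := by field_simp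
        _ ≤ (B * ω (j + n + 1)) * |u| := by
            have := hBM (j + n + 1)
            gcongr
            linarith
        _ ≤ _ := by gcongr
  have hω2 : ∀ i, ω i ≤ ∑ i, ω i := fun i =>
    Finset.single_le_sum (fun i _ => (hω i).le) (Finset.mem_univ i)
  have hSω : 0 ≤ ∑ i, ω i := Finset.sum_nonneg fun i _ => (hω i).le
  refine ⟨1 + B * ∑ i, ω i, by positivity, fun n => ?_⟩
  rw [Prod.norm_def, Real.norm_eq_abs, Real.norm_eq_abs]
  have h5 := abs_nonneg (cocycle d c g F φ z n v).1
  refine max_le ?_ ((hgrow n).trans ?_)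
  · exact le_mul_of_one_le_left h5 (by linarith [mul_nonneg hB0 hSω])
  · gcongr
    have := mul_le_mul_of_nonneg_left (hω2 (j + n)) hB0
    linarith

end ContractingSkewProduct

/-! ### Lyapunov exponents -/

theorem log_enorm_div {E : Type*} [NormedAddCommGroup E] {x : E} (hx : x ≠ 0) (n : ℕ) :
    ENNReal.log ‖x‖ₑ / (n : EReal) = ((Real.log ‖x‖ / n : ℝ) : EReal) := by
  rw [← ofReal_norm, ENNReal.log_ofReal_of_pos (norm_pos_iff.2 hx), EReal.coe_div,
    EReal.coe_natCast]

theorem hasExponent_of_tendsto {L : ℕ → (ℝ × ℝ) →L[ℝ] (ℝ × ℝ)} {v : ℝ × ℝ} {χ : ℝ}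
    (h0 : ∀ n, L n v ≠ 0) (h : Tendsto (fun n => Real.log ‖L n v‖ / n) atTop (𝓝 χ)) :
    HasExponent L v (χ : EReal) := by
  unfold HasExponent
  simp only [log_enorm_div (h0 _)]
  exact EReal.tendsto_coe.2 h

/-- The decrement `b - log |x|`, with `log 0 = -∞`. -/
noncomputable def logDecrement (b x : ℝ) : ENNReal :=
  if x = 0 then ⊤ else ENNReal.ofReal (b - Real.log |x|)

theorem measurable_logDecrement (b : ℝ) : Measurable (logDecrement b) :=
  Measurable.ite (measurableSet_singleton 0) measurable_const
    (measurable_const.sub (Real.measurable_log.comp measurable_id.abs)).ennreal_ofReal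

/-- Subtracting the logarithms from an upper bound `b` leaves terms in `[0, ∞]`, which can be summed
without cancellation. A vanishing factor gives `-∞` on both sides. -/
theorem log_enorm_prod_div {w : ℕ → ℝ} {b : ℝ} (hw : ∀ m, w m ≠ 0 → Real.log |w m| ≤ b) {s : ℝ}
    (hs : s ≠ 0) {n : ℕ} (hn : 0 < n) :
    ENNReal.log ‖s * ∏ m ∈ Finset.range n, w m‖ₑ / (n : EReal) =
      ((b + Real.log |s| / n : ℝ) : EReal) -
        (((∑ m ∈ Finset.range n, logDecrement b (w m)) / n : ENNReal) : EReal) := by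
  have hn0 : (0 : ℝ) < n := Nat.cast_pos.2 hn
  by_cases h0 : ∀ m ∈ Finset.range n, w m ≠ 0
  · have hP : ∏ m ∈ Finset.range n, w m ≠ 0 := Finset.prod_ne_zero_iff.2 h0
    have h1 : ∀ m ∈ Finset.range n, 0 ≤ b - Real.log |w m| := fun m hm =>
      sub_nonneg.2 (hw m (h0 m hm))
    have h2 : ∑ m ∈ Finset.range n, logDecrement b (w m) =
        ENNReal.ofReal (∑ m ∈ Finset.range n, (b - Real.log |w m|)) := by
      rw [ENNReal.ofReal_sum_of_nonneg h1]
      exact Finset.sum_congr rfl fun m hm => if_neg (h0 m hm)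
    rw [log_enorm_div (mul_ne_zero hs hP), h2, ← ENNReal.ofReal_natCast,
      ← ENNReal.ofReal_div_of_pos hn0, EReal.coe_ennreal_ofReal,
      max_eq_left (div_nonneg (Finset.sum_nonneg h1) hn0.le), ← EReal.coe_sub]
    congr 1
    rw [Real.norm_eq_abs, abs_mul, Finset.abs_prod,
      Real.log_mul (abs_pos.2 hs).ne' (Finset.prod_ne_zero_iff.2 fun m hm => (abs_pos.2 (h0 m hm)).ne'),
      Real.log_prod (fun m hm => (abs_pos.2 (h0 m hm)).ne'),
      Finset.sum_sub_distrib, Finset.sum_const, Finset.card_range, nsmul_eq_mul]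
    field_simp
    ring
  · push Not at h0
    obtain ⟨m, hm, h0⟩ := h0
    have h1 : ∑ m ∈ Finset.range n, logDecrement b (w m) = ⊤ :=
      ENNReal.sum_eq_top.2 ⟨m, hm, if_pos h0⟩
    rw [Finset.prod_eq_zero hm h0, mul_zero, enorm_zero, ENNReal.log_zero, h1,
      ENNReal.top_div_of_ne_top (ENNReal.natCast_ne_top n), EReal.coe_ennreal_top,
      EReal.sub_top]
    exact EReal.bot_div_of_pos_ne_top (by exact_mod_cast hn) (EReal.natCast_ne_top n)

theorem tendsto_log_enorm_prod_div {w : ℕ → ℝ} {b : ℝ} (hw : ∀ m, w m ≠ 0 → Real.log |w m| ≤ b)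
    {s : ℝ} (hs : s ≠ 0) {a : ENNReal}
    (ha : Tendsto (fun n : ℕ => (∑ m ∈ Finset.range n, logDecrement b (w m)) / n) atTop (𝓝 a)) :
    Tendsto (fun n : ℕ => ENNReal.log ‖s * ∏ m ∈ Finset.range n, w m‖ₑ / (n : EReal)) atTop
      (𝓝 ((b : EReal) - (a : EReal))) := by
  have h1 : Tendsto (fun n : ℕ => ((b + Real.log |s| / n : ℝ) : EReal)) atTop (𝓝 (b : EReal)) := by
    refine EReal.tendsto_coe.2 ?_
    simpa using (tendsto_const_nhds (x := b)).add
      (tendsto_const_div_atTop_nhds_zero_nat (Real.log |s|))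
  have h2 : Tendsto (fun n : ℕ => -((((∑ m ∈ Finset.range n, logDecrement b (w m)) / n : ENNReal))
      : EReal)) atTop (𝓝 (-(a : EReal))) :=
    (continuous_neg.tendsto _).comp (EReal.tendsto_coe_ennreal.2 ha)
  -- Addition in `EReal` is continuous at this point because `b` is finite, even if `a = ∞`.
  have h3 := (EReal.continuousAt_add (p := ((b : EReal), -(a : EReal)))
    (.inl (EReal.coe_ne_top b)) (.inl (EReal.coe_ne_bot b))).tendsto.comp (h1.prodMk_nhds h2)
  rw [sub_eq_add_neg]
  refine h3.congr' ?_
  filter_upwards [eventually_gt_atTop 0] with n hn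
  rw [log_enorm_prod_div hw hs hn, sub_eq_add_neg]
  rfl

namespace ContractingSkewProduct

variable {d : ℕ} {c : ℕ → ℝ} {g : ℕ → ℝ → ℝ} {σ : ℝ} {F : ℕ → ℝ × ℝ → ℝ} {k : ℕ}
  {p ω : ZMod k → ℝ} {κ : ℝ} {φ : Cylinder → Cylinder}

theorem fst_iterate (H : ContractingSkewProduct d c g σ F k p ω κ φ) (z : Cylinder) (n : ℕ) :
    (φ^[n] z).1 = (baseMap φ)^[n] z.1 := by
  have : Function.Semiconj Prod.fst φ (baseMap φ) := H.fst_apply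
  exact (this.iterate_right n).eq z

theorem exists_abs_fibreFDeriv_le (H : ContractingSkewProduct d c g σ F k p ω κ φ) [NeZero k] :
    ∃ B, ∀ z : Cylinder, ∀ j, |z.2 - p j| ≤ ω j → |fibreFDeriv d c F z (0, 1)| ≤ B := by
  have hω := H.width_pos
  have hκ := H.rate_pos
  refine ⟨∑ j, κ * (ω (j + 1) / ω j), fun z j hz => (H.abs_fibreFDeriv_le hz).trans ?_⟩
  exact Finset.single_le_sum (f := fun j => κ * (ω (j + 1) / ω j))
    (fun i _ => (mul_pos hκ (div_pos (hω _) (hω _))).le) (Finset.mem_univ j)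

variable {μ : Measure UnitAddCircle} {ν : Measure Cylinder}

theorem ae_iterate_notMem_arcEnds
    (hμv : μ ≪ volume) (hν : MeasurePreserving φ ν ν) (hmap : ν.map Prod.fst = μ) :
    ∀ᵐ z ∂ν, ∀ n, (φ^[n] z).1 ∉ arcEnds d c := by
  have h0 : ∀ᵐ θ ∂μ, θ ∉ arcEnds d c := by
    refine hμv.ae_le (compl_mem_ae_iff.2 ?_)
    rw [← biUnion_of_singleton (arcEnds d c)]
    refine (measure_biUnion_null_iff (finite_arcEnds d c).countable).2 fun x _ => ?_
    rw [← Metric.closedBall_zero, AddCircle.volume_closedBall]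
    simp
  rw [← hmap] at h0
  have h1 : ∀ᵐ z ∂ν, z.1 ∉ arcEnds d c := ae_of_ae_map measurable_fst.aemeasurable h0
  refine ae_all_iff.2 fun n => ?_
  have hn := hν.iterate n
  rw [← hn.map_eq] at h1
  exact ae_of_ae_map hn.measurable.aemeasurable h1

theorem integrable_log_baseDeriv (H : ContractingSkewProduct d c g σ F k p ω κ φ)
    [IsProbabilityMeasure μ] : Integrable (fun θ => Real.log (baseDeriv d c g θ)) μ := by
  obtain ⟨M, hM⟩ := H.exists_baseDeriv_le
  refine Integrable.of_bound
    (Real.measurable_log.comp H.measurable_baseDeriv).aestronglyMeasurable (Real.log M)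
    (.of_forall fun θ => ?_)
  have h1 := H.one_lt.le.trans (H.le_baseDeriv θ)
  rw [Real.norm_eq_abs, abs_of_nonneg (Real.log_nonneg h1)]
  exact Real.log_le_log (by linarith) (hM θ)

theorem log_le_integral_log_baseDeriv (H : ContractingSkewProduct d c g σ F k p ω κ φ)
    [IsProbabilityMeasure μ] : Real.log σ ≤ ∫ θ, Real.log (baseDeriv d c g θ) ∂μ := by
  have h := integral_mono (μ := μ) (integrable_const (Real.log σ)) H.integrable_log_baseDeriv
    fun θ => Real.log_le_log (zero_lt_one.trans H.one_lt) (H.le_baseDeriv θ)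
  simpa using h

/-- The norm lies between the first component and a constant multiple of it. The logarithm of the
first component is, up to a constant, a Birkhoff sum of the base. -/
theorem hasExponent_of_fst_ne_zero (H : ContractingSkewProduct d c g σ F k p ω κ φ) [NeZero k]
    {z : Cylinder} {j : ZMod k} (hz : |z.2 - p j| ≤ ω j) {v : ℝ × ℝ} (hv : v.1 ≠ 0) {χ : ℝ}
    (hχ : Tendsto (fun n : ℕ =>
      birkhoffSum (baseMap φ) (fun θ => Real.log (baseDeriv d c g θ)) n z.1 / n) atTop (𝓝 χ)) :
    HasExponent (cocycle d c g F φ z) v (χ : EReal) := by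
  obtain ⟨C, hC, hle⟩ := H.exists_norm_cocycle_le hz hv
  have hpos : ∀ θ, 0 < baseDeriv d c g θ := fun θ =>
    (zero_lt_one.trans H.one_lt).trans_le (H.le_baseDeriv θ)
  have hu0 : ∀ n, (cocycle d c g F φ z n v).1 ≠ 0 := fun n => by
    rw [cocycle_fst]
    exact mul_ne_zero hv (Finset.prod_ne_zero_iff.2 fun m _ => (hpos _).ne')
  have hu : ∀ n, Real.log |(cocycle d c g F φ z n v).1| = Real.log |v.1| +
      birkhoffSum (baseMap φ) (fun θ => Real.log (baseDeriv d c g θ)) n z.1 := by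
    intro n
    rw [cocycle_fst, abs_mul, Finset.abs_prod, Real.log_mul (abs_pos.2 hv).ne'
      (Finset.prod_ne_zero_iff.2 fun m _ => (abs_pos.2 (hpos _).ne').ne'),
      Real.log_prod (fun m _ => (abs_pos.2 (hpos _).ne').ne')]
    simp only [birkhoffSum, H.fst_iterate, Real.log_abs]
  have hn0 : ∀ n, cocycle d c g F φ z n v ≠ 0 := fun n h => hu0 n (by rw [h]; rfl)
  refine hasExponent_of_tendsto hn0 ?_
  have hlim : ∀ a : ℝ, Tendsto (fun n : ℕ =>
      (a + Real.log |(cocycle d c g F φ z n v).1|) / n) atTop (𝓝 χ) := by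
    intro a
    have := (tendsto_const_div_atTop_nhds_zero_nat (a + Real.log |v.1|)).add hχ
    rw [zero_add] at this
    refine this.congr fun n => ?_
    rw [hu]
    ring
  refine tendsto_of_tendsto_of_tendsto_of_le_of_le (hlim 0) (hlim (Real.log C)) (fun n => ?_)
    fun n => ?_
  · simp only [zero_add]
    gcongr
    · exact abs_pos.2 (hu0 n)
    · exact norm_fst_le (cocycle d c g F φ z n v)
  · simp only
    rw [← Real.log_mul hC.ne' (abs_pos.2 (hu0 n)).ne']
    gcongr
    · exact norm_pos_iff.2 (hn0 n)
    · exact hle n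

theorem hasExponent_vertical (H : ContractingSkewProduct d c g σ F k p ω κ φ)
    {b : ℝ} (hb : ∀ z : Cylinder, ∀ j, |z.2 - p j| ≤ ω j → fibreFDeriv d c F z (0, 1) ≠ 0 →
      Real.log |fibreFDeriv d c F z (0, 1)| ≤ b)
    {z : Cylinder} {j : ZMod k} (hz : |z.2 - p j| ≤ ω j) {s : ℝ} (hs : s ≠ 0) {a : ENNReal}
    (ha : Tendsto (fun n : ℕ => birkhoffSum φ
      (fun z => logDecrement b (fibreFDeriv d c F z (0, 1))) n z / n) atTop (𝓝 a)) :
    HasExponent (cocycle d c g F φ z) (0, s) ((b : EReal) - (a : EReal)) := by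
  have h1 := tendsto_log_enorm_prod_div (w := fun m => fibreFDeriv d c F (φ^[m] z) (0, 1)) (b := b)
    (fun m => hb _ _ (H.trapped_iterate hz m)) hs ha
  refine h1.congr fun n => ?_
  rw [cocycle_vertical]
  congr 2
  rw [← ofReal_norm, ← ofReal_norm, Prod.norm_mk, norm_zero,
    max_eq_right (norm_nonneg _)]

/-- Vertical vectors have norm at most `C κ ^ n`, so the exponent is at most `log κ`. The comparison
in `EReal` also covers `-∞`. -/
theorem vertical_exponent_neg (H : ContractingSkewProduct d c g σ F k p ω κ φ) [NeZero k]
    {z : Cylinder} {j : ZMod k} (hz : |z.2 - p j| ≤ ω j) {χ : EReal}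
    (hχ : HasExponent (cocycle d c g F φ z) (0, 1) χ) : χ < 0 := by
  have hω := H.width_pos
  have hκ := H.rate_pos
  set C := (∑ i, ω i) / ω j with hC
  have hsum : ∀ i, ω i ≤ ∑ i, ω i := fun i =>
    Finset.single_le_sum (fun i _ => (hω i).le) (Finset.mem_univ i)
  have hC0 : 0 < C := div_pos ((hω j).trans_le (hsum j)) (hω j)
  have hlim : Tendsto (fun n : ℕ => ((Real.log C / n + Real.log κ : ℝ) : EReal)) atTop
      (𝓝 (Real.log κ : EReal)) := by
    refine EReal.tendsto_coe.2 ?_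
    simpa using (tendsto_const_div_atTop_nhds_zero_nat (Real.log C)).add_const (Real.log κ)
  refine (le_of_tendsto_of_tendsto hχ hlim ?_).trans_lt
    (by exact_mod_cast Real.log_neg hκ H.rate_lt_one)
  filter_upwards [eventually_gt_atTop 0] with n hn
  have hn0 : (0 : ℝ) < n := Nat.cast_pos.2 hn
  have h1 : ‖cocycle d c g F φ z n (0, 1)‖ ≤ C * κ ^ n := by
    rw [cocycle_vertical, one_mul, Prod.norm_mk, norm_zero, max_eq_right (norm_nonneg _),
      Real.norm_eq_abs]
    refine (H.abs_prod_fibreFDeriv_le hz n).trans ?_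
    rw [mul_comm]
    gcongr
    exact div_le_div_of_nonneg_right (hsum _) (hω j).le
  calc ENNReal.log ‖cocycle d c g F φ z n (0, 1)‖ₑ / (n : EReal)
      ≤ ENNReal.log (ENNReal.ofReal (C * κ ^ n)) / (n : EReal) := by
        refine EReal.div_le_div_right_of_nonneg (by exact_mod_cast hn.le) (ENNReal.log_le_log ?_)
        rw [← ofReal_norm]
        exact ENNReal.ofReal_le_ofReal h1
    _ = _ := by
        rw [ENNReal.log_ofReal_of_pos (by positivity), ← EReal.coe_natCast, ← EReal.coe_div,
          Real.log_mul hC0.ne' (by positivity), Real.log_pow]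
        congr 1
        field_simp

/-- The line is the vertical one at every point. The stable exponent is `log B` minus the integral
of the decrement, which may be infinite. -/
theorem isHyperbolicMeasure (H : ContractingSkewProduct d c g σ F k p ω κ φ) [NeZero k]
    [IsProbabilityMeasure μ] [IsProbabilityMeasure ν] (hμv : μ ≪ volume)
    (hμ : Ergodic (baseMap φ) μ) (hν : Ergodic φ ν) (hmap : ν.map Prod.fst = μ)
    (hU : ∀ᵐ z ∂ν, ∃ j, |z.2 - p j| < ω j) : IsHyperbolicMeasure φ ν := by
  obtain ⟨B, hB⟩ := H.exists_abs_fibreFDeriv_le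
  have hb : ∀ z : Cylinder, ∀ j, |z.2 - p j| ≤ ω j → fibreFDeriv d c F z (0, 1) ≠ 0 →
      Real.log |fibreFDeriv d c F z (0, 1)| ≤ Real.log B := fun z j hz h0 =>
    Real.log_le_log (abs_pos.2 h0) (hB z j hz)
  have h1 := ae_tendsto_birkhoffSum_div hμ
    (Real.measurable_log.comp H.measurable_baseDeriv) H.integrable_log_baseDeriv
  have h2 := ae_tendsto_birkhoffSum_div_ennreal hν
    ((measurable_logDecrement (Real.log B)).comp (H.measurable_fibreFDeriv (0, 1)))
  rw [← hmap] at h1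
  replace h1 := ae_of_ae_map measurable_fst.aemeasurable h1
  rw [hmap] at h1
  have h3 := ae_iterate_notMem_arcEnds (d := d) (c := c) hμv hν.toMeasurePreserving hmap
  set a := ∫⁻ z, (logDecrement (Real.log B) ∘ fun z => fibreFDeriv d c F z (0, 1)) z ∂ν
  refine ⟨(Real.log B : EReal) - (a : EReal), ∫ θ, Real.log (baseDeriv d c g θ) ∂μ, ?_,
    (Real.log_pos H.one_lt).trans_le H.log_le_integral_log_baseDeriv, ?_⟩
  -- The stable exponent does not depend on the point, so its sign can be read off at a single
  -- generic one.
  · obtain ⟨z, hz2, j, hj⟩ := (h2.and hU).exists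
    exact H.vertical_exponent_neg hj.le (H.hasExponent_vertical hb hj.le one_ne_zero hz2)
  · filter_upwards [h1, h2, h3, hU] with z hz1 hz2 hz3 ⟨j, hj⟩
    have hmem : ∀ v : ℝ × ℝ, v ∈ Submodule.span ℝ {((0 : ℝ), (1 : ℝ))} ↔ v.1 = 0 := by
      intro v
      rw [Submodule.mem_span_singleton]
      constructor
      · rintro ⟨s, rfl⟩
        simp
      · intro h
        exact ⟨v.2, by ext <;> simp [h]⟩
    refine ⟨cocycle d c g F φ z, H.hasCylinderDerivAt_iterate hz3,
      Submodule.span ℝ {((0 : ℝ), (1 : ℝ))}, finrank_span_singleton (by simp), ?_, ?_⟩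
    · intro v hv hv0
      rw [hmem] at hv
      have hv2 : v = (0, v.2) := Prod.ext hv rfl
      have hs : v.2 ≠ 0 := fun h => hv0 (Prod.ext hv h)
      rw [hv2]
      exact H.hasExponent_vertical hb hj.le hs hz2
    · intro v hv
      rw [hmem] at hv
      exact H.hasExponent_of_fst_ne_zero hj.le hv hz1

theorem hasHyperbolicSRB (H : ContractingSkewProduct d c g σ F k p ω κ φ) [NeZero k] {I : Set ℝ}
    (hφ : MapsTo φ (univ ×ˢ I) (univ ×ˢ I)) (hI : {x | ∃ j, |x - p j| ≤ ω j} ⊂ I) :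
    HasHyperbolicSRBOnProperAttractor φ I := by
  obtain ⟨μ, ν, hμ, hν, hμv, hvμ, hμe, hνe, hmap, hU, hgen⟩ := H.exists_measure
  exact ⟨hφ, ν, H.isSRB hI.subset hν hvμ hνe hgen, H.isHyperbolicMeasure hμv hμe hνe hmap hU,
    _, H.isProperAttractor hI, H.ae_mem_attractor hνe.toMeasurePreserving hU⟩

end ContractingSkewProduct

/-! ### Trapping strips around an attracting periodic orbit -/

/-- The condition `f k = f 0` is what lets the index wrap around from `k - 1` to `0`. -/
theorem val_add_one_eq {α : Type*} {k : ℕ} [NeZero k] {f : ℕ → α} (hf : f k = f 0) (j : ZMod k) :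
    f (j + 1).val = f (j.val + 1) := by
  have hj := ZMod.val_lt j
  have h1 : (j + 1).val = (j.val + 1) % k := by
    conv_lhs => rw [← ZMod.natCast_zmod_val j, ← Nat.cast_succ, ZMod.val_natCast]
  rw [h1]
  rcases Nat.lt_or_ge (j.val + 1) k with h | h
  · rw [Nat.mod_eq_of_lt h]
  · have : j.val + 1 = k := by omega
    rw [this, Nat.mod_self, hf]

/-- If the product of `m` over a period is less than `1`, then there are weights along the period
relative to which `m` is a uniform contraction. -/
theorem exists_weights {k : ℕ} [NeZero k] {m : ℕ → ℝ} (hm : ∀ i, 0 < m i)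
    (h : ∏ i ∈ Finset.range k, m i < 1) : ∃ κ : ℝ, 0 < κ ∧ κ < 1 ∧ ∃ w : ZMod k → ℝ,
      (∀ j, 0 < w j) ∧ ∀ j, m j.val * w j = κ * w (j + 1) := by
  have hP : 0 < ∏ i ∈ Finset.range k, m i := Finset.prod_pos fun i _ => hm i
  have hk : (k : ℝ) ≠ 0 := Nat.cast_ne_zero.2 (NeZero.ne k)
  -- The rate is the geometric mean of the multipliers. The weights are the partial products divided
  -- by powers of this mean, and they close up because `κ ^ k` is the full product.
  set κ : ℝ := (∏ i ∈ Finset.range k, m i) ^ (k : ℝ)⁻¹ with hκ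
  have hκ0 : 0 < κ := Real.rpow_pos_of_pos hP _
  have hκk : κ ^ k = ∏ i ∈ Finset.range k, m i := Real.rpow_inv_natCast_pow hP.le (NeZero.ne k)
  let W : ℕ → ℝ := fun n => (∏ i ∈ Finset.range n, m i) / κ ^ n
  have hW : W k = W 0 := by simp [W, hκk, hP.ne']
  refine ⟨κ, hκ0, Real.rpow_lt_one hP.le h (by positivity), fun j => W j.val,
    fun j => div_pos (Finset.prod_pos fun i _ => hm i) (pow_pos hκ0 _), fun j => ?_⟩
  simp only
  rw [val_add_one_eq hW]
  simp only [W, Finset.prod_range_succ]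
  field_simp
  ring

theorem hasDerivAt_quad (a₀ x : ℝ) : HasDerivAt (quad a₀) (-2 * x) x := by
  have h := (hasDerivAt_pow 2 x).const_sub a₀
  have h2 : -((2 : ℕ) * x ^ (2 - 1)) = -2 * x := by norm_num
  rw [h2] at h
  exact h

theorem continuous_quad (a₀ : ℝ) : Continuous (quad a₀) := by unfold quad; fun_prop

theorem hasDerivAt_quad_iterate (a₀ x : ℝ) (n : ℕ) :
    HasDerivAt ((quad a₀)^[n]) (∏ i ∈ Finset.range n, (-2 * (quad a₀)^[i] x)) x := by
  induction n with
  | zero => simpa using hasDerivAt_id x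
  | succ n ih =>
    rw [Function.iterate_succ', Finset.prod_range_succ, mul_comm]
    exact (hasDerivAt_quad a₀ _).comp x ih

theorem abs_quad_sub_le (a₀ x y : ℝ) :
    |quad a₀ x - quad a₀ y| ≤ (|2 * y| + |x - y|) * |x - y| := by
  have h1 : quad a₀ x - quad a₀ y = -((2 * y + (x - y)) * (x - y)) := by unfold quad; ring
  rw [h1, abs_neg, abs_mul]
  gcongr
  exact abs_add_le _ _

/-- A hyperbolic quadratic interval map has an attracting periodic point. -/
theorem exists_attractingPeriodicPt {a₀ l r : ℝ} (hlr : l < r)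
    (hI : MapsTo (quad a₀) (Icc l r) (Icc l r)) (hhyp : IsHyperbolicOn (quad a₀) (Icc l r)) :
    ∃ x, x ∈ attractingPeriodicPts (quad a₀) (Icc l r) := by
  by_contra! hno
  obtain ⟨-, C, hC, σ, hσ, h⟩ := hhyp
  have hexp : ∀ x ∈ Icc l r, ∀ n : ℕ, C * σ ^ n ≤ |deriv ((quad a₀)^[n]) x| := fun x hx =>
    h x ⟨hx, fun ⟨_, y, hy, _⟩ => hno y hy⟩
  -- The iterate maps an interval into itself, so its mean slope has absolute value at most one, and
  -- the slope is the derivative at some point. Exponential growth is then impossible.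
  have hlen : ∀ n : ℕ, C * σ ^ n ≤ 1 := by
    intro n
    have hd : Differentiable ℝ ((quad a₀)^[n]) := fun x =>
      (hasDerivAt_quad_iterate a₀ x n).differentiableAt
    obtain ⟨x, hx, hx2⟩ := exists_deriv_eq_slope ((quad a₀)^[n]) hlr hd.continuous.continuousOn
      hd.differentiableOn
    refine (hexp x (Ioo_subset_Icc_self hx) n).trans ?_
    have h1 := hI.iterate n (left_mem_Icc.2 hlr.le)
    have h2 := hI.iterate n (right_mem_Icc.2 hlr.le)
    rw [hx2, abs_div, abs_of_pos (sub_pos.2 hlr), div_le_one (sub_pos.2 hlr), abs_le]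
    constructor <;> linarith [h1.1, h1.2, h2.1, h2.2]
  obtain ⟨n, hn⟩ := pow_unbounded_of_one_lt (1 / C) hσ
  rw [div_lt_iff₀ hC] at hn
  linarith [hlen n]

/-- A neighbourhood of an attracting periodic orbit which is trapped and contracted by all maps
close to `quad a₀`. -/
theorem exists_trapping_strips {a₀ l r : ℝ} (hI : MapsTo (quad a₀) (Icc l r) (Ioo l r)) {x₀ : ℝ}
    (hx₀ : x₀ ∈ attractingPeriodicPts (quad a₀) (Icc l r)) :
    ∃ (k : ℕ) (_ : NeZero k) (p ω : ZMod k → ℝ) (κ η : ℝ), 0 < κ ∧ κ < 1 ∧ 0 < η ∧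
      (∀ j, 0 < ω j) ∧ {x | ∃ j, |x - p j| ≤ ω j} ⊂ Icc l r ∧
      (∀ j x y, |x - p j| ≤ ω j → |y - quad a₀ x| < η → |y - p (j + 1)| < ω (j + 1)) ∧
      ∀ j x a, |x - p j| ≤ ω j → |a + 2 * x| < η → |a| ≤ κ * (ω (j + 1) / ω j) := by
  obtain ⟨hxI, k, hk, hper, hder⟩ := hx₀
  have : NeZero k := ⟨hk.ne'⟩
  let f : ℕ → ℝ := fun n => (quad a₀)^[n] x₀
  have hfk : f k = f 0 := hper
  -- By periodicity `x₀` is itself an image under `h`, so it too lies in the interior.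
  have hfI : ∀ n, f n ∈ Ioo l r := by
    have hI' : MapsTo (quad a₀) (Icc l r) (Icc l r) := fun x hx => Ioo_subset_Icc_self (hI hx)
    have hsucc : ∀ n, f (n + 1) ∈ Ioo l r := fun n => by
      simp only [f, Function.iterate_succ_apply']
      exact hI (hI'.iterate n hxI)
    intro n
    cases n with
    | zero =>
      rw [← hfk]
      obtain ⟨m, rfl⟩ := Nat.exists_eq_succ_of_ne_zero hk.ne'
      exact hsucc m
    | succ n => exact hsucc n
  -- The multipliers along the orbit can all be enlarged by `δ` with product still below one. Half
  -- of `δ` will pay for the strip width and half for the perturbation of the derivative.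
  obtain ⟨δ, hδ0, hδ⟩ : ∃ δ : ℝ, 0 < δ ∧ ∏ i ∈ Finset.range k, (|2 * f i| + δ) < 1 := by
    have hc : Continuous fun δ : ℝ => ∏ i ∈ Finset.range k, (|2 * f i| + δ) := by fun_prop
    have h0 : ∏ i ∈ Finset.range k, (|2 * f i| + 0) < 1 := by
      rw [(hasDerivAt_quad_iterate a₀ x₀ k).deriv, Finset.abs_prod] at hder
      simpa [f, abs_mul] using hder
    have h1 : ∀ᶠ δ : ℝ in 𝓝[>] 0, ∏ i ∈ Finset.range k, (|2 * f i| + δ) < 1 :=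
      ((hc.tendsto 0).eventually_lt_const h0).filter_mono nhdsWithin_le_nhds
    obtain ⟨δ, h2, h3⟩ := (h1.and self_mem_nhdsWithin).exists
    exact ⟨δ, h3, h2⟩
  obtain ⟨κ, hκ0, hκ1, w, hw0, hw⟩ := exists_weights (k := k)
    (m := fun i => |2 * f i| + δ) (fun i => by positivity) hδ
  let p : ZMod k → ℝ := fun j => f j.val
  have hp : ∀ j, p (j + 1) = quad a₀ (p j) := fun j => by
    simp only [p]
    rw [val_add_one_eq hfk]
    simp only [f, Function.iterate_succ_apply']
  obtain ⟨s, hs0, hs⟩ : ∃ s : ℝ, 0 < s ∧ ∀ j, 2 * (s * w j) < δ / 2 ∧ s * w j < p j - l ∧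
      s * w j < r - p j := by
    have h1 : ∀ᶠ s : ℝ in 𝓝[>] 0, ∀ j, 2 * (s * w j) < δ / 2 ∧ s * w j < p j - l ∧
        s * w j < r - p j := by
      refine eventually_all.2 fun j => ?_
      have h2 : Tendsto (fun s : ℝ => s * w j) (𝓝[>] 0) (𝓝 0) := by
        have : Continuous fun s : ℝ => s * w j := by fun_prop
        simpa using (this.tendsto 0).mono_left nhdsWithin_le_nhds
      have h3 : Tendsto (fun s : ℝ => 2 * (s * w j)) (𝓝[>] 0) (𝓝 0) := by
        simpa using h2.const_mul 2
      have h4 := hfI j.val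
      exact (h3.eventually_lt_const (by linarith)).and
        ((h2.eventually_lt_const (sub_pos.2 h4.1)).and (h2.eventually_lt_const (sub_pos.2 h4.2)))
    obtain ⟨s, h2, h3⟩ := (h1.and self_mem_nhdsWithin).exists
    exact ⟨s, h3, h2⟩
  -- The unperturbed image of a strip fills at most the fraction `κ` of the next one. The remaining
  -- `1 - κ` is the tolerance for values.
  obtain ⟨η, hη0, hη⟩ : ∃ η : ℝ, 0 < η ∧ ∀ j, η < δ / 2 ∧ η < (1 - κ) * (s * w j) := by
    have h1 : ∀ᶠ η : ℝ in 𝓝[>] 0, ∀ j, η < δ / 2 ∧ η < (1 - κ) * (s * w j) := by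
      refine eventually_all.2 fun j => ?_
      have h2 : Tendsto (fun η : ℝ => η) (𝓝[>] 0) (𝓝 0) :=
        tendsto_id.mono_left nhdsWithin_le_nhds
      exact (h2.eventually_lt_const (by linarith)).and
        (h2.eventually_lt_const (mul_pos (sub_pos.2 hκ1) (mul_pos hs0 (hw0 j))))
    obtain ⟨η, h2, h3⟩ := (h1.and self_mem_nhdsWithin).exists
    exact ⟨η, h3, h2⟩
  have hmul : ∀ j, (|2 * p j| + δ) * (s * w j) = κ * (s * w (j + 1)) := fun j => by
    have := hw j
    simp only [p]
    linear_combination s * this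
  refine ⟨k, this, p, fun j => s * w j, κ, η, hκ0, hκ1, hη0, fun j => mul_pos hs0 (hw0 j),
    ⟨?_, fun h => ?_⟩, ?_, ?_⟩
  · rintro x ⟨j, hj⟩
    obtain ⟨-, h2, h3⟩ := hs j
    rw [abs_le] at hj
    constructor <;> linarith [hj.1, hj.2]
  -- The strips keep away from the end point `l`, so the inclusion in `[l, r]` is strict.
  · obtain ⟨j, hj⟩ := h (left_mem_Icc.2 ((hfI 0).1.trans (hfI 0).2).le)
    rw [abs_le] at hj
    linarith [hj.1, (hs j).2.1]
  · intro j x y hx hy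
    have h1 := abs_quad_sub_le a₀ x (p j)
    have h2 : (|2 * p j| + |x - p j|) * |x - p j| ≤ (|2 * p j| + δ) * (s * w j) := by
      have h3 := (hs j).1
      have h4 := mul_pos hs0 (hw0 j)
      simp only at hx
      gcongr
      linarith
    rw [hmul] at h2
    have h5 := abs_add_le (y - quad a₀ x) (quad a₀ x - quad a₀ (p j))
    rw [sub_add_sub_cancel] at h5
    have h6 := (hη (j + 1)).2
    rw [hp]
    linarith
  · intro j x a hx ha
    simp only at hx ⊢
    have h4 := mul_pos hs0 (hw0 j)
    rw [← mul_div_assoc, ← hmul, mul_div_cancel_right₀ _ h4.ne']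
    have h1 := abs_sub (a + 2 * x) (2 * x)
    rw [add_sub_cancel_right] at h1
    have h2 : |2 * x| ≤ |2 * p j| + 2 * |x - p j| := by
      have := abs_add_le (2 * p j) (2 * (x - p j))
      rw [abs_mul 2 (x - p j), abs_two] at this
      refine le_of_eq_of_le ?_ this
      congr 1
      ring
    linarith [(hs j).1, (hη j).1]

/-- The image of `I` is compact in the open interior, hence at positive distance from the
complement. -/
theorem exists_invariance_margin {a₀ l r : ℝ}
    (hI : MapsTo (quad a₀) (Icc l r) (Ioo l r)) :
    ∃ η > 0, ∀ x ∈ Icc l r, ∀ y, |y - quad a₀ x| < η → y ∈ Icc l r := by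
  have hK : IsCompact (quad a₀ '' Icc l r) := isCompact_Icc.image (continuous_quad a₀)
  obtain ⟨η, hη, h⟩ := hK.exists_thickening_subset_open isOpen_Ioo hI.image_subset
  refine ⟨η, hη, fun x hx y hy => Ioo_subset_Icc_self (h ?_)⟩
  exact Metric.mem_thickening_iff.2 ⟨_, mem_image_of_mem _ hx, hy⟩

/-! ### From closeness to contracting skew products -/

theorem exists_rescale_eq {d : ℕ} (hd : 0 < d) {c : ℕ → ℝ} {i : ℕ} (hc : c i < c (i + 1)) {t : ℝ}
    (ht : t ∈ Icc (c i) (c (i + 1))) :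
    ∃ s ∈ Icc ((i : ℝ) / d) ((i + 1 : ℝ) / d), rescale d c i s = t := by
  have hd0 : (0 : ℝ) < d := Nat.cast_pos.2 hd
  have hc0 := sub_pos.2 hc
  have h1 : 0 ≤ (t - c i) / (c (i + 1) - c i) := div_nonneg (by linarith [ht.1]) hc0.le
  have h2 : (t - c i) / (c (i + 1) - c i) ≤ 1 := (div_le_one hc0).2 (by linarith [ht.2])
  refine ⟨(i + (t - c i) / (c (i + 1) - c i)) / d, ⟨?_, ?_⟩, ?_⟩
  · gcongr
    linarith
  · gcongr
  · unfold rescale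
    field_simp
    ring

namespace IsC3CloseVia

variable {d : ℕ} {a₀ α ε : ℝ} {I : Set ℝ} {φ : Cylinder → Cylinder} {c : ℕ → ℝ} {G : ℕ → ℝ → ℝ}
  {F : ℕ → ℝ × ℝ → ℝ}

/-- The forcing term is bounded by `α`, so forcing and perturbation add up to one displacement of
the fibre map from `h`. -/
theorem abs_sub_quad_lt (H : IsC3CloseVia d a₀ α ε I φ c G F) (hα : 0 ≤ α) {i : ℕ} (hi : i < d)
    {t : ℝ} (ht : t ∈ Icc (c i) (c (i + 1))) {x : ℝ} (hx : x ∈ I) :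
    |F i (t, x) - quad a₀ x| < α + ε := by
  obtain ⟨s, hs, rfl⟩ := exists_rescale_eq (i.zero_le.trans_lt hi) (H.partition_lt i hi) ht
  have h := H.close_fiber i hi 0 (by norm_num) s hs x hx
  rw [norm_iteratedFDeriv_zero, Real.norm_eq_abs] at h
  have h1 : |α * Real.sin (2 * Real.pi * s)| ≤ α := by
    rw [abs_mul, abs_of_nonneg hα]
    exact mul_le_of_le_one_right hα (Real.abs_sin_le_one _)
  have h2 := abs_add_le (F i (rescale d c i s, x) -
    (a₀ + α * Real.sin (2 * Real.pi * s) - x ^ 2)) (α * Real.sin (2 * Real.pi * s))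
  have h3 : F i (rescale d c i s, x) - quad a₀ x = F i (rescale d c i s, x) -
    (a₀ + α * Real.sin (2 * Real.pi * s) - x ^ 2) + α * Real.sin (2 * Real.pi * s) := by
    unfold quad; ring
  rw [h3]
  linarith

/-- The forcing does not depend on `x`, so it drops out of the fibre derivative and the error is `ε`
alone. -/
theorem abs_fderiv_add_lt (H : IsC3CloseVia d a₀ α ε I φ c G F) {i : ℕ} (hi : i < d)
    {t : ℝ} (ht : t ∈ Icc (c i) (c (i + 1))) {x : ℝ} (hx : x ∈ I) :
    |fderiv ℝ (F i) (t, x) (0, 1) + 2 * x| < ε := by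
  obtain ⟨s, hs, rfl⟩ := exists_rescale_eq (i.zero_le.trans_lt hi) (H.partition_lt i hi) ht
  have h := H.close_fiber i hi 1 (by norm_num) s hs x hx
  rw [norm_iteratedFDeriv_one] at h
  have hF : Differentiable ℝ (F i) := (H.smooth_fiber i hi).differentiable (by norm_num)
  have hr : Differentiable ℝ fun q : ℝ × ℝ => rescale d c i q.1 := by unfold rescale; fun_prop
  set f : ℝ × ℝ → ℝ := fun q => F i (rescale d c i q.1, q.2)
      - (a₀ + α * Real.sin (2 * Real.pi * q.1) - q.2 ^ 2) with hf
  have hfd : Differentiable ℝ f :=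
    (hF.comp (hr.prodMk differentiable_snd)).sub (by fun_prop)
  have hy : HasDerivAt (fun y : ℝ => (s, y)) (0, 1) x := (hasDerivAt_const x s).prodMk (hasDerivAt_id x)
  have hy' : HasDerivAt (fun y : ℝ => (rescale d c i s, y)) (0, 1) x :=
    (hasDerivAt_const x _).prodMk (hasDerivAt_id x)
  have h1 : HasDerivAt (fun y => f (s, y)) (fderiv ℝ f (s, x) (0, 1)) x :=
    (hfd (s, x)).hasFDerivAt.comp_hasDerivAt x hy
  have h2 : HasDerivAt (fun y => f (s, y)) (fderiv ℝ (F i) (rescale d c i s, x) (0, 1) + 2 * x) x := by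
    have h3 := (hF (rescale d c i s, x)).hasFDerivAt.comp_hasDerivAt x hy'
    have h4 := h3.sub ((hasDerivAt_pow 2 x).const_sub (a₀ + α * Real.sin (2 * Real.pi * s)))
    have h5 : ∀ b : ℝ, b - -((2 : ℕ) * x ^ (2 - 1)) = b + 2 * x := fun b => by norm_num
    rw [h5] at h4
    exact h4
  rw [h2.unique h1, ← Real.norm_eq_abs]
  refine lt_of_le_of_lt ((fderiv ℝ f (s, x)).le_opNorm (0, 1)) ?_
  simpa [Prod.norm_mk] using h

/-- Subtracting `i` from the `i`-th branch normalizes all branches to the same fundamental domain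
and changes nothing on the circle. -/
theorem exists_contractingSkewProduct (H : IsC3CloseVia d a₀ α ε I φ c G F) (hα : 0 ≤ α) {k : ℕ}
    {p ω : ZMod k → ℝ} {κ η : ℝ} (hκ0 : 0 < κ) (hκ1 : κ < 1) (hη : α + ε ≤ η)
    (hω : ∀ j, 0 < ω j) (hI : {x | ∃ j, |x - p j| ≤ ω j} ⊆ I)
    (htrap : ∀ j x y, |x - p j| ≤ ω j → |y - quad a₀ x| < η → |y - p (j + 1)| < ω (j + 1))
    (hcontr : ∀ j x a, |x - p j| ≤ ω j → |a + 2 * x| < η → |a| ≤ κ * (ω (j + 1) / ω j)) :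
    ∃ σ, ContractingSkewProduct d c (fun i t => G i t - i) σ F k p ω κ φ := by
  obtain ⟨σ, hσ, hexp⟩ := H.expanding
  refine ⟨σ, ?_⟩
  exact
    { total := H.partition_total
      lt := H.partition_lt
      left := fun i hi => by rw [H.markov_left i hi, add_sub_cancel_right]
      right := fun i hi => by rw [H.markov_right i hi]; ring
      smooth := fun i hi => ((H.smooth_base i hi).of_le (by norm_num)).sub contDiff_const
      one_lt := hσ
      le_deriv := fun i hi t ht => by rw [deriv_sub_const]; exact hexp i hi t ht
      map_eq := fun i hi t ht x => by
        rw [H.map_eq i hi t ht x, AddCircle.coe_sub]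
        have : ((i : ℝ) : UnitAddCircle) = 0 := (AddCircle.coe_eq_zero_iff 1).2 ⟨i, by simp⟩
        rw [this, sub_zero]
      smooth_fibre := fun i hi => (H.smooth_fiber i hi).of_le (by norm_num)
      width_pos := hω
      rate_pos := hκ0
      rate_lt_one := hκ1
      trapping := fun i hi t ht j x hx => htrap j x _ hx
        ((H.abs_sub_quad_lt hα hi (Ioc_subset_Icc_self ht) (hI ⟨j, hx⟩)).trans_le hη)
      contraction := fun i hi t ht j x hx => hcontr j x _ hx
        ((H.abs_fderiv_add_lt hi (Ioc_subset_Icc_self ht) (hI ⟨j, hx⟩)).trans_le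
          (by linarith)) }

end IsC3CloseVia

/-- With equal arcs the unperturbed map has zero error for every `ε`, so the statement for
perturbations covers it. -/
theorem isC3Close_vianaMap {d : ℕ} (hd : 2 ≤ d) (a₀ α : ℝ) {ε : ℝ} (hε : 0 < ε) (I : Set ℝ) :
    IsC3Close d a₀ α ε I (vianaMap d a₀ α) := by
  have hd0 : (0 : ℝ) < d := by positivity
  have hr : ∀ i t, rescale d (fun i => (i : ℝ) / d) i t = t := by
    intro i t
    unfold rescale
    push_cast
    field_simp
    ring
  refine ⟨fun i => i / d, fun _ t => d * t,
    fun _ q => a₀ + α * Real.sin (2 * Real.pi * q.1) - q.2 ^ 2, ?_⟩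
  exact
    { partition_total := by simp [hd0.ne']
      partition_lt := fun i _ => by gcongr; simp
      map_eq := fun i _ t _ x => by
        simp only [vianaMap, circleSin_coe]
        rw [← AddCircle.coe_nsmul, nsmul_eq_mul]
      markov_left := fun i _ => by simp; field_simp
      markov_right := fun i _ => by push_cast; field_simp; ring
      smooth_base := fun i _ => by fun_prop
      smooth_fiber := fun i _ => by fun_prop
      expanding := ⟨d, by exact_mod_cast hd, fun i _ t _ => by
        rw [deriv_const_mul_field, deriv_id'', mul_one]⟩
      close_base := fun i _ k _ t _ => by
        simp only [hr, sub_self]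
        simpa using hε
      close_fiber := fun i _ k _ t _ x _ => by
        simp only [hr, sub_self]
        simpa using hε }

/-- The threshold `η` depends on `h` and `I` only, being the smaller of the tolerances for trapping
in the strips and for invariance of `I`. -/
theorem exists_forall_isC3Close_hasHyperbolicSRB {a₀ l r : ℝ} (hlr : l < r)
    (hI : MapsTo (quad a₀) (Icc l r) (Ioo l r)) (hhyp : IsHyperbolicOn (quad a₀) (Icc l r)) :
    ∃ η : ℝ, 0 < η ∧ ∀ (d : ℕ) (α ε : ℝ) (φ : Cylinder → Cylinder), 0 ≤ α → α + ε ≤ η →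
      IsC3Close d a₀ α ε (Icc l r) φ → HasHyperbolicSRBOnProperAttractor φ (Icc l r) := by
  obtain ⟨x₀, hx₀⟩ := exists_attractingPeriodicPt hlr
    (fun x hx => Ioo_subset_Icc_self (hI hx)) hhyp
  obtain ⟨k, _, p, ω, κ, η₁, hκ0, hκ1, hη₁, hω, hstrip, htrap, hcontr⟩ :=
    exists_trapping_strips hI hx₀
  obtain ⟨η₂, hη₂, hinv⟩ := exists_invariance_margin hI
  refine ⟨min η₁ η₂, lt_min hη₁ hη₂, fun d α ε φ hα hle ⟨c, G, F, H⟩ => ?_⟩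
  obtain ⟨σ, hS⟩ := H.exists_contractingSkewProduct hα hκ0 hκ1 (hle.trans (min_le_left _ _)) hω
    hstrip.subset htrap hcontr
  refine hS.hasHyperbolicSRB (fun z hz => ⟨mem_univ _, ?_⟩) hstrip
  obtain ⟨hi, ht⟩ := hS.arcIndex_spec z.1
  rw [hS.apply_eq]
  exact hinv z.2 hz.2 _
    ((H.abs_sub_quad_lt hα hi (Ioc_subset_Icc_self ht) hz.2).trans_le (hle.trans (min_le_right _ _)))

end Viana

theorem corollaryE (d : ℕ) (hd : 2 ≤ d) (a₀ l r : ℝ) (hlr : l < r)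
    (hI : Set.MapsTo (Viana.quad a₀) (Set.Icc l r) (Set.Ioo l r))
    (hhyp : Viana.IsHyperbolicOn (Viana.quad a₀) (Set.Icc l r)) :
    ∃ α₀ : ℝ, 0 < α₀ ∧ ∀ α : ℝ, 0 < α → α < α₀ →
      Viana.HasHyperbolicSRBOnProperAttractor (Viana.vianaMap d a₀ α) (Set.Icc l r) ∧
      ∃ ε : ℝ, 0 < ε ∧ ∀ φ : Viana.Cylinder → Viana.Cylinder,
        Viana.IsC3Close d a₀ α ε (Set.Icc l r) φ →
          Viana.HasHyperbolicSRBOnProperAttractor φ (Set.Icc l r) := by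
  obtain ⟨η, hη, h⟩ := Viana.exists_forall_isC3Close_hasHyperbolicSRB hlr hI hhyp
  -- Half of the tolerance goes to the forcing and half to the perturbation, so here `ε` does not
  -- even depend on `α`.
  refine ⟨η / 2, half_pos hη, fun α hα hα' => ⟨?_, η / 2, half_pos hη, fun φ hφ => ?_⟩⟩
  · exact h d α (η / 2) _ hα.le (by linarith)
      (Viana.isC3Close_vianaMap hd a₀ α (half_pos hη) (Set.Icc l r))
  · exact h d α (η / 2) φ hα.le (by linarith) hφ
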